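/- **Setting.** Let $f:[0,\infty)\to[0,\infty)$ be lower semicontinuous and nondecreasing with $\lim_{t\to0^+}f(t)/t=\alpha>0$ and $\lim_{t\to\infty}f(t)=\beta>0$. Let $d\ge1$, $1<p<\infty$, let $\Omega\subset\mathbb R^d$ be open and bounded, and let $W:\mathbb R^{d\times d}\to\mathbb R$ be convex on the symmetric matrices, with $W(0)=0$ and $c|M|^p\le W(M)\le C(1+|M|^p)$ for all symmetric $M$, where $c>0$ and $C$ are constants. Write $\mathcal Eu=\frac12(\nabla u+\nabla u^T)$, let ⨍ denote an average integral, and for $\varepsilon>0$ and $A\subset\Omega$ open put $$F_\varepsilon(u,A)=\frac1\varepsilon\int_A f\Big(\varepsilon\,\frac{1}{\mathcal L^d(B_\varepsilon(x)\cap\Omega)}\int_{B_\varepsilon(x)\cap\Omega}W(\mathcal Eu)\,dy\Big)dx\quad\text{if }u\in W^{1,p}(\Omega;\mathbb R^d),\qquad F_\varepsilon(u,A)=+\infty\text{ otherwise.}$$ $GSBV(A;\mathbb R^d)$ is the set of measurable $v$ such that $\varphi\circ v\in SBV_{\rm loc}(A)$ for every $\varphi\in C^1(\mathbb R^d)$ for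 which $\nabla\varphi$ has compact support. $GSBV^p(A;\mathbb R^d)$ is the set of those $v\in GSBV(A;\mathbb R^d)$ whose approximate gradient $\nabla v$ is in $L^p(A)$ and whose jump set $J_v\subset A$ has $\mathcal H^{d-1}(J_v)<\infty$; for such $v$, $\mathcal Ev$ is the symmetric part of $\nabla v$. **Proposition.** For every $f$ as above and every $\delta\in(0,1)$ there are constants $M_\delta\ge 0$ and $a,b>0$, depending only on $f$ and $\delta$, with $a\ge\alpha(1-\delta)$ and $\min\{at,b\}\le f(t)$ for all $t\ge0$, such that the following holds for all $d,p,W,\Omega$ as above. Let $A$ be open with $A\subset\subset\Omega$. Let $\varepsilon$ range over positive parameters tending to $0$ (for instance a sequence $\varepsilon_j\to0$, or all $\varepsilon>0$; in general a family $(\varepsilon_i)_{i\in I}$ of positive numbers that tends to $0$ along a filter on $I$), and let $u_\varepsilon\in W^{1,p}(\Omega;\mathbb R^d)$ with $u_\varepsilon\to u$ in $L^1(\Omega;\mathbb R^d)$. Then there are functions $v_\varepsilon^\delta\in GSBV^p(A;\mathbb R^d)\cap L^1(A;\mathbb R^d)$ such that * (i) $\displaystyle\alpha(1-\delta)^{2d+1}\int_A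 W(\mathcal Ev_\varepsilon^\delta)\,dx\le F_\varepsilon(u_\varepsilon,A)$ for every $\varepsilon$; * (ii) $\displaystyle\mathcal H^{d-1}(J_{v_\varepsilon^\delta})\le M_\delta\,F_\varepsilon(u_\varepsilon,A)$ for every $\varepsilon$; * (iii) $v_\varepsilon^\delta\to u$ in $L^1(A;\mathbb R^d)$ as $\varepsilon\to0$. Moreover, if $F_\varepsilon(u_\varepsilon,A)$ stays bounded as $\varepsilon\to0$, the $v_\varepsilon^\delta$ can be chosen so that in addition, for every $\varepsilon$ such that $B_\varepsilon(x)\subset\Omega$ for all $x\in A$, there is $\delta'_\varepsilon\in(0,\delta\varepsilon)$ with $$v_\varepsilon^\delta(x)=\frac{1}{\mathcal L^d(B_{(1-\delta)\varepsilon}(x))}\int_{B_{(1-\delta)\varepsilon}(x)}u_\varepsilon\,dy\ \text{ for }x\in A\setminus K'_\varepsilon,\qquad v_\varepsilon^\delta=0\ \text{ on }K'_\varepsilon,$$ where $K'_\varepsilon=\{x\in A:\operatorname{dist}(x,K_\varepsilon)\le\delta'_\varepsilon\}$ (empty if $K_\varepsilon$ is empty) and $$K_\varepsilon=\Big\{x\in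 A:\ \varepsilon\,\frac{1}{\mathcal L^d(B_{(1-\delta)\varepsilon}(x)\cap\Omega)}\int_{B_{(1-\delta)\varepsilon}(x)\cap\Omega}W(\mathcal Eu_\varepsilon)\,dy\ \ge\ \frac{1}{(1-\delta)^{d}}\,\frac ba\Big\}.$$ -/

import Mathlib

open MeasureTheory Filter Topology Set Metric
open scoped ENNReal NNReal ContDiff

noncomputable section

namespace Griffith

/-- `ℝ^d` with its Euclidean norm. -/
abbrev E (d : ℕ) : Type := EuclideanSpace ℝ (Fin d)

/-! ### Sobolev functions -/

/-- `φ` is a smooth real test function with compact support in the open set `Ω`. -/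
structure IsTestFun {d : ℕ} (Ω : Set (E d)) (φ : E d → ℝ) : Prop where
  smooth : ContDiff ℝ ∞ φ
  compact_supp : HasCompactSupport φ
  supp_subset : tsupport φ ⊆ Ω

/-- `G` is a weak (distributional) gradient of `u` on the open set `Ω`. -/
def IsWeakGrad {d : ℕ} (Ω : Set (E d)) (u : E d → E d) (G : E d → E d →L[ℝ] E d) : Prop :=
  LocallyIntegrableOn G Ω volume ∧
    ∀ φ : E d → ℝ, IsTestFun Ω φ → ∀ e : E d,
      ∫ x in Ω, (fderiv ℝ φ x e) • u x = - ∫ x in Ω, φ x • G x e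

/-- `u ∈ W^{1,p}(Ω; ℝ^d)`. -/
def MemW1p {d : ℕ} (Ω : Set (E d)) (p : ℝ) (u : E d → E d) : Prop :=
  MemLp u (ENNReal.ofReal p) (volume.restrict Ω) ∧
    ∃ G : E d → E d →L[ℝ] E d, IsWeakGrad Ω u G ∧
      MemLp G (ENNReal.ofReal p) (volume.restrict Ω)

open Classical in
/-- The weak gradient of `u` on `Ω` (unique up to null sets where it exists; `0` otherwise). -/
def weakGrad {d : ℕ} (Ω : Set (E d)) (u : E d → E d) : E d → E d →L[ℝ] E d :=
  if h : ∃ G, IsWeakGrad Ω u G then h.choose else 0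

/-- The symmetric part `(L + Lᵀ) / 2` of a linear map, as a matrix. -/
def symPart {d : ℕ} (L : E d →L[ℝ] E d) : Matrix (Fin d) (Fin d) ℝ :=
  Matrix.of fun i j =>
    (L (EuclideanSpace.single j 1) i + L (EuclideanSpace.single i 1) j) / 2

/-- The Euclidean (Frobenius) norm of a matrix. -/
def matNorm {d : ℕ} (M : Matrix (Fin d) (Fin d) ℝ) : ℝ :=
  Real.sqrt (∑ i, ∑ j, M i j ^ 2)

/-! ### The data of the model and the non-local energies -/

/-- `f : [0,∞) → [0,∞)` is lower semicontinuous and nondecreasing, with slope `α > 0` at `0` and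
limit `β > 0` at infinity (only the values of `f` on `[0,∞)` matter). -/
structure IsProfile (f : ℝ → ℝ) (α β : ℝ) : Prop where
  nonneg : ∀ t, 0 ≤ t → 0 ≤ f t
  lsc : LowerSemicontinuousOn f (Ici 0)
  mono : MonotoneOn f (Ici 0)
  alpha_pos : 0 < α
  beta_pos : 0 < β
  slope_zero : Tendsto (fun t => f t / t) (𝓝[>] 0) (𝓝 α)
  lim_infty : Tendsto f atTop (𝓝 β)

/-- `W` is convex on the symmetric matrices, vanishes at `0` and has `p`-growth from above and
below there (so it is nonnegative there). -/
structure IsBulkDensity {d : ℕ} (p : ℝ) (W : Matrix (Fin d) (Fin d) ℝ → ℝ) : Prop where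
  convex : ConvexOn ℝ {M : Matrix (Fin d) (Fin d) ℝ | M.IsSymm} W
  map_zero : W 0 = 0
  growth : ∃ c C : ℝ, 0 < c ∧ ∀ M : Matrix (Fin d) (Fin d) ℝ, M.IsSymm →
    c * matNorm M ^ p ≤ W M ∧ W M ≤ C * (1 + matNorm M ^ p)

/-- The rescaled average `ε ⨍_{B_r(x) ∩ Ω} W(ℰu)`. -/
def meanEnergy {d : ℕ} (Ω : Set (E d)) (W : Matrix (Fin d) (Fin d) ℝ → ℝ) (u : E d → E d)
    (ε r : ℝ) (x : E d) : ℝ :=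
  ε * ⨍ y in ball x r ∩ Ω, W (symPart (weakGrad Ω u y))

open Classical in
/-- The localized energy
`F_ε(u, A) = (1/ε) ∫_A f (ε ⨍_{B_ε(x) ∩ Ω} W(ℰu)) dx` if `u ∈ W^{1,p}(Ω; ℝ^d)`, and `+∞`
otherwise. Localization concerns the domain of the outer integral. -/
def energy {d : ℕ} (Ω : Set (E d)) (p : ℝ) (f : ℝ → ℝ) (W : Matrix (Fin d) (Fin d) ℝ → ℝ)
    (ε : ℝ) (u : E d → E d) (A : Set (E d)) : ℝ≥0∞ :=
  if MemW1p Ω p u then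
    ENNReal.ofReal (1 / ε) * ∫⁻ x in A, ENNReal.ofReal (f (meanEnergy Ω W u ε ε x))
  else ⊤

/-! ### Approximate limits, jump points and approximate differentials -/

/-- The set of points
`y` with `Bad y` has Lebesgue density `0` at `x`. -/
def HasDensityZero {d : ℕ} (Bad : E d → Prop) (x : E d) : Prop :=
  Tendsto (fun r : ℝ => volume {y | y ∈ ball x r ∧ Bad y} / volume (ball x r))
    (𝓝[>] 0) (𝓝 0)

/-- The approximate discontinuity set of `w` in `A`: the points of `A` at which `w` has no
approximate limit. -/
def approxDiscSet {d : ℕ} (A : Set (E d)) (w : E d → ℝ) : Set (E d) :=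
  {x | x ∈ A ∧ ¬ ∃ z : ℝ, ∀ η : ℝ, 0 < η → HasDensityZero (fun y => η < |w y - z|) x}

/-- The (approximate) jump set `J_u` of `u` in `A`: the points of `A` at which `u` has two distinct
one-sided approximate limits `a ≠ b` on the two sides of a hyperplane with unit normal `ν`. -/
def jumpSet {d : ℕ} (A : Set (E d)) (u : E d → E d) : Set (E d) :=
  {x | x ∈ A ∧ ∃ a b ν : E d, a ≠ b ∧ ‖ν‖ = 1 ∧ ∀ η : ℝ, 0 < η →
    HasDensityZero (fun y => 0 < inner ℝ (y - x) ν ∧ η < ‖u y - a‖) x ∧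
    HasDensityZero (fun y => inner ℝ (y - x) ν < 0 ∧ η < ‖u y - b‖) x}

/-- `L` is the approximate differential of `u` at `x`: for some `a` (the approximate limit of `u`
at `x`) the quotient `|u(y) - a - L(y - x)| / |y - x|` has approximate limit `0` as `y → x`. -/
def IsApproxDiff {d : ℕ} (u : E d → E d) (x : E d) (L : E d →L[ℝ] E d) : Prop :=
  ∃ a : E d, ∀ η : ℝ, 0 < η →
    HasDensityZero (fun y => η * ‖y - x‖ < ‖u y - a - L (y - x)‖) x

open Classical in
/-- The approximate gradient `∇u(x)` (unique where it exists; `0` otherwise). -/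
def approxGrad {d : ℕ} (u : E d → E d) (x : E d) : E d →L[ℝ] E d :=
  if h : ∃ L, IsApproxDiff u x L then h.choose else 0

/-! ### The spaces `SBV_loc` and `GSBV^p` -/

/-- `w ∈ SBV_loc(A)`: `w` is locally integrable on the open set `A`, its distributional gradient
is a vector Radon measure on `A`, written in polar form `Dw = σ μ` with `μ = |Dw|` and `|σ| = 1`
`μ`-a.e., and its Cantor part vanishes. The Cantor part is the restriction of the Lebesgue-singular
part of `Dw` to the complement of the approximate discontinuity set of `w`, so it vanishes exactly
when `|Dw|` is absolutely continuous with respect to Lebesgue measure on that complement. -/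
def IsSBVLoc {d : ℕ} (A : Set (E d)) (w : E d → ℝ) : Prop :=
  LocallyIntegrableOn w A volume ∧
    ∃ (μ : Measure (E d)) (σ : E d → E d),
      (∀ K : Set (E d), IsCompact K → K ⊆ A → μ K < ⊤) ∧
      Measurable σ ∧ (∀ᵐ x ∂(μ.restrict A), ‖σ x‖ = 1) ∧
      (∀ φ : E d → ℝ, IsTestFun A φ → ∀ e : E d,
        ∫ x in A, w x * fderiv ℝ φ x e = - ∫ x in A, φ x * inner ℝ (σ x) e ∂μ) ∧
      (∀ B : Set (E d), MeasurableSet B → B ⊆ A \ approxDiscSet A w → volume B = 0 → μ B = 0)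

/-- `u ∈ GSBV(A; ℝ^d)`: `φ ∘ u ∈ SBV_loc(A)` for all `φ ∈ C¹(ℝ^d)` such that `∇φ` has compact
support. -/
def IsGSBV {d : ℕ} (A : Set (E d)) (u : E d → E d) : Prop :=
  AEMeasurable u (volume.restrict A) ∧
    ∀ φ : E d → ℝ, ContDiff ℝ 1 φ → HasCompactSupport (fderiv ℝ φ) → IsSBVLoc A (φ ∘ u)

/-- `u ∈ GSBV^p(A; ℝ^d)`: `u ∈ GSBV(A; ℝ^d)`, its approximate gradient (which exists a.e. in `A`)
is in `L^p(A)`, and `ℋ^{d-1}(J_u) < ∞`. -/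
structure MemGSBVp {d : ℕ} (A : Set (E d)) (p : ℝ) (u : E d → E d) : Prop where
  gsbv : IsGSBV A u
  approx_diff : ∀ᵐ x ∂(volume.restrict A), ∃ L, IsApproxDiff u x L
  grad_Lp : MemLp (approxGrad u) (ENNReal.ofReal p) (volume.restrict A)
  jump_finite : μHE[d - 1] (jumpSet A u) < ⊤

/-! ### The sets on which the energy concentrates -/

/-- `K_ε = {x ∈ A : ε ⨍_{B_{(1-δ)ε}(x) ∩ Ω} W(ℰu) ≥ (1-δ)^{-d} b/a}`. -/
def concSet {d : ℕ} (Ω A : Set (E d)) (W : Matrix (Fin d) (Fin d) ℝ → ℝ) (u : E d → E d)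
    (a b δ ε : ℝ) : Set (E d) :=
  {x | x ∈ A ∧ (1 / (1 - δ) ^ d) * (b / a) ≤ meanEnergy Ω W u ε ((1 - δ) * ε) x}

/-- `{x ∈ A : dist(x, K_ε) ≤ s}` (empty if `K_ε` is empty). -/
def concNhd {d : ℕ} (Ω A : Set (E d)) (W : Matrix (Fin d) (Fin d) ℝ → ℝ) (u : E d → E d)
    (a b δ ε s : ℝ) : Set (E d) :=
  {x | x ∈ A ∧ infEDist x (concSet Ω A W u a b δ ε) ≤ ENNReal.ofReal s}

/-- `v` is the average of `u` over balls of radius `(1-δ)ε` on `A \ K'_ε`, and `0` on `K'_ε`,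
where `K'_ε = {x ∈ A : dist(x, K_ε) ≤ δ'}` for some `0 < δ' < δε`. -/
def IsTruncatedAverage {d : ℕ} (Ω A : Set (E d)) (W : Matrix (Fin d) (Fin d) ℝ → ℝ)
    (u : E d → E d) (a b δ ε : ℝ) (v : E d → E d) : Prop :=
  ∃ s : ℝ, 0 < s ∧ s < δ * ε ∧
    (∀ x ∈ A \ concNhd Ω A W u a b δ ε s, v x = ⨍ y in ball x ((1 - δ) * ε), u y) ∧
    (∀ x ∈ concNhd Ω A W u a b δ ε s, v x = 0)

end Griffith

end

open Griffith

noncomputable section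

namespace Griffith

/-! ### Level sets of Lipschitz functions with unit gradient -/

/-! Take `a = α (1 - δ)`; the slope of `f` at `0` and monotonicity give `b`. Let `w` be the average
of `u_ε` over balls of radius `(1-δ)ε`. It is `C¹` on `A`, and its gradient is the average of the
weak gradient. Off `K_ε`, Jensen bounds `W(ℰw)` by the mean of `W(ℰu_ε)`, and the mean stays in the
range where `f` dominates `a t`. This gives the bulk estimate (`IsConfig.bulk_le`). At points closer
than `δε` to `K_ε`, the mean over `B_ε` is at least `b/a`, so `f ≥ b` there (`IsConfig.b_le`), and
the strip `{dist(·, K_ε) < δε}` has measure at most `ε F_ε / b` in `A`. The coarea inequality for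
the distance function (`exists_coarea_bound`) then yields a level `s ∈ (0, δε)` with `ℋ^{d-1}(A ∩
{dist = s}) ≤ 2/(δb) F_ε`. The candidate `v` is `w` on `{dist > s}` and `0` elsewhere.

For `v ∈ GSBV^p` the set `{dist > s}` must have an explicit boundary measure and `v` must have no
Cantor part. The boundary measure comes from disintegrating Lebesgue measure along the distance
function and differentiating integrals over thin slabs at Lebesgue points
(`ae_exists_boundary_measure`). For almost every `s` it lives on points of the level set where the
distance is differentiable. Its gradient has norm one there, so neither side of the level set is
negligible. Hence for each admissible `φ` such a point is an approximate discontinuity of `φ ∘ v`,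
unless the jump `φ(w) - φ(0)` vanishes (`IsCut.isSBVLoc`, `IsCut.memGSBVp`).

Convergence in `L¹` holds along bounded energies because ball averaging is an `L¹` contraction and
the cut set has measure `O(ε)` (`eventually_truncated_close`). The estimates are required for every
`ε` and without an energy bound. If the energies are not eventually bounded, `v_ε` is an almost
minimizer of the `L¹` distance to `u` among all functions satisfying the estimates. It is compared
with the truncated average where the energy is at most a threshold, and with a fixed smooth
approximation of `u` where it exceeds the bulk energy of that approximation. -/

lemma euclideanHausdorff_image_le {X Y : Type*} [EMetricSpace X] [EMetricSpace Y]
    [MeasurableSpace X] [BorelSpace X] [MeasurableSpace Y] [BorelSpace Y] {L : ℝ≥0} {f : X → Y}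
    {s : Set X} (h : LipschitzOnWith L f s) (k : ℕ) :
    μHE[k] (f '' s) ≤ (L : ℝ≥0∞) ^ k * μHE[k] s := by
  have := h.hausdorffMeasure_image_le (d := k) (by positivity)
  simp only [Measure.euclideanHausdorffMeasure_def, Measure.smul_apply, ENNReal.smul_def,
    smul_eq_mul]
  rw [ENNReal.rpow_natCast] at this
  calc _ ≤ _ * ((L : ℝ≥0∞) ^ k * μH[k] s) := by gcongr
    _ = _ := by ring

/-- An expanding map is injective on `s`, and its inverse is Lipschitz on the image. -/
lemma euclideanHausdorff_le_image {X Y : Type*} [MetricSpace X] [MetricSpace Y]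
    [MeasurableSpace X] [BorelSpace X] [MeasurableSpace Y] [BorelSpace Y] {L : ℝ≥0} {f : X → Y}
    {s : Set X} (h : ∀ x ∈ s, ∀ y ∈ s, dist x y ≤ L * dist (f x) (f y)) (k : ℕ) :
    μHE[k] s ≤ (L : ℝ≥0∞) ^ k * μHE[k] (f '' s) := by
  rcases s.eq_empty_or_nonempty with rfl | ⟨x₀, -⟩
  · simp
  have : Nonempty X := ⟨x₀⟩
  have hinj : InjOn f s := fun x hx y hy hxy => by
    have := h x hx y hy
    rw [hxy, dist_self, mul_zero] at this
    exact dist_le_zero.1 this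
  have hlip : LipschitzOnWith L (Function.invFunOn f s) (f '' s) := by
    refine LipschitzOnWith.of_dist_le_mul ?_
    rintro _ ⟨x, hx, rfl⟩ _ ⟨y, hy, rfl⟩
    rw [hinj.leftInvOn_invFunOn hx, hinj.leftInvOn_invFunOn hy]
    exact h x hx y hy
  have := euclideanHausdorff_image_le hlip k
  rwa [hinj.leftInvOn_invFunOn.image_image] at this

/-- Completing `e` to an orthonormal basis gives Fubini coordinates in which `e` is the first axis
and `τ` collects the others. -/
lemma exists_split {k : ℕ} (e : E (k + 1)) (he : ‖e‖ = 1) :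
    ∃ (P : E (k + 1) ≃ᵐ ℝ × E k) (τ : E (k + 1) →ₗ[ℝ] E k),
      MeasurePreserving P volume volume ∧ (∀ x, P x = (inner ℝ e x, τ x)) ∧ τ e = 0 ∧
      (∀ x, ‖x‖ ≤ |inner ℝ e x| + ‖τ x‖) := by
  obtain ⟨b, hb⟩ := Orthonormal.exists_orthonormalBasis_extension_of_card_eq (𝕜 := ℝ)
    (E := E (k + 1)) (ι := Fin (k + 1)) (by simp) (v := fun _ => e) (s := {0})
    ⟨fun i => by simpa using he, fun i j hij => by
      exact absurd (Subtype.ext (i.2.trans j.2.symm)) hij⟩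
  have hb0 : b 0 = e := hb 0 rfl
  let e₁ : E (k + 1) ≃ᵐ (Fin (k + 1) → ℝ) :=
    b.repr.toMeasurableEquiv.trans (MeasurableEquiv.toLp 2 (Fin (k + 1) → ℝ)).symm
  have h₁ : MeasurePreserving e₁ volume volume :=
    b.measurePreserving_repr.trans
      (EuclideanSpace.volume_preserving_symm_measurableEquiv_toLp (Fin (k + 1)))
  let e₂ : ℝ × (Fin k → ℝ) ≃ᵐ ℝ × E k :=
    (MeasurableEquiv.refl ℝ).prodCongr (MeasurableEquiv.toLp 2 (Fin k → ℝ))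
  have h₂ : MeasurePreserving e₂ volume volume :=
    (MeasurePreserving.id volume).prod (PiLp.volume_preserving_toLp (Fin k))
  let τ : E (k + 1) →ₗ[ℝ] E k :=
    { toFun := fun x => WithLp.toLp 2 fun i => b.repr x i.succ
      map_add' := fun x y => by ext i; simp
      map_smul' := fun c x => by ext i; simp }
  have hτ : ∀ x i, τ x i = b.repr x i.succ := fun _ _ => rfl
  refine ⟨e₁.trans ((MeasurableEquiv.piFinSuccAbove (fun _ => ℝ) 0).trans e₂), τ,
    (h₁.trans (volume_preserving_piFinSuccAbove (fun _ => ℝ) 0)).trans h₂, ?_, ?_, ?_⟩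
  · intro x
    refine Prod.ext ?_ ?_
    · change b.repr x 0 = _
      rw [b.repr_apply_apply, hb0]
    · rfl
  · ext i
    rw [hτ, b.repr_apply_apply, ← hb0, b.inner_eq_zero (Fin.succ_ne_zero i)]
    rfl
  · intro x
    have h1 : ‖x‖ ^ 2 = |inner ℝ e x| ^ 2 + ‖τ x‖ ^ 2 := by
      rw [← b.repr.norm_map x, EuclideanSpace.norm_sq_eq, EuclideanSpace.norm_sq_eq,
        Fin.sum_univ_succ, b.repr_apply_apply, hb0]
      simp [hτ]
    refine abs_le_of_sq_le_sq' ?_ (by positivity) |>.2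
    nlinarith [mul_nonneg (abs_nonneg (inner ℝ e x)) (norm_nonneg (τ x))]

/-- On a set where `g` is close to the affine function with gradient `e`, the coarea inequality
holds with a constant close to one, and preimages of null sets are null. -/
lemma coarea_piece {k : ℕ} {g : E (k + 1) → ℝ} {e : E (k + 1)} (he : ‖e‖ = 1) {η L : ℝ≥0}
    (hL : (1 - η : ℝ) * L = 1) {S : Set (E (k + 1))}
    (hS : ∀ x ∈ S, ∀ y ∈ S, |g x - g y - inner ℝ e (x - y)| ≤ η * ‖x - y‖) :
    (∃ H : ℝ → ℝ≥0∞, Measurable H ∧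
      ∫⁻ s, H s ≤ (L : ℝ≥0∞) ^ k * (1 + η) ^ (k + 1) * volume S ∧
      ∀ s, μHE[k] (S ∩ g ⁻¹' {s}) ≤ H s) ∧
    ∀ Z : Set ℝ, volume Z = 0 → volume (S ∩ g ⁻¹' Z) = 0 := by
  obtain ⟨P, τ, hP, hPτ, hτe, hnorm⟩ := exists_split e he
  have hL0 : (0 : ℝ) ≤ L := L.2
  have hee : inner ℝ e e = (1 : ℝ) := by rw [real_inner_self_eq_norm_sq, he]; norm_num
  -- `Φ` straightens `g`: it replaces the `e`-component of `x` by `g x` and keeps the transversal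
  -- part. On `S` it is a perturbation of the identity of size `η`, hence bi-Lipschitz with
  -- constants `1 + η` and `L = (1 - η)⁻¹`.
  let Φ : E (k + 1) → E (k + 1) := fun x => x + (g x - inner ℝ e x) • e
  have hPΦ : ∀ x, P (Φ x) = (g x, τ x) := by
    intro x
    rw [hPτ]
    simp [Φ, inner_add_right, inner_smul_right, he, hτe]
  have hΦd : ∀ x y, Φ x - Φ y = (x - y) + (g x - g y - inner ℝ e (x - y)) • e := by
    intro x y
    simp only [Φ, inner_sub_right]
    module
  have hΦlip : LipschitzOnWith (1 + η) Φ S := by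
    refine LipschitzOnWith.of_dist_le_mul fun x hx y hy => ?_
    rw [dist_eq_norm, dist_eq_norm, hΦd]
    refine (norm_add_le _ _).trans ?_
    rw [norm_smul, he, mul_one, Real.norm_eq_abs]
    have := hS x hx y hy
    push_cast
    linarith
  have hΦanti : ∀ x ∈ S, ∀ y ∈ S, dist x y ≤ L * dist (Φ x) (Φ y) := by
    intro x hx y hy
    have h1 := hS x hx y hy
    have h2 : ‖x - y‖ ≤ ‖Φ x - Φ y‖ + η * ‖x - y‖ := by
      have : x - y = (Φ x - Φ y) - (g x - g y - inner ℝ e (x - y)) • e := by rw [hΦd]; module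
      calc ‖x - y‖ = ‖(Φ x - Φ y) - (g x - g y - inner ℝ e (x - y)) • e‖ := by rw [← this]
        _ ≤ _ := norm_sub_le _ _
        _ ≤ _ := by rw [norm_smul, he, mul_one, Real.norm_eq_abs]; gcongr
    rw [dist_eq_norm, dist_eq_norm]
    have : (1 - η) * ‖x - y‖ ≤ ‖Φ x - Φ y‖ := by linarith
    calc ‖x - y‖ = L * ((1 - η) * ‖x - y‖) := by
          rw [← mul_assoc, mul_comm (L : ℝ), hL, one_mul]
      _ ≤ _ := by gcongr
  have hvol : ∀ T ⊆ S, volume (Φ '' T) ≤ (1 + η) ^ (k + 1) * volume T := by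
    intro T hT
    have := euclideanHausdorff_image_le (hΦlip.mono hT) (k + 1)
    rw [EuclideanSpace.euclideanHausdorffMeasure_eq_volume] at this
    simpa using this
  have hPvol : ∀ T : Set (E (k + 1)), volume (P '' T) = volume T := by
    intro T
    rw [← hP.measure_preimage_equiv, P.injective.preimage_image]
  refine ⟨?_, ?_⟩
  -- Slices of `P (Φ S)` are the projected level sets, and Fubini integrates their measure. No
  -- measurability of `S` is assumed, hence the measurable hull.
  · set T := toMeasurable volume (P '' (Φ '' S)) with hT
    have hTm : MeasurableSet T := measurableSet_toMeasurable _ _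
    refine ⟨fun s => (L : ℝ≥0∞) ^ k * volume (Prod.mk s ⁻¹' T),
      (measurable_measure_prodMk_left hTm).const_mul _, ?_, ?_⟩
    · rw [lintegral_const_mul _ (measurable_measure_prodMk_left hTm), mul_assoc]
      gcongr
      rw [← Measure.prod_apply hTm, ← Measure.volume_eq_prod, hT, measure_toMeasurable, hPvol]
      exact hvol S subset_rfl
    · intro s
      -- On a single level the `e`-component of `x - y` is at most `η ‖x - y‖`, so already the
      -- projection `τ` loses only the factor `L`.
      have h1 := euclideanHausdorff_le_image (L := L) (f := τ) (s := S ∩ g ⁻¹' {s}) ?_ k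
      · refine h1.trans ?_
        rw [EuclideanSpace.euclideanHausdorffMeasure_eq_volume]
        refine mul_le_mul_right (measure_mono ?_) _
        rintro _ ⟨x, ⟨hx, hxs⟩, rfl⟩
        refine subset_toMeasurable _ _ ⟨Φ x, ⟨x, hx, rfl⟩, ?_⟩
        rw [hPΦ, show g x = s from hxs]
      · rintro x ⟨hx, hxs⟩ y ⟨hy, hys⟩
        have h1 := hS x hx y hy
        rw [show g x = s from hxs, show g y = s from hys, sub_self, zero_sub, abs_neg] at h1
        rw [dist_eq_norm, dist_eq_norm, ← map_sub]
        have := hnorm (x - y)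
        have : (1 - η) * ‖x - y‖ ≤ ‖τ (x - y)‖ := by linarith
        calc ‖x - y‖ = L * ((1 - η) * ‖x - y‖) := by
              rw [← mul_assoc, mul_comm (L : ℝ), hL, one_mul]
          _ ≤ _ := by gcongr
  · intro Z hZ
    have h1 := euclideanHausdorff_le_image (s := S ∩ g ⁻¹' Z)
      (fun x hx y hy => hΦanti x hx.1 y hy.1) (k + 1)
    rw [EuclideanSpace.euclideanHausdorffMeasure_eq_volume] at h1
    have h2 : volume (P '' (Φ '' (S ∩ g ⁻¹' Z))) = 0 := by
      have h3 : P '' (Φ '' (S ∩ g ⁻¹' Z)) ⊆ Z ×ˢ univ := by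
        rintro _ ⟨_, ⟨x, hx, rfl⟩, rfl⟩
        rw [hPΦ]
        exact ⟨hx.2, mem_univ _⟩
      refine measure_mono_null h3 ?_
      rw [Measure.volume_eq_prod, Measure.prod_prod, hZ, zero_mul]
    rw [hPvol] at h2
    simpa [h2] using h1

/-- Eilenberg's inequality for null sets. -/
lemma ae_level_null {k : ℕ} {g : E (k + 1) → ℝ} (hg : LipschitzWith 1 g) {N : Set (E (k + 1))}
    (hN : volume N = 0) : ∀ᵐ s : ℝ, μHE[k] (N ∩ g ⁻¹' {s}) = 0 := by
  have hc0 := Measure.addHaarScalarFactor_volume_hausdorffMeasure_ne_zero (k + 1)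
  have hH : μH[((k + 1 : ℕ) : ℝ)] N = 0 := by
    rw [← EuclideanSpace.euclideanHausdorffMeasure_eq_volume,
      Measure.euclideanHausdorffMeasure_def, Measure.smul_apply, ENNReal.smul_def, smul_eq_mul,
      mul_eq_zero] at hN
    rcases hN with h | h
    · exact absurd (by exact_mod_cast h) hc0
    · exact h
  have hcov : ∀ n : ℕ, ∃ t : ℕ → Set (E (k + 1)), N ⊆ ⋃ i, t i ∧
      (∀ i, ediam (t i) ≤ ((n : ℝ≥0∞) + 1)⁻¹) ∧
      ∑' i, ⨆ _ : (t i).Nonempty, ediam (t i) ^ ((k + 1 : ℕ) : ℝ) ≤ ((n : ℝ≥0∞) + 1)⁻¹ := by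
    intro n
    rw [Measure.hausdorffMeasure_apply] at hH
    have h1 := (ENNReal.iSup_eq_zero.1 hH) (((n : ℝ≥0∞) + 1)⁻¹)
    have hpos : (0 : ℝ≥0∞) < ((n : ℝ≥0∞) + 1)⁻¹ := by
      rw [ENNReal.inv_pos]; finiteness
    have h2 := (ENNReal.iSup_eq_zero.1 h1) hpos
    have h3 := h2.trans_lt hpos
    simp only [iInf_lt_iff] at h3
    obtain ⟨t, ht1, ht2, ht3⟩ := h3
    exact ⟨t, ht1, ht2, ht3.le⟩
  choose t htN htd hts using hcov
  -- `F n s` adds `diam ^ k` over the covering sets whose image meets the level `s`. The image of a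
  -- set has length at most its diameter, so `∫ F n` is bounded by the `(k+1)`-dimensional covering
  -- sum, which tends to zero; Fatou then gives `liminf F n = 0` almost everywhere. The nonemptiness
  -- guard matters for `k = 0`, where `diam ^ 0 = 1` even for the empty set.
  let D : ℕ → ℕ → ℝ≥0∞ := fun n i => ⨆ _ : (t n i).Nonempty, ediam (t n i) ^ (k : ℝ)
  let F : ℕ → ℝ → ℝ≥0∞ := fun n s => ∑' i, (closure (g '' (t n i))).indicator (fun _ => D n i) s
  have hFm : ∀ n, Measurable (F n) := fun n =>
    Measurable.tsum fun i => measurable_const.indicator isClosed_closure.measurableSet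
  have hFint : ∀ n, ∫⁻ s, F n s ≤ ((n : ℝ≥0∞) + 1)⁻¹ := by
    intro n
    refine le_trans ?_ (hts n)
    rw [lintegral_tsum fun i =>
      (measurable_const.indicator isClosed_closure.measurableSet).aemeasurable]
    refine ENNReal.tsum_le_tsum fun i => ?_
    rw [lintegral_indicator isClosed_closure.measurableSet, setLIntegral_const]
    rcases (t n i).eq_empty_or_nonempty with h | h
    · simp [h]
    · simp only [D, h, iSup_pos]
      have h1 : volume (closure (g '' (t n i))) ≤ ediam (t n i) := by
        refine (Real.volume_le_diam _).trans ?_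
        rw [ediam_closure]
        simpa using hg.ediam_image_le (t n i)
      calc _ ≤ ediam (t n i) ^ (k : ℝ) * ediam (t n i) := by gcongr
        _ = _ := by
          rw [ENNReal.rpow_natCast, ENNReal.rpow_natCast, pow_succ]
  have hlim : ∀ᵐ s : ℝ, liminf (fun n => F n s) atTop = 0 := by
    have h1 : ∫⁻ s, liminf (fun n => F n s) atTop = 0 := by
      refine le_antisymm ?_ zero_le
      refine (lintegral_liminf_le hFm).trans ?_
      have h2 : Tendsto (fun n : ℕ => ((n : ℝ≥0∞) + 1)⁻¹) atTop (𝓝 0) := by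
        have := (ENNReal.tendsto_inv_nat_nhds_zero).comp (tendsto_add_atTop_nat 1)
        simpa [Function.comp_def] using this
      rw [← h2.liminf_eq]
      exact liminf_le_liminf (Eventually.of_forall hFint)
    rw [lintegral_eq_zero_iff (Measurable.liminf hFm)] at h1
    exact h1
  filter_upwards [hlim] with s hs
  suffices μH[(k : ℝ)] (N ∩ g ⁻¹' {s}) ≤ liminf (fun n => F n s) atTop by
    rw [hs] at this
    rw [Measure.euclideanHausdorffMeasure_def, Measure.smul_apply, le_antisymm this zero_le]
    simp
  have h2 : Tendsto (fun n : ℕ => ((n : ℝ≥0∞) + 1)⁻¹) atTop (𝓝 0) := by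
    have := (ENNReal.tendsto_inv_nat_nhds_zero).comp (tendsto_add_atTop_nat 1)
    simpa [Function.comp_def] using this
  -- The index type keeps only the sets that meet the level, since the covering sum here has no
  -- guard against empty sets.
  have h3 := Measure.hausdorffMeasure_le_liminf_tsum (k : ℝ) (N ∩ g ⁻¹' {s}) (l := atTop) _ h2
    (fun n (i : {i : ℕ // (t n i ∩ g ⁻¹' {s}).Nonempty}) => t n i ∩ g ⁻¹' {s})
    (Eventually.of_forall fun n i => (ediam_mono inter_subset_left).trans (htd n i))
    (Eventually.of_forall fun n x hx => by
      obtain ⟨i, hi⟩ := mem_iUnion.1 (htN n hx.1)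
      exact mem_iUnion.2 ⟨⟨i, ⟨x, hi, hx.2⟩⟩, hi, hx.2⟩)
  refine h3.trans (liminf_le_liminf (Eventually.of_forall fun n => ?_))
  calc _ ≤ ∑' i : {i : ℕ // (t n i ∩ g ⁻¹' {s}).Nonempty},
        (closure (g '' (t n i))).indicator (fun _ => D n i) s := by
        refine ENNReal.tsum_le_tsum fun i => ?_
        obtain ⟨x, hx, hxs⟩ := i.2
        have hsm : s ∈ closure (g '' (t n i)) := subset_closure ⟨x, hx, hxs⟩
        rw [indicator_of_mem hsm]
        simp only [D, show (t n i).Nonempty from ⟨x, hx⟩, iSup_pos]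
        exact ENNReal.rpow_le_rpow (ediam_mono inter_subset_left) (by positivity)
    _ ≤ _ := ENNReal.tsum_comp_le_tsum_of_injective Subtype.val_injective _

/-- The Lipschitz bound gives `≤ 1`. Conversely, moving from `x` straight towards a nearest point of
the closure of `K` decreases the distance at unit speed. -/
lemma norm_fderiv_infDist {d : ℕ} {K : Set (E d)} (hK : K.Nonempty) {x : E d}
    (hx : 0 < infDist x K) {L : E d →L[ℝ] ℝ} (hL : HasFDerivAt (fun y => infDist y K) L x) :
    ‖L‖ = 1 := by
  refine le_antisymm (by simpa using hL.le_of_lipschitz (lipschitz_infDist_pt K)) ?_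
  obtain ⟨y, hy, hxy⟩ := isClosed_closure.exists_infDist_eq_dist hK.closure x
  rw [infDist_closure] at hxy
  have hle : L (y - x) ≤ - infDist x K := by
    have hd : HasDerivAt (fun t : ℝ => infDist (x + t • (y - x)) K) (L (y - x)) 0 := by
      have h0 : HasDerivAt (fun t : ℝ => x + t • (y - x)) (y - x) 0 := by
        simpa using ((hasDerivAt_id (0 : ℝ)).smul_const (y - x)).const_add x
      have h1 : HasFDerivAt (fun y => infDist y K) L (x + (0 : ℝ) • (y - x)) := by simpa using hL
      exact h1.comp_hasDerivAt 0 h0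
    have hs := (hasDerivAt_iff_tendsto_slope.1 hd).mono_left
      (nhdsWithin_mono 0 (fun t (ht : t ∈ Ioi (0 : ℝ)) => ht.ne'))
    refine le_of_tendsto hs ?_
    filter_upwards [Ioo_mem_nhdsGT (zero_lt_one' ℝ)] with t ht
    rw [slope_def_field, sub_zero, zero_smul, add_zero, div_le_iff₀ ht.1]
    have h2 : infDist (x + t • (y - x)) K ≤ (1 - t) * infDist x K := by
      rw [← infDist_closure]
      refine (infDist_le_dist_of_mem hy).trans ?_
      rw [hxy, dist_eq_norm, dist_eq_norm, show x + t • (y - x) - y = (1 - t) • (x - y) by module,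
        norm_smul, Real.norm_of_nonneg (by linarith [ht.2])]
    linarith
  have h3 : |L (y - x)| ≤ ‖L‖ * ‖y - x‖ := L.le_opNorm _
  rw [norm_sub_rev, ← dist_eq_norm, ← hxy] at h3
  have h4 := neg_abs_le (L (y - x))
  by_contra! hlt
  nlinarith

/-- The coarea inequality for a Lipschitz function with unit gradient, up to a factor `2`. -/
lemma exists_coarea_bound {k : ℕ} {g : E (k + 1) → ℝ} (hg : LipschitzWith 1 g)
    {U : Set (E (k + 1))} (hU : MeasurableSet U)
    (hgrad : ∀ x ∈ U, ∀ L : E (k + 1) →L[ℝ] ℝ, HasFDerivAt g L x → ‖L‖ = 1) :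
    (∃ H : ℝ → ℝ≥0∞, Measurable H ∧ ∫⁻ s, H s ≤ 2 * volume U ∧
      ∀ᵐ s, μHE[k] (U ∩ g ⁻¹' {s}) ≤ H s) ∧
    ∀ Z : Set ℝ, volume Z = 0 → volume (U ∩ g ⁻¹' Z) = 0 := by
  -- The distortion `(1 - η)⁻ᵏ (1 + η)ᵏ⁺¹` tends to `1` as `η → 0`; any bound above `1` would do in
  -- place of `2`.
  obtain ⟨η, L, hη0, hL, hη2⟩ : ∃ η L : ℝ≥0, η ≠ 0 ∧ (1 - η : ℝ) * L = 1 ∧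
      L ^ k * (1 + η) ^ (k + 1) ≤ 2 := by
    have hc : ContinuousAt (fun η : ℝ => (1 - η)⁻¹ ^ k * (1 + η) ^ (k + 1)) 0 := by
      have : (1 - (0 : ℝ)) ≠ 0 := by norm_num
      fun_prop (disch := assumption)
    have h1 : ∀ᶠ η : ℝ in 𝓝 0, (1 - η)⁻¹ ^ k * (1 + η) ^ (k + 1) < 2 := by
      refine hc.eventually_lt continuousAt_const ?_
      norm_num
    have h2 : ∀ᶠ η : ℝ in 𝓝[>] 0, (1 - η)⁻¹ ^ k * (1 + η) ^ (k + 1) < 2 :=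
      h1.filter_mono nhdsWithin_le_nhds
    obtain ⟨η, h3, h4⟩ := (h2.and (Ioo_mem_nhdsGT (zero_lt_one' ℝ))).exists
    refine ⟨⟨η, h4.1.le⟩, ⟨(1 - η)⁻¹, inv_nonneg.2 (by linarith [h4.2])⟩, ?_, ?_, ?_⟩
    · exact fun h => h4.1.ne' (congrArg NNReal.toReal h)
    · exact mul_inv_cancel₀ (sub_pos.2 h4.2).ne'
    · rw [← NNReal.coe_le_coe]
      push_cast
      exact h3.le
  set D := {x | DifferentiableAt ℝ g x} with hD
  have hDm : MeasurableSet D := measurableSet_of_differentiableAt ℝ g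
  have hDN : volume Dᶜ = 0 := hg.ae_differentiableAt
  -- Countably many pieces on which `g` is `η`-close to affine. Each slope is the derivative at a
  -- point of `U ∩ D`, hence of norm one, as `coarea_piece` requires.
  obtain ⟨t, A, hdisj, htm, hcov, happ, hA⟩ :=
    exists_partition_approximatesLinearOn_of_hasFDerivWithinAt g (U ∩ D) (fderiv ℝ g)
      (fun x hx => hx.2.hasFDerivAt.hasFDerivWithinAt) (fun _ => η) (fun _ => hη0)
  have hpiece : ∀ n, (∃ H : ℝ → ℝ≥0∞, Measurable H ∧
      ∫⁻ s, H s ≤ (L : ℝ≥0∞) ^ k * (1 + η) ^ (k + 1) * volume (U ∩ D ∩ t n) ∧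
      ∀ s, μHE[k] (U ∩ D ∩ t n ∩ g ⁻¹' {s}) ≤ H s) ∧
      ∀ Z : Set ℝ, volume Z = 0 → volume (U ∩ D ∩ t n ∩ g ⁻¹' Z) = 0 := by
    intro n
    rcases (U ∩ D).eq_empty_or_nonempty with h | h
    · simp only [h, empty_inter, measure_empty]
      exact ⟨⟨0, measurable_zero, by simp, by simp⟩, by simp⟩
    · obtain ⟨y, hy, hAy⟩ := hA h n
      refine coarea_piece (e := (InnerProductSpace.toDual ℝ _).symm (A n)) ?_ hL ?_
      · rw [LinearIsometryEquiv.norm_map, hAy]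
        exact hgrad y hy.1 _ hy.2.hasFDerivAt
      · intro x hx y hy
        rw [InnerProductSpace.toDual_symm_apply]
        exact happ n x hx y hy
  have hUD : U ∩ D = ⋃ n, U ∩ D ∩ t n := by
    rw [← inter_iUnion, inter_eq_left.2 hcov]
  constructor
  · choose H hHm hHi hHs using fun n => (hpiece n).1
    refine ⟨fun s => ∑' n, H n s, Measurable.tsum hHm, ?_, ?_⟩
    · rw [lintegral_tsum fun n => (hHm n).aemeasurable]
      calc _ ≤ ∑' n, (L : ℝ≥0∞) ^ k * (1 + η) ^ (k + 1) * volume (U ∩ D ∩ t n) :=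
            ENNReal.tsum_le_tsum hHi
        _ = (L : ℝ≥0∞) ^ k * (1 + η) ^ (k + 1) * volume (U ∩ D) := by
            rw [ENNReal.tsum_mul_left, ← measure_iUnion
              (fun i j hij => (hdisj hij).mono inter_subset_right inter_subset_right)
              (fun n => (hU.inter hDm).inter (htm n)), ← hUD]
        _ ≤ _ := by
            gcongr
            · exact_mod_cast hη2
            · exact inter_subset_left
    -- The non-differentiability points form a null set, and Eilenberg's inequality removes it from
    -- almost every level.
    · filter_upwards [ae_level_null hg hDN] with s hs
      have hsub : U ∩ g ⁻¹' {s} ⊆ (⋃ n, U ∩ D ∩ t n ∩ g ⁻¹' {s}) ∪ (Dᶜ ∩ g ⁻¹' {s}) := by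
        rw [← iUnion_inter, ← hUD]
        intro x hx
        by_cases h : x ∈ D
        · exact Or.inl ⟨⟨hx.1, h⟩, hx.2⟩
        · exact Or.inr ⟨h, hx.2⟩
      refine (measure_mono hsub).trans ((measure_union_le _ _).trans ?_)
      rw [hs, add_zero]
      exact (measure_iUnion_le _).trans (ENNReal.tsum_le_tsum fun n => hHs n s)
  · intro Z hZ
    have hsub : U ∩ g ⁻¹' Z ⊆ (⋃ n, U ∩ D ∩ t n ∩ g ⁻¹' Z) ∪ Dᶜ := by
      rw [← iUnion_inter, ← hUD]
      intro x hx
      by_cases h : x ∈ D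
      · exact Or.inl ⟨⟨hx.1, h⟩, hx.2⟩
      · exact Or.inr h
    refine measure_mono_null hsub (measure_union_null ?_ hDN)
    exact measure_iUnion_null fun n => (hpiece n).2 Z hZ

/-! ### The boundary measure of superlevel sets -/

open ProbabilityTheory in
/-- Disintegration of a finite measure along a real function with absolutely continuous law. -/
lemma exists_disintegration {X : Type*} [MeasurableSpace X] [StandardBorelSpace X] [Nonempty X]
    (V : Type*) [NormedAddCommGroup V] [NormedSpace ℝ V] [CompleteSpace V]
    (μ : Measure X) [IsFiniteMeasure μ] {g : X → ℝ} (hg : Measurable g)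
    (hac : ∀ Z, volume Z = 0 → μ (g ⁻¹' Z) = 0) :
    ∃ ν : ℝ → Measure X, (∀ s, IsFiniteMeasure (ν s)) ∧
      (∀ N, MeasurableSet N → μ N = 0 → ∀ᵐ s, ν s N = 0) ∧
      (∀ᵐ s, ν s {x | g x ≠ s} = 0) ∧
      Integrable (fun s => (ν s).real univ) ∧
      ∀ q : X → V, StronglyMeasurable q → (∃ C, ∀ x, ‖q x‖ ≤ C) →
        Integrable (fun s => ∫ x, q x ∂ν s) ∧
        ∀ I, MeasurableSet I → ∫ x in g ⁻¹' I, q x ∂μ = ∫ s in I, ∫ x, q x ∂ν s := by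
  -- The fibre measure is the conditional distribution `κ s` of the point given the value of `g`,
  -- weighted by the Lebesgue density `r s` of the law of `g`.
  set ρ := μ.map g with hρ
  set r := ρ.rnDeriv volume with hr
  set κ := condDistrib id g μ with hκ
  have hfin : IsFiniteMeasure ρ := Measure.isFiniteMeasure_map μ g
  have hρac : ρ ≪ volume := by
    refine Measure.AbsolutelyContinuous.mk fun Z hZm hZ => ?_
    rw [hρ, Measure.map_apply hg hZm]
    exact hac Z hZ
  have hdis : ρ ⊗ₘ κ = μ.map (fun x => (g x, x)) := compProd_map_condDistrib aemeasurable_id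
  have hgid : Measurable fun x => (g x, x) := hg.prodMk measurable_id
  -- Properties known almost everywhere for the law transfer to Lebesgue almost every `s` where the
  -- weight is nonzero; elsewhere the fibre measure is zero.
  have htrans : ∀ p : ℝ → Prop, (∀ᵐ s ∂ρ, p s) → ∀ᵐ s, r s = 0 ∨ p s := by
    intro p hp
    have h1 : ∀ᵐ s ∂(volume.withDensity r), p s := by
      rwa [Measure.withDensity_rnDeriv_eq _ _ hρac]
    rw [ae_withDensity_iff (Measure.measurable_rnDeriv _ _)] at h1
    filter_upwards [h1] with s hs
    exact or_iff_not_imp_left.2 hs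
  have hνapp : ∀ s B, ((r s).toNNReal • κ s) B = ((r s).toNNReal : ℝ≥0∞) * κ s B := fun s B => rfl
  have hνint : ∀ s (q : X → V), ∫ x, q x ∂((r s).toNNReal • κ s) =
      (r s).toReal • ∫ x, q x ∂κ s := fun s q => by
    rw [integral_smul_nnreal_measure]; rfl
  refine ⟨fun s => (r s).toNNReal • κ s, fun s => inferInstance, ?_, ?_, ?_, ?_⟩
  · intro N hNm hN
    have hm : MeasurableSet {p : ℝ × X | p.2 ∉ N} := measurable_snd hNm.compl
    have h1 : ∀ᵐ p ∂(ρ ⊗ₘ κ), p.2 ∉ N := by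
      rw [hdis, ae_map_iff hgid.aemeasurable hm]
      exact measure_eq_zero_iff_ae_notMem.1 hN
    rw [Measure.ae_compProd_iff hm] at h1
    filter_upwards [htrans _ h1] with s hs
    rw [hνapp]
    rcases hs with hs | hs
    · simp [hs]
    · rw [measure_eq_zero_iff_ae_notMem.2 hs, mul_zero]
  · have hm : MeasurableSet {p : ℝ × X | g p.2 = p.1} :=
      measurableSet_eq_fun (hg.comp measurable_snd) measurable_fst
    have h1 : ∀ᵐ p ∂(ρ ⊗ₘ κ), g p.2 = p.1 := by
      rw [hdis, ae_map_iff hgid.aemeasurable hm]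
      simp
    rw [Measure.ae_compProd_iff hm] at h1
    filter_upwards [htrans _ h1] with s hs
    rw [hνapp]
    rcases hs with hs | hs
    · simp [hs]
    · rw [show κ s {x | g x ≠ s} = 0 from hs, mul_zero]
  · have : ∀ s, ((r s).toNNReal • κ s).real univ = (r s).toReal := by
      intro s
      rw [measureReal_def, hνapp, measure_univ, mul_one]
      rfl
    simp_rw [this]
    exact Measure.integrable_toReal_rnDeriv
  · rintro q hq ⟨C, hC⟩
    have hq2 : Integrable (fun p : ℝ × X => q p.2) (ρ ⊗ₘ κ) := by
      have : IsFiniteMeasure (ρ ⊗ₘ κ) := inferInstance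
      exact Integrable.of_bound (hq.comp_measurable measurable_snd).aestronglyMeasurable C
        (Eventually.of_forall fun p => hC p.2)
    simp_rw [hνint]
    constructor
    · rw [integrable_rnDeriv_smul_iff hρac]
      exact hq2.integral_compProd
    · intro I hI
      rw [setIntegral_rnDeriv_smul hρac hI]
      have h1 := Measure.setIntegral_compProd hI MeasurableSet.univ hq2.integrableOn
      simp only [Measure.restrict_univ] at h1
      rw [← h1, hdis, setIntegral_map (hI.prod MeasurableSet.univ) ?_ hgid.aemeasurable]
      · rw [show (fun x => (g x, x)) ⁻¹' (I ×ˢ univ) = g ⁻¹' I by ext; simp]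
      · rw [← hdis]; exact hq2.aestronglyMeasurable

/-- Integration by parts on the superlevel sets of a Lipschitz function, as a limit of integrals
over thin slabs. -/
lemma tendsto_slab {d : ℕ} {g : E d → ℝ} (hg : LipschitzWith 1 g) {A : Set (E d)}
    (hlev : ∀ s, 0 < s → volume (A ∩ g ⁻¹' {s}) = 0) {ψ : E d → ℝ} (hψ : ContDiff ℝ 1 ψ)
    (hψc : HasCompactSupport ψ) (hψA : tsupport ψ ⊆ A) (e : E d) {s : ℝ} (hs : 0 < s) :
    Tendsto (fun h => h⁻¹ * ∫ x in g ⁻¹' Ioo s (s + h), ψ x * fderiv ℝ g x e) (𝓝[>] 0)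
      (𝓝 (-∫ x in g ⁻¹' Ioi s, fderiv ℝ ψ x e)) := by
  have hgm : Measurable g := hg.continuous.measurable
  -- A Lipschitz cut-off increasing to the indicator of `{g > s}` as `h ↓ 0`. Its gradient is `h⁻¹
  -- ∇g` in the slab `s < g < s + h` and zero outside; the two bounding levels are null in `A`.
  let q : ℝ → E d → ℝ := fun h x => min (max (h⁻¹ * (g x - s)) 0) 1
  have hq0 : ∀ h x, 0 ≤ q h x := fun h x => le_min (le_max_right _ _) zero_le_one
  have hq1 : ∀ h x, q h x ≤ 1 := fun h x => min_le_right _ _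
  have hqlip : ∀ h, 0 < h → LipschitzWith (Real.toNNReal h⁻¹) (q h) := by
    intro h hh
    refine (LipschitzWith.max_const ?_ 0).min_const 1
    refine LipschitzWith.of_dist_le_mul fun x y => ?_
    rw [Real.coe_toNNReal _ (by positivity), Real.dist_eq, ← mul_sub, abs_mul,
      abs_of_pos (by positivity : 0 < h⁻¹)]
    gcongr
    have := hg.dist_le_mul x y
    simpa [Real.dist_eq] using this
  obtain ⟨D, hD⟩ := hψ.lipschitzWith_of_hasCompactSupport hψc one_ne_zero
  have hψd : ∀ x, DifferentiableAt ℝ ψ x := fun x => hψ.differentiable one_ne_zero x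
  have hψout : ∀ x, x ∉ A → ψ x = 0 := fun x hx => image_eq_zero_of_notMem_tsupport
    fun h => hx (hψA h)
  -- the formula for positive width
  have hform : ∀ h, 0 < h → h⁻¹ * ∫ x in g ⁻¹' Ioo s (s + h), ψ x * fderiv ℝ g x e =
      -∫ x, fderiv ℝ ψ x e * q h x := by
    intro h hh
    have h1 := (hqlip h hh).integral_lineDeriv_mul_eq (μ := volume) hD hψc e
    have h2 : ∀ x, lineDeriv ℝ ψ x (-e) * q h x = -(fderiv ℝ ψ x e * q h x) := by
      intro x
      rw [(hψd x).lineDeriv_eq_fderiv, map_neg, neg_mul]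
    simp_rw [h2] at h1
    rw [integral_neg] at h1
    rw [← h1, ← integral_const_mul, ← integral_indicator (hgm measurableSet_Ioo)]
    refine integral_congr_ae ?_
    have hn1 := measure_eq_zero_iff_ae_notMem.1 (hlev s hs)
    have hn2 := measure_eq_zero_iff_ae_notMem.1 (hlev (s + h) (by linarith))
    filter_upwards [hg.ae_differentiableAt, hn1, hn2] with x hx hx1 hx2
    by_cases hxA : x ∈ A
    · have hne1 : g x ≠ s := fun h' => hx1 ⟨hxA, h'⟩
      have hne2 : g x ≠ s + h := fun h' => hx2 ⟨hxA, h'⟩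
      have hgc : ContinuousAt g x := hg.continuous.continuousAt
      rcases lt_or_gt_of_ne hne1 with hlt | hgt
      · rw [indicator_of_notMem (fun h' => absurd h'.1 (not_lt.2 hlt.le))]
        have : q h =ᶠ[𝓝 x] fun _ => 0 := by
          filter_upwards [hgc.eventually_lt_const hlt] with y hy
          have : h⁻¹ * (g y - s) ≤ 0 :=
            mul_nonpos_of_nonneg_of_nonpos (by positivity) (by linarith)
          simp [q, max_eq_right this]
        rw [this.lineDeriv_eq, (differentiableAt_const _).lineDeriv_eq_fderiv]
        simp
      · rcases lt_or_gt_of_ne hne2 with hlt2 | hgt2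
        · rw [indicator_of_mem (show x ∈ g ⁻¹' Ioo s (s + h) from ⟨hgt, hlt2⟩)]
          have : q h =ᶠ[𝓝 x] fun y => h⁻¹ * (g y - s) := by
            filter_upwards [hgc.eventually_lt_const hlt2, hgc.eventually_const_lt hgt] with y h3 h4
            have h5 : 0 ≤ h⁻¹ * (g y - s) := mul_nonneg (by positivity) (by linarith)
            have h6 : h⁻¹ * (g y - s) ≤ 1 := by
              rw [inv_mul_le_iff₀ hh]; linarith
            simp [q, max_eq_left h5, min_eq_left h6]
          have hd : HasFDerivAt (fun y => h⁻¹ * (g y - s)) (h⁻¹ • fderiv ℝ g x) x :=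
            (hx.hasFDerivAt.sub_const s).const_mul h⁻¹
          rw [this.lineDeriv_eq, hd.differentiableAt.lineDeriv_eq_fderiv, hd.fderiv]
          simp only [_root_.smul_apply, smul_eq_mul]
          ring
        · rw [indicator_of_notMem (fun h' => absurd h'.2 (not_lt.2 hgt2.le))]
          have : q h =ᶠ[𝓝 x] fun _ => 1 := by
            filter_upwards [hgc.eventually_const_lt hgt2] with y hy
            have : 1 ≤ h⁻¹ * (g y - s) := by
              rw [le_inv_mul_iff₀ hh]; linarith
            simp [q, this]
          rw [this.lineDeriv_eq, (differentiableAt_const _).lineDeriv_eq_fderiv]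
          simp
    · simp [hψout x hxA]
  have hcont : Continuous fun x => fderiv ℝ ψ x e :=
    (hψ.continuous_fderiv one_ne_zero).clm_apply continuous_const
  have hint : Integrable fun x => fderiv ℝ ψ x e :=
    hcont.integrable_of_hasCompactSupport (hψc.fderiv_apply ℝ e)
  have hlim : Tendsto (fun h => -∫ x, fderiv ℝ ψ x e * q h x) (𝓝[>] 0)
      (𝓝 (-∫ x in g ⁻¹' Ioi s, fderiv ℝ ψ x e)) := by
    rw [← integral_indicator (hgm measurableSet_Ioi)]
    refine Tendsto.neg ?_
    refine tendsto_integral_filter_of_dominated_convergence (fun x => ‖fderiv ℝ ψ x e‖) ?_ ?_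
      hint.norm ?_
    · filter_upwards [self_mem_nhdsWithin] with h hh
      exact (hcont.mul (hqlip h hh).continuous).aestronglyMeasurable
    · refine Eventually.of_forall fun h => Eventually.of_forall fun x => ?_
      rw [norm_mul]
      refine mul_le_of_le_one_right (norm_nonneg _) ?_
      rw [Real.norm_of_nonneg (hq0 h x)]
      exact hq1 h x
    · refine Eventually.of_forall fun x => ?_
      by_cases hx : s < g x
      · rw [indicator_of_mem (show x ∈ g ⁻¹' Ioi s from hx)]
        refine tendsto_const_nhds.congr' ?_
        filter_upwards [Ioo_mem_nhdsGT (sub_pos.2 hx)] with h hh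
        have h0 := hh.1
        have : 1 ≤ h⁻¹ * (g x - s) := by
          rw [le_inv_mul_iff₀ h0]; linarith [hh.2]
        simp [q, this]
      · rw [indicator_of_notMem (show x ∉ g ⁻¹' Ioi s from hx)]
        refine tendsto_const_nhds.congr' ?_
        filter_upwards [self_mem_nhdsWithin] with h hh
        have hh : 0 < h := hh
        have : h⁻¹ * (g x - s) ≤ 0 :=
          mul_nonpos_of_nonneg_of_nonpos (by positivity) (by linarith [not_lt.1 hx])
        simp [q, max_eq_right this]
  refine hlim.congr' ?_
  filter_upwards [self_mem_nhdsWithin] with h hh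
  exact (hform h hh).symm

/-- For almost every `s > 0` the superlevel set `{g > s}` has a finite boundary measure, which
lives on the points of `{g = s}` at which `g` is differentiable. -/
lemma ae_exists_boundary_measure {d : ℕ} {g : E d → ℝ} (hg : LipschitzWith 1 g) {A : Set (E d)}
    (hA : IsOpen A) (hAc : IsCompact (closure A))
    (hnull : ∀ Z, volume Z = 0 → volume ((A ∩ {x | 0 < g x}) ∩ g ⁻¹' Z) = 0) :
    ∀ᵐ s : ℝ, 0 < s → ∃ ν : Measure (E d), IsFiniteMeasure ν ∧ ν {x | g x ≠ s} = 0 ∧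
      (∀ᵐ x ∂ν, DifferentiableAt ℝ g x) ∧
      ∀ ψ : E d → ℝ, ContDiff ℝ 1 ψ → HasCompactSupport ψ → tsupport ψ ⊆ A → ∀ e,
        ∫ x in g ⁻¹' Ioi s, fderiv ℝ ψ x e = -∫ x, ψ x * fderiv ℝ g x e ∂ν := by
  have hgm : Measurable g := hg.continuous.measurable
  set U := A ∩ {x | 0 < g x} with hU
  have hUm : MeasurableSet U := hA.measurableSet.inter (hgm measurableSet_Ioi)
  have hAfin : volume U < ⊤ :=
    (measure_mono (inter_subset_left.trans subset_closure)).trans_lt hAc.measure_lt_top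
  have : IsFiniteMeasure (volume.restrict U) := isFiniteMeasure_restrict.2 hAfin.ne
  have hμ : ∀ Z, volume Z = 0 → (volume.restrict U) (g ⁻¹' Z) = 0 := fun Z hZ => by
    rw [Measure.restrict_apply' hUm, inter_comm]; exact hnull Z hZ
  have hlev : ∀ s, 0 < s → volume (A ∩ g ⁻¹' {s}) = 0 := by
    intro s hs
    refine measure_mono_null ?_ (hnull {s} (measure_singleton s))
    intro x hx
    have : g x = s := hx.2
    exact ⟨⟨hx.1, by simpa [this] using hs⟩, hx.2⟩
  obtain ⟨ν, hνfin, hνnull, hνlev, hνR, hνq⟩ :=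
    exists_disintegration (E d →L[ℝ] ℝ) (volume.restrict U) hgm hμ
  have hgrad : ∀ x, ‖fderiv ℝ g x‖ ≤ 1 := fun x => by
    simpa using norm_fderiv_le_of_lipschitz ℝ hg (x₀ := x)
  have hgradm : StronglyMeasurable (fderiv ℝ g) := (measurable_fderiv ℝ g).stronglyMeasurable
  have : CompactSpace (closure A) := isCompact_iff_compactSpace.1 hAc
  let ext : C(closure A, ℝ) → E d → ℝ := fun φ => Function.extend Subtype.val φ 0
  have hext_in : ∀ φ (x : closure A), ext φ x = φ x := fun φ x =>
    Subtype.val_injective.extend_apply _ _ _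
  have hext_out : ∀ φ x, x ∉ closure A → ext φ x = 0 := fun φ x hx =>
    Function.extend_apply' _ _ _ fun ⟨y, hy⟩ => hx (hy ▸ y.2)
  have hextm : ∀ φ, Measurable (ext φ) := fun φ =>
    (MeasurableEmbedding.subtype_coe isClosed_closure.measurableSet).measurable_extend
      φ.continuous.measurable measurable_zero
  have hextb : ∀ φ x, ‖ext φ x‖ ≤ ‖φ‖ := by
    intro φ x
    by_cases hx : x ∈ closure A
    · rw [show x = ((⟨x, hx⟩ : closure A) : E d) from rfl, hext_in]
      exact φ.norm_coe_le_norm _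
    · rw [hext_out φ x hx]; simp
  -- Lebesgue's differentiation theorem has an exceptional set depending on the integrand. A dense
  -- sequence of test functions keeps the union of these sets null, and one `s` then serves every
  -- `ψ`.
  let Φ : ℕ → C(closure A, ℝ) := TopologicalSpace.denseSeq _
  have hqj : ∀ φ, StronglyMeasurable (fun x => ext φ x • fderiv ℝ g x) ∧
      ∃ C, ∀ x, ‖ext φ x • fderiv ℝ g x‖ ≤ C := fun φ =>
    ⟨(hextm φ).stronglyMeasurable.smul hgradm, ‖φ‖, fun x => by
      rw [norm_smul]
      exact (mul_le_of_le_one_right (norm_nonneg _) (hgrad x)).trans (hextb φ x)⟩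
  have hND : (volume.restrict U) {x | DifferentiableAt ℝ g x}ᶜ = 0 :=
    le_antisymm ((Measure.restrict_le_self _).trans hg.ae_differentiableAt.le) zero_le
  have hleb : ∀ j, ∀ᵐ s, ∀ c, HasDerivAt
      (fun x => ∫ t in c..x, ∫ y, ext (Φ j) y • fderiv ℝ g y ∂ν t)
      (∫ y, ext (Φ j) y • fderiv ℝ g y ∂ν s) s := fun j =>
    LocallyIntegrable.ae_hasDerivAt_integral
      (hνq _ (hqj (Φ j)).1 (hqj (Φ j)).2).1.locallyIntegrable
  filter_upwards [hνlev, hνnull _ (measurableSet_of_differentiableAt ℝ g).compl hND,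
    ae_all_iff.2 hleb,
    LocallyIntegrable.ae_hasDerivAt_integral hνR.locallyIntegrable] with s h1 h2 h3 h4 hs
  have hfin := hνfin s
  refine ⟨ν s, hfin, h1, h2, fun ψ hψ hψc hψA e => ?_⟩
  have hslope : ∀ {V : Type} [NormedAddCommGroup V] [NormedSpace ℝ V] (F : ℝ → V) (L : V),
      HasDerivAt (fun x => ∫ t in s..x, F t) L s →
      Tendsto (fun h : ℝ => h⁻¹ • ∫ t in Ioo s (s + h), F t) (𝓝[>] 0) (𝓝 L) := by
    intro V _ _ F L hF
    refine ((hasDerivAt_iff_tendsto_slope_zero.1 hF).mono_left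
      (nhdsWithin_mono 0 fun t (ht : 0 < t) => ht.ne')).congr' ?_
    filter_upwards [self_mem_nhdsWithin] with h hh
    have hh : 0 < h := hh
    rw [intervalIntegral.integral_same, sub_zero,
      intervalIntegral.integral_of_le (by linarith), integral_Ioc_eq_integral_Ioo]
  have hψout : ∀ x, x ∉ A → ψ x = 0 := fun x hx => image_eq_zero_of_notMem_tsupport
    fun h => hx (hψA h)
  let φ : C(closure A, ℝ) := ⟨fun x => ψ x, by fun_prop⟩
  have hφψ : ext φ = ψ := by
    funext x
    by_cases hx : x ∈ closure A
    · exact hext_in φ ⟨x, hx⟩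
    · rw [hext_out φ x hx, hψout x fun h => hx (subset_closure h)]
  let R : ℝ → ℝ := fun t => (ν t).real univ
  let Q : C(closure A, ℝ) → ℝ → E d →L[ℝ] ℝ := fun φ t => ∫ y, ext φ y • fderiv ℝ g y ∂ν t
  have hQi : ∀ φ, Integrable (Q φ) := fun φ => (hνq _ (hqj φ).1 (hqj φ).2).1
  have hQd : ∀ φ₁ φ₂ t, ‖Q φ₁ t - Q φ₂ t‖ ≤ ‖φ₁ - φ₂‖ * R t := by
    intro φ₁ φ₂ t
    have := hνfin t
    have hi : ∀ φ, Integrable (fun y => ext φ y • fderiv ℝ g y) (ν t) := fun φ => by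
      obtain ⟨C, hC⟩ := (hqj φ).2
      exact Integrable.of_bound (hqj φ).1.aestronglyMeasurable C (Eventually.of_forall hC)
    rw [← integral_sub (hi φ₁) (hi φ₂)]
    refine norm_integral_le_of_norm_le_const (Eventually.of_forall fun y => ?_)
    rw [← sub_smul, norm_smul]
    refine (mul_le_of_le_one_right (norm_nonneg _) (hgrad y)).trans ?_
    by_cases hy : y ∈ closure A
    · rw [show y = ((⟨y, hy⟩ : closure A) : E d) from rfl, hext_in, hext_in]
      exact (φ₁ - φ₂).norm_coe_le_norm _
    · rw [hext_out _ y hy, hext_out _ y hy]; simp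
  -- Replacing `φ` by a close `Φ j` costs `‖φ - Φ j‖` times the slab averages of the total mass `R`.
  -- These are controlled because `s` is also a differentiation point of `R`.
  have hmain : Tendsto (fun h : ℝ => h⁻¹ • ∫ t in Ioo s (s + h), Q φ t) (𝓝[>] 0)
      (𝓝 (Q φ s)) := by
    rw [Metric.tendsto_nhds]
    intro η hη
    have hR0 : 0 ≤ R s := measureReal_nonneg
    set c := η / (2 * (R s + 1) + 1) with hc
    have hc0 : 0 < c := by positivity
    obtain ⟨_, ⟨j, rfl⟩, hj⟩ := Metric.mem_closure_iff.1
      (TopologicalSpace.denseRange_denseSeq (C(closure A, ℝ)) φ) c hc0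
    rw [dist_eq_norm] at hj
    change ‖φ - Φ j‖ < c at hj
    filter_upwards [self_mem_nhdsWithin,
      Metric.tendsto_nhds.1 (hslope _ _ (h3 j s)) c hc0,
      (hslope _ _ (h4 s)).eventually_lt_const (lt_add_one _)] with h hh h5 h6
    have hh : 0 < h := hh
    have e1 : ‖h⁻¹ • (∫ t in Ioo s (s + h), Q φ t) - h⁻¹ • ∫ t in Ioo s (s + h), Q (Φ j) t‖ ≤
        c * (R s + 1) := by
      rw [← smul_sub h⁻¹ (∫ t in Ioo s (s + h), Q φ t) (∫ t in Ioo s (s + h), Q (Φ j) t),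
        ← integral_sub (hQi _).integrableOn (hQi _).integrableOn, norm_smul,
        Real.norm_of_nonneg (by positivity)]
      calc _ ≤ h⁻¹ * ∫ t in Ioo s (s + h), c * R t := by
            gcongr
            refine norm_integral_le_of_norm_le (hνR.const_mul c).integrableOn
              (Eventually.of_forall fun t => ?_)
            exact (hQd _ _ t).trans (by gcongr)
        _ = c * (h⁻¹ • ∫ t in Ioo s (s + h), R t) := by
            rw [integral_const_mul, smul_eq_mul]; ring
        _ ≤ _ := by gcongr
    have e2 : ‖Q (Φ j) s - Q φ s‖ ≤ c * R s := by
      rw [norm_sub_rev]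
      exact (hQd _ _ s).trans (by gcongr)
    rw [dist_eq_norm] at h5 ⊢
    calc _ = ‖(h⁻¹ • (∫ t in Ioo s (s + h), Q φ t) - h⁻¹ • ∫ t in Ioo s (s + h), Q (Φ j) t) +
          (h⁻¹ • (∫ t in Ioo s (s + h), Q (Φ j) t) - Q (Φ j) s) + (Q (Φ j) s - Q φ s)‖ := by
          congr 1; abel
      _ ≤ _ := norm_add₃_le
      _ < c * (R s + 1) + c + c * R s := by
          refine add_lt_add_of_lt_of_le (add_lt_add_of_le_of_lt e1 h5) e2
      _ ≤ c * (2 * (R s + 1) + 1) := by nlinarith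
      _ = η := by rw [hc]; field_simp
  have hlim := tendsto_slab hg hlev hψ hψc hψA e hs
  have hlim2 : Tendsto (fun h : ℝ => (h⁻¹ • ∫ t in Ioo s (s + h), Q φ t) e) (𝓝[>] 0)
      (𝓝 (Q φ s e)) :=
    ((ContinuousLinearMap.apply ℝ ℝ e).continuous.tendsto _).comp hmain
  have hQs : Q φ s e = ∫ x, ψ x * fderiv ℝ g x e ∂ν s := by
    obtain ⟨C, hC⟩ := (hqj φ).2
    have hi : Integrable (fun y => ext φ y • fderiv ℝ g y) (ν s) :=
      Integrable.of_bound (hqj φ).1.aestronglyMeasurable C (Eventually.of_forall hC)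
    rw [ContinuousLinearMap.integral_apply hi, hφψ]
    rfl
  rw [← hQs, ← tendsto_nhds_unique hlim (hlim2.congr' ?_), neg_neg]
  filter_upwards [self_mem_nhdsWithin] with h hh
  rw [_root_.smul_apply, smul_eq_mul, ← (hνq _ (hqj φ).1 (hqj φ).2).2 _ measurableSet_Ioo]
  obtain ⟨C, hC⟩ := (hqj φ).2
  have hi : Integrable (fun y => ext φ y • fderiv ℝ g y)
      ((volume.restrict U).restrict (g ⁻¹' Ioo s (s + h))) :=
    Integrable.of_bound (hqj φ).1.aestronglyMeasurable C (Eventually.of_forall hC)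
  rw [ContinuousLinearMap.integral_apply hi, hφψ,
    Measure.restrict_restrict (hgm measurableSet_Ioo)]
  congr 1
  -- In the slab one has `g > s > 0`, so a point outside `U` lies outside `A`, where `ψ` vanishes.
  refine (setIntegral_eq_of_subset_of_forall_sdiff_eq_zero (hgm measurableSet_Ioo)
    inter_subset_left fun x hx => ?_).symm
  have hxA : x ∉ A := fun hxA => hx.2 ⟨hx.1, hxA, hs.trans hx.1.1⟩
  simp [hψout x hxA]

/-! ### Ball averages -/

section Averages

variable {d : ℕ} {V : Type*} [NormedAddCommGroup V] [NormedSpace ℝ V]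

/-- Dominated convergence: off the null sphere, membership in `ball x r` is locally constant in the
centre. -/
lemma continuous_setIntegral_ball {U : E d → V} (hU : Integrable U) {r : ℝ} (hr : r ≠ 0) :
    Continuous fun x => ∫ y in ball x r, U y := by
  simp_rw [← integral_indicator measurableSet_ball]
  rw [continuous_iff_continuousAt]
  intro x₀
  refine continuousAt_of_dominated (bound := fun y => ‖U y‖)
    (Eventually.of_forall fun x => hU.aestronglyMeasurable.indicator measurableSet_ball)
    (Eventually.of_forall fun x => Eventually.of_forall fun y => norm_indicator_le_norm_self _ _)
    hU.norm ?_
  have hs : ∀ᵐ y : E d, y ∉ sphere x₀ r :=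
    measure_eq_zero_iff_ae_notMem.1 (Measure.addHaar_sphere_of_ne_zero volume x₀ hr)
  filter_upwards [hs] with y hy
  have hc : ContinuousAt (fun x => dist y x) x₀ := by fun_prop
  rcases lt_or_gt_of_ne (show dist y x₀ ≠ r from hy) with h | h
  · refine continuousAt_const.congr (f := fun _ => U y) ?_
    filter_upwards [hc.eventually_lt_const h] with x hx
    rw [indicator_of_mem (mem_ball.2 hx)]
  · refine continuousAt_const.congr (f := fun _ => (0 : V)) ?_
    filter_upwards [hc.eventually_const_lt h] with x hx
    rw [indicator_of_notMem fun h' => absurd (mem_ball.1 h') (not_lt.2 hx.le)]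

lemma continuous_average_ball {U : E d → V} (hU : Integrable U) {r : ℝ} (hr : r ≠ 0) :
    Continuous fun x => ⨍ y in ball x r, U y := by
  simp_rw [setAverage_eq, measureReal_def, Measure.addHaar_ball_center]
  exact (continuous_setIntegral_ball hU hr).const_smul _

lemma norm_setAverage_ball_le {U : E d → V} {x : E d} {r : ℝ} (hU : IntegrableOn U (ball x r)) :
    ENNReal.ofReal ‖⨍ y in ball x r, U y‖ ≤
      (volume (ball (0 : E d) r))⁻¹ * ∫⁻ y in ball x r, ‖U y‖ₑ := by
  rw [setAverage_eq, norm_smul, ENNReal.ofReal_mul (norm_nonneg _)]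
  gcongr
  · rw [Real.norm_of_nonneg (by positivity), measureReal_def, Measure.addHaar_ball_center,
      ← ENNReal.toReal_inv]
    exact ENNReal.ofReal_toReal_le
  · rw [← ofReal_integral_norm_eq_lintegral_enorm hU]
    exact ENNReal.ofReal_le_ofReal (norm_integral_le_integral_norm _)

/-- Averaging over balls is a contraction in `L¹`. -/
lemma lintegral_average_ball_le {U : E d → V} (hU : Integrable U) {r : ℝ} (hr : 0 < r) :
    ∫⁻ x, ‖⨍ y in ball x r, U y‖ₑ ≤ ∫⁻ x, ‖U x‖ₑ := by
  set m := volume (ball (0 : E d) r) with hm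
  have hm0 : m ≠ 0 := (measure_ball_pos _ _ hr).ne'
  have hmt : m ≠ ⊤ := measure_ball_lt_top.ne
  calc ∫⁻ x, ‖⨍ y in ball x r, U y‖ₑ
      ≤ ∫⁻ x, m⁻¹ * ∫⁻ y, {p : E d × E d | dist p.2 p.1 < r}.indicator
          (fun p => ‖U p.2‖ₑ) (x, y) := by
        refine lintegral_mono fun x => ?_
        rw [← ofReal_norm]
        refine (norm_setAverage_ball_le hU.integrableOn).trans ?_
        rw [← lintegral_indicator measurableSet_ball]
        rfl
    _ = m⁻¹ * ∫⁻ x, ∫⁻ y, {p : E d × E d | dist p.2 p.1 < r}.indicator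
          (fun p => ‖U p.2‖ₑ) (x, y) :=
        lintegral_const_mul' _ _ (ENNReal.inv_ne_top.2 hm0)
    _ = m⁻¹ * ∫⁻ y, ∫⁻ x, {p : E d × E d | dist p.2 p.1 < r}.indicator
          (fun p => ‖U p.2‖ₑ) (x, y) := by
        rw [lintegral_lintegral_swap]
        have hS : MeasurableSet {p : E d × E d | dist p.2 p.1 < r} :=
          measurableSet_lt (by fun_prop) measurable_const
        exact (hU.aestronglyMeasurable.enorm.comp_quasiMeasurePreserving
          Measure.quasiMeasurePreserving_snd).indicator hS
    _ = m⁻¹ * ∫⁻ y, m * ‖U y‖ₑ := by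
        congr 2
        funext y
        rw [show (fun x => {p : E d × E d | dist p.2 p.1 < r}.indicator
          (fun p => ‖U p.2‖ₑ) (x, y)) = (ball y r).indicator (fun _ => ‖U y‖ₑ) by
            funext x
            by_cases h : dist x y < r <;> simp [h, dist_comm y x]]
        rw [lintegral_indicator measurableSet_ball, setLIntegral_const,
          Measure.addHaar_ball_center, mul_comm]
    _ = ∫⁻ y, ‖U y‖ₑ := by
        rw [lintegral_const_mul' _ _ hmt, ← mul_assoc, ENNReal.inv_mul_cancel hm0 hmt, one_mul]

/-- Averages over small balls converge in `L¹`. -/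
lemma exists_average_ball_close [CompleteSpace V] {U : E d → V} (hU : Integrable U) {A : Set (E d)}
    (hA : volume A ≠ ⊤) {η : ℝ≥0∞} (hη : η ≠ 0) :
    ∃ ρ > 0, ∀ r, 0 < r → r < ρ → ∫⁻ x in A, ‖(⨍ y in ball x r, U y) - U x‖ₑ ≤ η := by
  rcases eq_or_ne η ⊤ with rfl | hηt
  · exact ⟨1, one_pos, fun _ _ _ => le_top⟩
  have hη3 : η / 3 ≠ 0 := by simp [hη]
  -- For a continuous compactly supported `g`, uniform continuity makes the averages uniformly
  -- close. The difference `U - g` enters twice, once averaged and once not, and averaging does not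
  -- increase its `L¹` norm.
  obtain ⟨g, hgc, hgU, hg, hgL⟩ := (memLp_one_iff_integrable.2 hU).exists_hasCompactSupport_eLpNorm_sub_le
    ENNReal.one_ne_top hη3
  rw [eLpNorm_one_eq_lintegral_enorm] at hgU
  have hgi : Integrable g := memLp_one_iff_integrable.1 hgL
  have huc := hgc.uniformContinuous_of_continuous hg
  obtain ⟨c, hc0, hc⟩ : ∃ c : ℝ, 0 < c ∧ ENNReal.ofReal c * volume A ≤ η / 3 := by
    refine ⟨(η / 3 / (volume A + 1)).toReal, ENNReal.toReal_pos ?_ ?_, ?_⟩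
    · exact (ENNReal.div_pos hη3 (by finiteness)).ne'
    · exact (ENNReal.div_lt_top (by finiteness) (by simp)).ne
    · refine (mul_le_mul' ENNReal.ofReal_toReal_le (le_add_of_nonneg_right zero_le_one)).trans ?_
      rw [ENNReal.div_mul_cancel (by simp) (by finiteness)]
  obtain ⟨ρ, hρ, hρc⟩ := Metric.uniformContinuous_iff.1 huc c hc0
  refine ⟨ρ, hρ, fun r hr hrρ => ?_⟩
  have hball : ∀ x : E d, volume (ball x r) ≠ 0 := fun x => (measure_ball_pos _ _ hr).ne'
  have hgclose : ∀ x, ‖(⨍ y in ball x r, g y) - g x‖ ≤ c := by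
    intro x
    have h1 : (⨍ y in ball x r, g y) - g x = ⨍ y in ball x r, (g y - g x) := by
      rw [setAverage_eq, setAverage_eq, integral_sub hgi.integrableOn (integrableOn_const measure_ball_lt_top.ne), smul_sub,
        setIntegral_const, smul_smul, inv_mul_cancel₀, one_smul]
      exact (ENNReal.toReal_pos (hball x) measure_ball_lt_top.ne).ne'
    rw [h1, setAverage_eq, norm_smul, Real.norm_of_nonneg (by positivity)]
    have h2 := norm_setIntegral_le_of_norm_le_const (f := fun y => g y - g x) (C := c)
      (measure_ball_lt_top (μ := volume) (x := x) (r := r)) fun y hy => by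
        rw [← dist_eq_norm]
        exact (hρc ((mem_ball.1 hy).trans hrρ)).le
    have hm : 0 < volume.real (ball x r) :=
      ENNReal.toReal_pos (hball x) measure_ball_lt_top.ne
    rw [inv_mul_le_iff₀ hm]
    linarith
  have hsplit : ∀ x, (⨍ y in ball x r, U y) - U x = (⨍ y in ball x r, (U y - g y)) +
      (((⨍ y in ball x r, g y) - g x) + (g x - U x)) := by
    intro x
    have : ⨍ y in ball x r, (U y - g y) = (⨍ y in ball x r, U y) - ⨍ y in ball x r, g y := by
      simp_rw [setAverage_eq]
      rw [integral_sub hU.integrableOn hgi.integrableOn, smul_sub]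
    rw [this]; abel
  have hUg : Integrable fun y => U y - g y := hU.sub hgi
  calc ∫⁻ x in A, ‖(⨍ y in ball x r, U y) - U x‖ₑ
      ≤ ∫⁻ x in A, (‖⨍ y in ball x r, (U y - g y)‖ₑ + (ENNReal.ofReal c + ‖U x - g x‖ₑ)) := by
        refine lintegral_mono fun x => ?_
        rw [hsplit x]
        refine (enorm_add_le _ _).trans (add_le_add le_rfl ((enorm_add_le _ _).trans ?_))
        refine add_le_add ?_ (by rw [← enorm_neg, neg_sub])
        rw [← ofReal_norm]
        exact ENNReal.ofReal_le_ofReal (hgclose x)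
    _ = (∫⁻ x in A, ‖⨍ y in ball x r, (U y - g y)‖ₑ) +
          ((∫⁻ x in A, ENNReal.ofReal c) + ∫⁻ x in A, ‖U x - g x‖ₑ) := by
        rw [lintegral_add_left (continuous_average_ball hUg hr.ne').enorm.measurable,
          lintegral_add_left measurable_const]
    _ ≤ η / 3 + (η / 3 + η / 3) := by
        refine add_le_add ?_ (add_le_add ?_ ?_)
        · exact ((setLIntegral_le_lintegral _ _).trans (lintegral_average_ball_le hUg hr)).trans hgU
        · rw [setLIntegral_const]; exact hc
        · exact (setLIntegral_le_lintegral _ _).trans hgU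
    _ = η := by rw [← add_assoc]; exact ENNReal.add_thirds η

/-- The ball averages of `u` are close to `u₀` if `u` is close to `u₀` in `L¹(Ω)` and the radius
is small. -/
lemma lintegral_average_sub_le {Ω A : Set (E d)} (hΩ : MeasurableSet Ω) {u u₀ : E d → V}
    (hu : IntegrableOn u Ω) (hu₀ : IntegrableOn u₀ Ω) {r : ℝ} (hr : 0 < r)
    (hball : ∀ x ∈ A, ball x r ⊆ Ω) (hAΩ : A ⊆ Ω) (hA : MeasurableSet A) :
    ∫⁻ x in A, ‖(⨍ y in ball x r, u y) - u₀ x‖ₑ ≤ (∫⁻ x in Ω, ‖u x - u₀ x‖ₑ) +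
      ∫⁻ x in A, ‖(⨍ y in ball x r, Ω.indicator u₀ y) - Ω.indicator u₀ x‖ₑ := by
  have h1 : Integrable (Ω.indicator fun y => u y - u₀ y) := (hu.sub hu₀).integrable_indicator hΩ
  calc _ ≤ ∫⁻ x in A, (‖⨍ y in ball x r, Ω.indicator (fun y => u y - u₀ y) y‖ₑ +
          ‖(⨍ y in ball x r, Ω.indicator u₀ y) - Ω.indicator u₀ x‖ₑ) := by
        refine setLIntegral_mono' hA fun x hx => ?_
        have e : ∀ q : E d → V, ⨍ y in ball x r, Ω.indicator q y = ⨍ y in ball x r, q y :=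
          fun q => by
            simp_rw [setAverage_eq]
            rw [setIntegral_congr_fun measurableSet_ball
              fun y hy => indicator_of_mem (hball x hx hy) q]
        refine le_trans (le_of_eq ?_) (enorm_add_le _ _)
        congr 1
        rw [e, e, indicator_of_mem (hAΩ hx)]
        simp_rw [setAverage_eq]
        rw [integral_sub (hu.mono_set (hball x hx)) (hu₀.mono_set (hball x hx)), smul_sub]
        abel
    _ ≤ _ := by
        rw [lintegral_add_left (continuous_average_ball h1 hr.ne').enorm.measurable]
        refine add_le_add ?_ le_rfl
        refine (setLIntegral_le_lintegral _ _).trans ((lintegral_average_ball_le h1 hr).trans ?_)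
        simp_rw [enorm_indicator_eq_indicator_enorm]
        rw [lintegral_indicator hΩ]

/-! ### Differentiability of ball averages of Sobolev functions -/

/-- Integrals against smooth bumps converge uniformly to integrals over balls. -/
lemma eventually_norm_bump_sub_ball_le {Ω : Set (E d)} {q : E d → V}
    (hq : IntegrableOn q Ω) {r : ℝ} (hr : 0 < r) {f : ℕ → ContDiffBump (0 : E d)}
    (hf : ∀ n, (f n).rOut = r) (hin : Tendsto (fun n => (f n).rIn) atTop (𝓝 r)) {η : ℝ}
    (hη : 0 < η) : ∀ᶠ n in atTop, ∀ x, ball x r ⊆ Ω →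
      ‖(∫ y in ball x r, q y) - ∫ y in Ω, f n (y - x) • q y‖ ≤ η := by
  obtain ⟨c, hc, hcq⟩ := exists_pos_setLIntegral_lt_of_measure_lt (μ := volume.restrict Ω)
    (f := fun y => ‖q y‖ₑ) hq.hasFiniteIntegral.ne (ε := ENNReal.ofReal η) (by simpa using hη)
  have hvol : Tendsto (fun n => volume (ball (0 : E d) 1) *
      ENNReal.ofReal (r ^ d - (f n).rIn ^ d)) atTop (𝓝 0) := by
    have h1 : Tendsto (fun n => r ^ d - (f n).rIn ^ d) atTop (𝓝 (r ^ d - r ^ d)) :=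
      tendsto_const_nhds.sub (hin.pow d)
    have h2 := ENNReal.Tendsto.const_mul (a := volume (ball (0 : E d) 1))
      (ENNReal.tendsto_ofReal h1) (Or.inr measure_ball_lt_top.ne)
    simpa using h2
  filter_upwards [hvol.eventually_lt_const hc] with n hn x hx
  set ρ := (f n).rIn with hρ
  have hρ0 : 0 < ρ := (f n).rIn_pos
  have hρr : ρ < r := hf n ▸ (f n).rIn_lt_rOut
  -- The two integrands differ only on this shell. Its volume does not depend on `x`, so absolute
  -- continuity of the integral of `q` gives a bound uniform in `x`.
  set T := ball x r \ closedBall x ρ with hT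
  have hTm : MeasurableSet T := measurableSet_ball.diff measurableSet_closedBall
  have hTv : volume T < c := by
    refine lt_of_eq_of_lt ?_ hn
    rw [hT, measure_sdiff (closedBall_subset_ball hρr) measurableSet_closedBall.nullMeasurableSet
      measure_closedBall_lt_top.ne, Measure.addHaar_ball_of_pos _ _ hr,
      Measure.addHaar_closedBall _ _ hρ0.le, ENNReal.ofReal_sub _ (by positivity),
      ENNReal.mul_sub fun _ _ => measure_ball_lt_top.ne, finrank_euclideanSpace_fin,
      mul_comm, mul_comm (ENNReal.ofReal (ρ ^ d))]
  have hfi : IntegrableOn (fun y => f n (y - x) • q y) Ω := by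
    refine Integrable.mono hq.norm ?_ (Eventually.of_forall fun y => ?_)
    · exact ((f n).continuous.comp (continuous_id.sub continuous_const)).aestronglyMeasurable.smul
        hq.aestronglyMeasurable
    · rw [norm_smul, norm_norm, Real.norm_of_nonneg (f n).nonneg]
      exact mul_le_of_le_one_left (norm_nonneg _) (f n).le_one
  have hbi : IntegrableOn ((ball x r).indicator q) Ω := hq.indicator measurableSet_ball
  have h1 : ∫ y in ball x r, q y = ∫ y in Ω, (ball x r).indicator q y := by
    rw [setIntegral_indicator measurableSet_ball, inter_eq_right.2 hx]
  rw [h1, ← integral_sub hbi hfi]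
  have h2 : ∀ y, ‖(ball x r).indicator q y - f n (y - x) • q y‖ ≤ T.indicator (fun y => ‖q y‖) y := by
    intro y
    by_cases hy : y ∈ ball x r
    · rw [indicator_of_mem hy]
      by_cases hy2 : y ∈ closedBall x ρ
      · rw [(f n).one_of_mem_closedBall (by simpa [dist_eq_norm] using hy2), one_smul, sub_self,
          norm_zero]
        exact indicator_nonneg (fun _ _ => norm_nonneg _) _
      · rw [indicator_of_mem (show y ∈ T from ⟨hy, hy2⟩)]
        rw [show q y - f n (y - x) • q y = (1 - f n (y - x)) • q y by rw [sub_smul, one_smul],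
          norm_smul, Real.norm_of_nonneg (sub_nonneg.2 (f n).le_one)]
        exact mul_le_of_le_one_left (norm_nonneg _) (sub_le_self _ (f n).nonneg)
    · have : f n (y - x) = 0 := by
        refine (f n).zero_of_le_dist ?_
        rw [hf, dist_zero_right, ← dist_eq_norm]
        exact not_lt.1 hy
      rw [indicator_of_notMem hy, this, zero_smul, sub_zero, norm_zero]
      exact indicator_nonneg (fun _ _ => norm_nonneg _) _
  refine (norm_integral_le_integral_norm _).trans ?_
  refine (integral_mono_of_nonneg (Eventually.of_forall fun _ => norm_nonneg _)
    (hq.norm.indicator hTm) (Eventually.of_forall h2)).trans ?_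
  rw [integral_indicator hTm]
  have h3 : IntegrableOn q T (volume.restrict Ω) := hq.integrableOn
  rw [← ENNReal.ofReal_le_ofReal_iff hη.le, ofReal_integral_norm_eq_lintegral_enorm h3]
  exact (hcq T ((Measure.restrict_le_self _).trans_lt hTv)).le

/-- Mollified Sobolev functions are differentiable. -/
lemma hasFDerivAt_bump {Ω : Set (E d)} {u : E d → E d}
    {G : E d → E d →L[ℝ] E d} (hG : IsWeakGrad Ω u G) (hu : IntegrableOn u Ω)
    (hGi : IntegrableOn G Ω) (f : ContDiffBump (0 : E d)) {x : E d}
    (hx : closedBall x f.rOut ⊆ Ω) :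
    HasFDerivAt (fun x => ∫ y in Ω, f (y - x) • u y) (∫ y in Ω, f (y - x) • G y) x := by
  obtain ⟨C, hC⟩ := f.contDiff.lipschitzWith_of_hasCompactSupport (n := ∞) (𝕂 := ℝ)
    f.hasCompactSupport (by simp)
  have hfc : Continuous (fderiv ℝ f) := f.contDiff.continuous_fderiv (n := ∞) (by simp)
  have hfd : Differentiable ℝ f := f.contDiff.differentiable (n := ∞) (by simp)
  have hfC : ∀ z, ‖fderiv ℝ f z‖ ≤ C := fun z => norm_fderiv_le_of_lipschitz ℝ hC
  have hd : ∀ x y, HasFDerivAt (fun x => f (y - x) • u y)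
      ((-fderiv ℝ f (y - x)).smulRight (u y)) x := by
    intro x y
    have h1 : HasFDerivAt (fun x => f (y - x)) (-fderiv ℝ f (y - x)) x := by
      have h2 : HasFDerivAt (fun x : E d => y - x) (-ContinuousLinearMap.id ℝ (E d)) x :=
        (hasFDerivAt_id x).const_sub y
      have h3 := (hfd (y - x)).hasFDerivAt.comp x h2
      rwa [ContinuousLinearMap.comp_neg, ContinuousLinearMap.comp_id] at h3
    exact h1.smul_const (u y)
  have hm : AEStronglyMeasurable (fun y => (-fderiv ℝ f (y - x)).smulRight (u y))
      (volume.restrict Ω) := by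
    have hc : Continuous fun p : (E d →L[ℝ] ℝ) × E d => p.1.smulRight p.2 := by fun_prop
    refine hc.comp_aestronglyMeasurable₂ ?_ hu.aestronglyMeasurable
    exact (hfc.comp (continuous_id.sub continuous_const)).neg.aestronglyMeasurable
  have hint : IntegrableOn (fun y => f (y - x) • u y) Ω := by
    refine Integrable.mono hu.norm ?_ (Eventually.of_forall fun y => ?_)
    · exact (f.continuous.comp (continuous_id.sub continuous_const)).aestronglyMeasurable.smul
        hu.aestronglyMeasurable
    · rw [norm_smul, norm_norm, Real.norm_of_nonneg f.nonneg]
      exact mul_le_of_le_one_left (norm_nonneg _) f.le_one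
  have hbound : ∀ x y, ‖(-fderiv ℝ f (y - x)).smulRight (u y)‖ ≤ C * ‖u y‖ := fun x y => by
    rw [ContinuousLinearMap.norm_smulRight_apply, norm_neg]
    gcongr
    exact hfC _
  have key := hasFDerivAt_integral_of_dominated_of_fderiv_le (μ := volume.restrict Ω)
    (F := fun x y => f (y - x) • u y) (x₀ := x) (s := univ) (bound := fun y => C * ‖u y‖)
    univ_mem
    (Eventually.of_forall fun x =>
      (f.continuous.comp (continuous_id.sub continuous_const)).aestronglyMeasurable.smul
        hu.aestronglyMeasurable) hint hm
    (Eventually.of_forall fun y x _ => hbound x y) (hu.norm.const_mul _)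
    (Eventually.of_forall fun y x _ => hd x y)
  refine key.congr_fderiv ?_
  ext1 e
  have hi : IntegrableOn (fun y => (-fderiv ℝ f (y - x)).smulRight (u y)) Ω :=
    Integrable.mono' (hu.norm.const_mul C) hm (Eventually.of_forall fun y => hbound x y)
  have hGi2 : IntegrableOn (fun y => f (y - x) • G y) Ω := by
    refine Integrable.mono hGi.norm ?_ (Eventually.of_forall fun y => ?_)
    · exact (f.continuous.comp (continuous_id.sub continuous_const)).aestronglyMeasurable.smul
        hGi.aestronglyMeasurable
    · rw [norm_smul, norm_norm, Real.norm_of_nonneg f.nonneg]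
      exact mul_le_of_le_one_left (norm_nonneg _) f.le_one
  rw [ContinuousLinearMap.integral_apply hi, ContinuousLinearMap.integral_apply hGi2]
  -- Differentiation under the integral puts the derivative on the kernel. The kernel is itself a
  -- test function of `y`, so the weak gradient moves the derivative onto `u`; the two minus signs
  -- cancel.
  have htest : IsTestFun Ω fun y => f (y - x) := by
    have hts : tsupport (fun y => f (y - x)) ⊆ closedBall x f.rOut := by
      refine closure_minimal (fun y hy => ?_) isClosed_closedBall
      have : y - x ∈ Function.support f := hy
      rw [f.support_eq, mem_ball_zero_iff] at this
      rw [mem_closedBall, dist_eq_norm]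
      exact this.le
    exact ⟨f.contDiff.comp (contDiff_id.sub contDiff_const),
      (isCompact_closedBall _ _).of_isClosed_subset (isClosed_tsupport _) hts, hts.trans hx⟩
  have hw := hG.2 _ htest e
  have hfd2 : ∀ y, fderiv ℝ (fun y => f (y - x)) y = fderiv ℝ f (y - x) := fun y =>
    fderiv_comp_sub _
  simp_rw [hfd2] at hw
  simp only [_root_.smul_apply, ContinuousLinearMap.smulRight_apply, _root_.neg_apply, neg_smul,
    integral_neg]
  rw [hw, neg_neg]

/-- Ball integrals of a Sobolev function are continuously differentiable. -/
lemma hasFDerivAt_setIntegral_ball {Ω A : Set (E d)} (hA : IsOpen A)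
    {u : E d → E d} {G : E d → E d →L[ℝ] E d} (hG : IsWeakGrad Ω u G) (hu : IntegrableOn u Ω)
    (hGi : IntegrableOn G Ω) {r : ℝ} (hr : 0 < r) (hball : ∀ x ∈ A, closedBall x r ⊆ Ω)
    {x : E d} (hx : x ∈ A) :
    HasFDerivAt (fun x => ∫ y in ball x r, u y) (∫ y in ball x r, G y) x := by
  -- The outer radius is fixed at `r` and the inner one increases to `r`. The derivatives of the
  -- mollifications then converge uniformly on `A`, which passes differentiability to the limit.
  let f : ℕ → ContDiffBump (0 : E d) := fun n =>
    ⟨r * (1 - 1 / ((n : ℝ) + 2)), r, by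
      have : 1 / ((n : ℝ) + 2) < 1 := by rw [div_lt_one (by positivity)]; linarith [n.cast_nonneg (α := ℝ)]
      exact mul_pos hr (by linarith), by
      have : 0 < 1 / ((n : ℝ) + 2) := by positivity
      nlinarith⟩
  have hf : ∀ n, (f n).rOut = r := fun n => rfl
  have hin : Tendsto (fun n => (f n).rIn) atTop (𝓝 r) := by
    have h1 : Tendsto (fun n : ℕ => 1 / ((n : ℝ) + 2)) atTop (𝓝 0) := by
      have := (tendsto_one_div_add_atTop_nhds_zero_nat (𝕜 := ℝ)).comp (tendsto_add_atTop_nat 1)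
      refine this.congr fun n => ?_
      simp only [Function.comp_apply]
      push_cast
      ring
    have h2 := (tendsto_const_nhds (x := (1 : ℝ)).sub h1).const_mul r
    simpa [f] using h2
  refine hasFDerivAt_of_tendstoUniformlyOn (l := atTop) (f := fun n x => ∫ y in Ω, f n (y - x) • u y)
    (f' := fun n x => ∫ y in Ω, f n (y - x) • G y) (g' := fun x => ∫ y in ball x r, G y) hA ?_
    (fun n x hx => hasFDerivAt_bump hG hu hGi (f n) (by rw [hf]; exact hball x hx)) ?_ hx
  · rw [Metric.tendstoUniformlyOn_iff]
    intro η hη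
    filter_upwards [eventually_norm_bump_sub_ball_le hGi hr hf hin (half_pos hη)] with n hn x hx
    rw [dist_eq_norm]
    exact (hn x (ball_subset_closedBall.trans (hball x hx))).trans_lt (half_lt_self hη)
  · intro x hx
    rw [Metric.tendsto_nhds]
    intro η hη
    filter_upwards [eventually_norm_bump_sub_ball_le hu hr hf hin (half_pos hη)] with n hn
    rw [dist_comm, dist_eq_norm]
    exact (hn x (ball_subset_closedBall.trans (hball x hx))).trans_lt (half_lt_self hη)

lemma hasFDerivAt_average_ball {Ω A : Set (E d)} (hA : IsOpen A)
    {u : E d → E d} {G : E d → E d →L[ℝ] E d} (hG : IsWeakGrad Ω u G) (hu : IntegrableOn u Ω)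
    (hGi : IntegrableOn G Ω) {r : ℝ} (hr : 0 < r) (hball : ∀ x ∈ A, closedBall x r ⊆ Ω)
    {x : E d} (hx : x ∈ A) :
    HasFDerivAt (fun x => ⨍ y in ball x r, u y) (⨍ y in ball x r, G y) x := by
  simp_rw [setAverage_eq, measureReal_def, Measure.addHaar_ball_center]
  exact (hasFDerivAt_setIntegral_ball hA hG hu hGi hr hball hx).const_smul
    ((volume (ball (0 : E d) r)).toReal⁻¹)

end Averages

/-! ### Approximate limits and differentials -/

section Density

variable {d : ℕ}

lemma HasDensityZero.or {P Q : E d → Prop} {x : E d} (hP : HasDensityZero P x)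
    (hQ : HasDensityZero Q x) : HasDensityZero (fun y => P y ∨ Q y) x := by
  refine tendsto_of_tendsto_of_tendsto_of_le_of_le tendsto_const_nhds
    (by simpa using hP.add hQ) (fun _ => zero_le) fun r => ?_
  rw [← ENNReal.add_div]
  gcongr
  refine (measure_mono ?_).trans (measure_union_le _ _)
  rintro y ⟨hy, h | h⟩
  exacts [Or.inl ⟨hy, h⟩, Or.inr ⟨hy, h⟩]

lemma hasDensityZero_of_eventually {P : E d → Prop} {x : E d} (h : ∀ᶠ y in 𝓝 x, ¬P y) :
    HasDensityZero P x := by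
  obtain ⟨ρ, hρ, hball⟩ := Metric.eventually_nhds_iff_ball.1 h
  refine tendsto_const_nhds.congr' ?_
  filter_upwards [Ioo_mem_nhdsGT hρ] with r hr
  have : {y | y ∈ ball x r ∧ P y} = ∅ := by
    ext y
    simp only [mem_ofPred_eq, mem_empty_iff_false, iff_false, not_and]
    exact fun hy => hball y (ball_subset_ball hr.2.le hy)
  rw [this, measure_empty, ENNReal.zero_div]

/-- Every thin cone with vertex `x` contains points close to `x` that avoid a given set of density
zero. -/
lemma HasDensityZero.exists_not_mem_cone {P : E d → Prop} {x : E d} (h : HasDensityZero P x)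
    {e : E d} (he : ‖e‖ = 1) {τ : ℝ} (hτ : 0 < τ) (hτ2 : τ ≤ 1 / 2) {ρ : ℝ} (hρ : 0 < ρ) :
    ∃ r, 0 < r ∧ r < ρ ∧ ∃ y, ‖y - x - (r / 2) • e‖ < τ * r ∧ ¬P y := by
  -- `τ ^ d` is the volume fraction in `ball x r` of the ball of radius `τ r` about `x + (r/2) e`. A
  -- bad set of smaller density cannot fill that ball.
  have hτd : (0 : ℝ≥0∞) < ENNReal.ofReal (τ ^ d) := by simpa using pow_pos hτ d
  obtain ⟨r, hr1, hr⟩ := ((h.eventually_lt_const hτd).and (Ioo_mem_nhdsGT hρ)).exists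
  refine ⟨r, hr.1, hr.2, ?_⟩
  by_contra! hall
  refine absurd hr1 (not_lt.2 ?_)
  have hr0 := hr.1
  have hsub : ball (x + (r / 2) • e) (τ * r) ⊆ {y | y ∈ ball x r ∧ P y} := by
    intro y hy
    rw [mem_ball, dist_eq_norm, ← sub_sub] at hy
    refine ⟨?_, hall y hy⟩
    rw [mem_ball, dist_eq_norm]
    calc ‖y - x‖ = ‖(y - x - (r / 2) • e) + (r / 2) • e‖ := by rw [sub_add_cancel]
      _ ≤ ‖y - x - (r / 2) • e‖ + ‖(r / 2) • e‖ := norm_add_le _ _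
      _ < τ * r + r / 2 := by
        rw [norm_smul, he, mul_one, Real.norm_of_nonneg (by positivity)]
        gcongr
      _ ≤ r := by nlinarith
  have hv : volume (ball x r) ≠ 0 := (measure_ball_pos _ _ hr0).ne'
  rw [ENNReal.le_div_iff_mul_le (Or.inl hv) (Or.inl measure_ball_lt_top.ne)]
  refine le_trans (le_of_eq ?_) (measure_mono hsub)
  rw [Measure.addHaar_ball_of_pos _ _ (mul_pos hτ hr0), Measure.addHaar_ball_of_pos _ _ hr0,
    finrank_euclideanSpace_fin, mul_pow, ENNReal.ofReal_mul (by positivity), mul_assoc]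

lemma norm_le_of_cone {x y e : E d} (he : ‖e‖ = 1) {τ r : ℝ} (hτ2 : τ ≤ 1 / 2) (hr : 0 < r)
    (hy : ‖y - x - (r / 2) • e‖ < τ * r) : ‖y - x‖ ≤ r := by
  calc ‖y - x‖ = ‖(y - x - (r / 2) • e) + (r / 2) • e‖ := by rw [sub_add_cancel]
    _ ≤ ‖y - x - (r / 2) • e‖ + ‖(r / 2) • e‖ := norm_add_le _ _
    _ ≤ τ * r + r / 2 := by
      rw [norm_smul, he, mul_one, Real.norm_of_nonneg (by positivity)]
      gcongr
    _ ≤ r := by nlinarith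

/-- Near `x + (r/2) e` there are points at which both expansions hold. Their difference controls `(a
- a') + (r/2)(L - L') e` up to an arbitrarily small multiple of `r`: letting `r → 0` gives `a = a'`,
and dividing by `r` gives `(L - L') e = 0`. -/
lemma IsApproxDiff.unique {u : E d → E d} {x : E d} {L L' : E d →L[ℝ] E d}
    (h : IsApproxDiff u x L) (h' : IsApproxDiff u x L') : L = L' := by
  obtain ⟨a, ha⟩ := h
  obtain ⟨a', ha'⟩ := h'
  have key : ∀ e : E d, ‖e‖ = 1 → ∀ η > 0, ∀ τ > 0, τ ≤ 1 / 2 → ∀ ρ > 0, ∃ r, 0 < r ∧ r < ρ ∧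
      ‖(a - a') + (r / 2) • (L - L') e‖ ≤ (2 * η + ‖L - L'‖ * τ) * r := by
    intro e he η hη τ hτ hτ2 ρ hρ
    obtain ⟨r, hr0, hrρ, y, hy, hyP⟩ := ((ha η hη).or (ha' η hη)).exists_not_mem_cone he hτ hτ2 hρ
    refine ⟨r, hr0, hrρ, ?_⟩
    simp only [not_or, not_lt] at hyP
    have hyr := norm_le_of_cone he hτ2 hr0 hy
    have e1 : (a - a') + (r / 2) • (L - L') e = (u y - a' - L' (y - x)) - (u y - a - L (y - x)) -
        (L - L') (y - x - (r / 2) • e) := by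
      simp only [_root_.sub_apply, map_sub, map_smul, smul_sub]
      abel
    rw [e1]
    calc _ ≤ ‖u y - a' - L' (y - x)‖ + ‖u y - a - L (y - x)‖ +
          ‖(L - L') (y - x - (r / 2) • e)‖ :=
          (norm_sub_le _ _).trans (add_le_add_left (norm_sub_le _ _) _)
      _ ≤ η * r + η * r + ‖L - L'‖ * (τ * r) := by
        refine add_le_add (add_le_add (hyP.2.trans ?_) (hyP.1.trans ?_)) ?_
        · gcongr
        · gcongr
        · exact ((L - L').le_opNorm _).trans (by gcongr)
      _ = _ := by ring
  have haa : ∀ e : E d, ‖e‖ = 1 → a = a' := by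
    intro e he
    rw [← sub_eq_zero, ← norm_le_zero_iff]
    refine le_of_forall_pos_le_add fun c hc => ?_
    set B := 2 * 1 + ‖L - L'‖ * (1 / 2) + ‖(L - L') e‖ + 1 with hB
    have hB0 : 0 < B := by positivity
    obtain ⟨r, hr0, hr, h1⟩ := key e he 1 one_pos (1 / 2) (by norm_num) le_rfl (c / B) (by positivity)
    have h2 : ‖a - a'‖ ≤ ‖(a - a') + (r / 2) • (L - L') e‖ + ‖(r / 2) • (L - L') e‖ := by
      simpa using norm_sub_le ((a - a') + (r / 2) • (L - L') e) ((r / 2) • (L - L') e)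
    rw [norm_smul, Real.norm_of_nonneg (by positivity)] at h2
    rw [lt_div_iff₀ hB0] at hr
    have : 0 ≤ ‖(L - L') e‖ := norm_nonneg _
    nlinarith [mul_nonneg hr0.le this]
  have hunit : ∀ e : E d, ‖e‖ = 1 → (L - L') e = 0 := by
    intro e he
    rw [← norm_le_zero_iff]
    refine le_of_forall_pos_le_add fun c hc => ?_
    set τ := min (1 / 2) (c / (4 * (‖L - L'‖ + 1))) with hτ
    have hτ0 : 0 < τ := by positivity
    have hτc : ‖L - L'‖ * τ ≤ c / 4 := by
      have : τ ≤ c / (4 * (‖L - L'‖ + 1)) := min_le_right _ _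
      calc ‖L - L'‖ * τ ≤ (‖L - L'‖ + 1) * (c / (4 * (‖L - L'‖ + 1))) := by
            gcongr; linarith
        _ = c / 4 := by field_simp
    obtain ⟨r, hr0, -, h1⟩ := key e he (c / 8) (by positivity) τ hτ0 (min_le_left _ _) 1 one_pos
    rw [haa e he, sub_self, zero_add, norm_smul, Real.norm_of_nonneg (by positivity)] at h1
    have h2 : r * (‖(L - L') e‖ / 2) ≤ r * (c / 2) := by nlinarith
    have h3 := le_of_mul_le_mul_left h2 hr0
    linarith
  rw [← sub_eq_zero]
  ext1 z
  rcases eq_or_ne z 0 with rfl | hz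
  · simp
  · have h1 := hunit (‖z‖⁻¹ • z) (by rw [norm_smul, norm_inv, norm_norm, inv_mul_cancel₀ (by simpa)])
    rw [map_smul, smul_eq_zero] at h1
    simpa [hz] using h1

lemma isApproxDiff_of_hasFDerivAt {u : E d → E d} {x : E d} {L : E d →L[ℝ] E d}
    (h : HasFDerivAt u L x) : IsApproxDiff u x L := by
  refine ⟨u x, fun η hη => hasDensityZero_of_eventually ?_⟩
  filter_upwards [(hasFDerivAt_iff_isLittleO.1 h).def hη] with y hy
  exact not_lt.2 hy

lemma approxGrad_eq_of_hasFDerivAt {u : E d → E d} {x : E d} {L : E d →L[ℝ] E d}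
    (h : HasFDerivAt u L x) : approxGrad u x = L := by
  have hL := isApproxDiff_of_hasFDerivAt h
  have hex : ∃ L, IsApproxDiff u x L := ⟨L, hL⟩
  rw [approxGrad, dif_pos hex]
  exact hex.choose_spec.unique hL

/-- A thin cone about `ν` lies in the open half space of `ν`, so each one-sided limit is attained
along points tending to `x` and must equal `u x`. -/
lemma notMem_jumpSet_of_continuousAt {A : Set (E d)} {u : E d → E d} {x : E d}
    (h : ContinuousAt u x) : x ∉ jumpSet A u := by
  rintro ⟨-, a, b, ν, hab, hν, H⟩
  have side : ∀ (c e : E d), ‖e‖ = 1 →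
      (∀ η : ℝ, 0 < η → HasDensityZero (fun y => 0 < inner ℝ (y - x) e ∧ η < ‖u y - c‖) x) →
      u x = c := by
    intro c e he hc
    rw [← sub_eq_zero, ← norm_le_zero_iff]
    refine le_of_forall_pos_le_add fun η hη => ?_
    obtain ⟨ρ, hρ, hball⟩ := Metric.continuousAt_iff.1 h (η / 2) (by positivity)
    obtain ⟨r, hr0, hrρ, y, hy, hyP⟩ :=
      (hc (η / 2) (by positivity)).exists_not_mem_cone he (τ := 1 / 4) (by norm_num) (by norm_num) hρ
    have hyr := norm_le_of_cone he (by norm_num) hr0 hy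
    have hin : 0 < inner ℝ (y - x) e := by
      have h1 : inner ℝ (y - x) e = inner ℝ (y - x - (r / 2) • e) e + r / 2 := by
        rw [inner_sub_left (y - x), inner_smul_left, real_inner_self_eq_norm_sq, he]
        simp
      have h2 := abs_real_inner_le_norm (y - x - (r / 2) • e) e
      rw [he, mul_one] at h2
      have h3 := neg_abs_le (inner ℝ (y - x - (r / 2) • e) e)
      linarith
    have hyc : ‖u y - c‖ ≤ η / 2 := not_lt.1 fun h' => hyP ⟨hin, h'⟩
    have hyx : dist (u y) (u x) < η / 2 :=
      hball (by rw [dist_eq_norm]; exact hyr.trans_lt hrρ)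
    rw [dist_eq_norm, norm_sub_rev] at hyx
    calc ‖u x - c‖ = ‖(u x - u y) + (u y - c)‖ := by congr 1; abel
      _ ≤ _ := norm_add_le _ _
      _ ≤ 0 + η := by linarith
  refine hab ((side a ν hν fun η hη => (H η hη).1).symm.trans
    (side b (-ν) (by rwa [norm_neg]) fun η hη => ?_))
  simpa only [inner_neg_right, Left.neg_pos_iff] using (H η hη).2

/-- Sets of density zero at `x` do not exhaust `S` near `x`. -/
def HasPosDensity (S : Set (E d)) (x : E d) : Prop :=
  ∀ P : E d → Prop, HasDensityZero P x → ∃ᶠ y in 𝓝 x, y ∈ S ∧ ¬P y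

/-- An approximate limit would be within `|h x| / 4` of `c` and also of some `h y + c` with `|h y -
h x| < |h x| / 4`, forcing `|h x| ≤ 3 |h x| / 4`. -/
lemma mem_approxDiscSet {A S : Set (E d)} {x : E d} (hA : IsOpen A) (hx : x ∈ A)
    (hS : HasPosDensity S x) (hS' : HasPosDensity Sᶜ x) {f h : E d → ℝ} {c : ℝ}
    (hfS : ∀ y ∈ A, y ∈ S → f y = h y + c) (hfn : ∀ y ∈ A, y ∉ S → f y = c)
    (hh : ContinuousAt h x) (h0 : h x ≠ 0) : x ∈ approxDiscSet A f := by
  refine ⟨hx, ?_⟩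
  rintro ⟨z, hz⟩
  have hη : 0 < |h x| / 4 := by positivity
  have hAx : ∀ᶠ y in 𝓝 x, y ∈ A := hA.mem_nhds hx
  obtain ⟨y, ⟨hyS, hyz⟩, hyA, hyh⟩ := ((hS _ (hz _ hη)).and_eventually
    (hAx.and (Metric.tendsto_nhds.1 hh _ hη))).exists
  obtain ⟨y', ⟨hyS', hyz'⟩, hyA'⟩ := ((hS' _ (hz _ hη)).and_eventually hAx).exists
  rw [hfS y hyA hyS, not_lt] at hyz
  rw [hfn y' hyA' hyS', not_lt] at hyz'
  rw [Real.dist_eq] at hyh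
  have hpos : 0 < |h x| := abs_pos.2 h0
  have : |h x| ≤ |h y - h x| + |h y + c - z| + |c - z| := by
    have e1 : h x = -(h y - h x) + (h y + c - z) - (c - z) := by ring
    calc |h x| = |-(h y - h x) + (h y + c - z) - (c - z)| := by rw [← e1]
      _ ≤ |-(h y - h x) + (h y + c - z)| + |c - z| := abs_sub _ _
      _ ≤ _ := by
        gcongr
        exact (abs_add_le _ _).trans (by rw [abs_neg])
  linarith

/-- At a regular point of a level set both sides have positive density. -/
lemma hasPosDensity_of_hasFDerivAt {g : E d → ℝ} {x : E d} {L : E d →L[ℝ] ℝ}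
    (hg : HasFDerivAt g L x) (hL : ‖L‖ = 1) :
    HasPosDensity {y | g x < g y} x ∧ HasPosDensity {y | g x < g y}ᶜ x := by
  set n := (InnerProductSpace.toDual ℝ (E d)).symm L with hn
  have hn1 : ‖n‖ = 1 := by rw [hn, LinearIsometryEquiv.norm_map, hL]
  have hLn : ∀ y, L y = inner ℝ n y := fun y => by
    rw [hn, InnerProductSpace.toDual_symm_apply]
  -- Points near `x + (r/2) σ n` change `g` by `r/2` in the direction of `σ`. The differentiation
  -- error and the cone's aperture cost `r/8` each, so the sign is kept.
  have key : ∀ σ : ℝ, |σ| = 1 → ∀ P : E d → Prop, HasDensityZero P x →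
      ∃ᶠ y in 𝓝 x, 0 < σ * (g y - g x) ∧ ¬P y := by
    intro σ hσ P hP
    rw [Metric.nhds_basis_ball.frequently_iff]
    intro ρ hρ
    obtain ⟨ρ', hρ', hlo⟩ := Metric.eventually_nhds_iff_ball.1
      ((hasFDerivAt_iff_isLittleO.1 hg).def (c := 1 / 8) (by norm_num))
    have hσn : ‖σ • n‖ = 1 := by rw [norm_smul, Real.norm_eq_abs, hσ, hn1, mul_one]
    have hσσ : σ * σ = 1 := by rw [← abs_mul_abs_self, hσ, mul_one]
    obtain ⟨r, hr0, hr, y, hy, hyP⟩ := hP.exists_not_mem_cone hσn (τ := 1 / 8) (by norm_num)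
      (by norm_num) (lt_min hρ hρ')
    have hyr := norm_le_of_cone hσn (by norm_num) hr0 hy
    refine ⟨y, ?_, ?_, hyP⟩
    · rw [mem_ball, dist_eq_norm]; exact hyr.trans_lt (hr.trans_le (min_le_left _ _))
    · have h1 := hlo y (by
        rw [mem_ball, dist_eq_norm]; exact hyr.trans_lt (hr.trans_le (min_le_right _ _)))
      rw [Real.norm_eq_abs] at h1
      have h2 : L (y - x) = L (y - x - (r / 2) • σ • n) + r / 2 * σ := by
        rw [map_sub L (y - x), map_smul, map_smul, hLn n, real_inner_self_eq_norm_sq, hn1]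
        simp
      have h3 : |L (y - x - (r / 2) • σ • n)| ≤ 1 / 8 * r := by
        refine (L.le_opNorm _).trans ?_
        rw [hL, one_mul]
        exact hy.le
      have h4 : σ * (g y - g x) = σ * (g y - g x - L (y - x)) +
          σ * L (y - x - (r / 2) • σ • n) + r / 2 * (σ * σ) := by rw [h2]; ring
      rw [h4, hσσ]
      have h5 : |σ * (g y - g x - L (y - x))| ≤ 1 / 8 * r := by
        rw [abs_mul, hσ, one_mul]; linarith
      have h6 : |σ * L (y - x - (r / 2) • σ • n)| ≤ 1 / 8 * r := by
        rw [abs_mul, hσ, one_mul]; exact h3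
      have h7 := (abs_le.1 h5).1
      have h8 := (abs_le.1 h6).1
      linarith
  refine ⟨fun P hP => (key 1 (by simp) P hP).mono fun y hy => ⟨?_, hy.2⟩,
    fun P hP => (key (-1) (by simp) P hP).mono fun y hy => ⟨?_, hy.2⟩⟩
  · have := hy.1
    change g x < g y
    linarith
  · have := hy.1
    change ¬ g x < g y
    linarith

end Density

/-! ### Functions that are cut off along a regular set -/

section Cut

variable {d : ℕ}

/-- `S` is an open set whose relative boundary in `A` is contained in the null set `T`, and the
distributional gradient of its indicator function is `n ν` with `ν` concentrated on those points of
`T` at which neither `S` nor its complement has density zero. -/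
structure IsCut (A S T : Set (E d)) (ν : Measure (E d)) (n : E d → E d →L[ℝ] ℝ) : Prop where
  isOpen : IsOpen S
  isClosed : IsClosed (S ∪ T)
  disj : Disjoint S T
  null : volume (A ∩ T) = 0
  finite : IsFiniteMeasure ν
  concentrated : ∀ᵐ x ∂ν, x ∈ T
  meas : Measurable n
  norm_le : ∀ x, ‖n x‖ ≤ 1
  grad : ∀ ψ : E d → ℝ, ContDiff ℝ 1 ψ → HasCompactSupport ψ → tsupport ψ ⊆ A → ∀ e,
    ∫ x in S, fderiv ℝ ψ x e = -∫ x, ψ x * n x e ∂ν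
  dens : ∀ᵐ x ∂ν, HasPosDensity S x ∧ HasPosDensity Sᶜ x

lemma IsCut.measurableSet {A S T : Set (E d)} {ν : Measure (E d)} {n : E d → E d →L[ℝ] ℝ}
    (h : IsCut A S T ν n) : MeasurableSet T := by
  have : T = (S ∪ T) \ S := by
    rw [union_sdiff_left, (disjoint_iff_inter_eq_empty.2 ?_ : Disjoint T S).sdiff_eq_left]
    rw [inter_comm]; exact disjoint_iff_inter_eq_empty.1 h.disj
  rw [this]
  exact h.isClosed.measurableSet.diff h.isOpen.measurableSet

lemma integral_fderiv_of_hasCompactSupport {ψ : E d → ℝ} (hψ : ContDiff ℝ 1 ψ)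
    (hψc : HasCompactSupport ψ) (e : E d) : ∫ x, fderiv ℝ ψ x e = 0 := by
  have h1 : Integrable fun x => fderiv ℝ ψ x e :=
    ((hψ.continuous_fderiv one_ne_zero).clm_apply continuous_const).integrable_of_hasCompactSupport
      (hψc.fderiv_apply ℝ e)
  have h2 := integral_mul_fderiv_eq_neg_fderiv_mul_of_integrable (μ := volume) (f := fun _ => (1 : ℝ))
    (g := ψ) (v := e) (by simp) (by simpa using h1)
    (by simpa using hψ.continuous.integrable_of_hasCompactSupport hψc)
    (fun x _ => differentiableAt_const _) (fun x _ => hψ.differentiable one_ne_zero x)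
  simpa using h2

/-- The case of an empty concentration set, where nothing is cut. It also puts `C¹` functions within
reach of `IsCut.memGSBVp`. -/
lemma isCut_univ (A : Set (E d)) : IsCut A univ ∅ 0 0 where
  isOpen := isOpen_univ
  isClosed := by simp
  disj := disjoint_empty _
  null := by simp
  finite := inferInstance
  concentrated := by simp
  meas := measurable_zero
  norm_le := by simp
  grad := fun ψ hψ hψc _ e => by
    rw [setIntegral_univ, integral_fderiv_of_hasCompactSupport hψ hψc]; simp
  dens := by simp

/-- A function whose distributional gradient is `Y κ` is in `SBV_loc` if `Y κ` does not charge
Lebesgue null sets off the approximate discontinuity set. -/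
lemma isSBVLoc_of_density {A : Set (E d)} (hA : IsOpen A) {f : E d → ℝ}
    (hf : LocallyIntegrableOn f A volume) (κ : Measure (E d))
    (hκ : ∀ K, IsCompact K → K ⊆ A → κ K < ⊤) {Y : E d → E d} (hY : Measurable Y)
    (hYb : ∀ K, IsCompact K → K ⊆ A → ∃ C, ∀ x ∈ K, ‖Y x‖ ≤ C)
    (hform : ∀ φ : E d → ℝ, IsTestFun A φ → ∀ e : E d,
      ∫ x in A, f x * fderiv ℝ φ x e = - ∫ x in A, φ x * inner ℝ (Y x) e ∂κ)
    (hnull : ∀ B, MeasurableSet B → B ⊆ A \ approxDiscSet A f → volume B = 0 →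
      ∀ᵐ x ∂κ, x ∈ B → Y x = 0) : IsSBVLoc A f := by
  have hYn : Measurable fun x => (‖Y x‖₊ : ℝ≥0∞) := hY.nnnorm.coe_nnreal_ennreal
  -- Polar decomposition of `Y κ`: total variation `‖Y‖ κ` and direction `Y / ‖Y‖`. The value of the
  -- direction where `Y = 0` is irrelevant, since the total variation does not charge that set.
  refine ⟨hf, κ.withDensity fun x => (‖Y x‖₊ : ℝ≥0∞), fun x => ‖Y x‖⁻¹ • Y x, ?_,
    hY.norm.inv.smul hY, ?_, ?_, ?_⟩
  · intro K hK hKA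
    obtain ⟨C, hC⟩ := hYb K hK hKA
    rw [withDensity_apply _ hK.measurableSet]
    calc ∫⁻ x in K, (‖Y x‖₊ : ℝ≥0∞) ∂κ ≤ ∫⁻ x in K, ENNReal.ofReal C ∂κ := by
          refine setLIntegral_mono' hK.measurableSet fun x hx => ?_
          rw [← enorm_eq_nnnorm, ← ofReal_norm]
          exact ENNReal.ofReal_le_ofReal (hC x hx)
      _ < ⊤ := by
          rw [setLIntegral_const]
          exact ENNReal.mul_lt_top ENNReal.ofReal_lt_top (hκ K hK hKA)
  · rw [restrict_withDensity hA.measurableSet, ae_withDensity_iff hYn]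
    refine Eventually.of_forall fun x hx => ?_
    have : ‖Y x‖ ≠ 0 := by simpa using hx
    rw [norm_smul, norm_inv, norm_norm, inv_mul_cancel₀ this]
  · intro φ hφ e
    rw [hform φ hφ e, setIntegral_withDensity_eq_setIntegral_smul hY.nnnorm _ hA.measurableSet]
    congr 2
    funext x
    rw [NNReal.smul_def, coe_nnnorm, smul_eq_mul, inner_smul_left]
    rcases eq_or_ne (Y x) 0 with h | h
    · simp [h]
    · have : ‖Y x‖ ≠ 0 := by simpa using h
      simp only [map_inv₀, conj_trivial]
      field_simp
  · intro B hB hBA hB0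
    rw [withDensity_apply _ hB, lintegral_eq_zero_iff hYn]
    filter_upwards [ae_restrict_of_ae (hnull B hB hBA hB0), ae_restrict_mem hB] with x hx hxB
    simp [hx hxB]

lemma contDiff_mul_of_tsupport_subset {A : Set (E d)} (hA : IsOpen A) {ζ h : E d → ℝ}
    (hζ : ContDiff ℝ 1 ζ) (hζA : tsupport ζ ⊆ A) (hh : ContDiffOn ℝ 1 h A) :
    ContDiff ℝ 1 fun x => ζ x * h x := by
  rw [contDiff_iff_contDiffAt]
  intro x
  by_cases hx : x ∈ A
  · exact hζ.contDiffAt.mul (hh.contDiffAt (hA.mem_nhds hx))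
  · have : (fun x => ζ x * h x) =ᶠ[𝓝 x] fun _ => 0 := by
      filter_upwards [(isClosed_tsupport ζ).isOpen_compl.mem_nhds fun h' => hx (hζA h')] with y hy
      rw [image_eq_zero_of_notMem_tsupport hy, zero_mul]
    exact contDiffAt_const.congr_of_eventuallyEq this

lemma continuous_mul_of_tsupport_subset {A : Set (E d)} (hA : IsOpen A) {ζ h : E d → ℝ}
    (hζ : Continuous ζ) (hζA : tsupport ζ ⊆ A) (hh : ContinuousOn h A) :
    Continuous fun x => ζ x * h x :=
  (hζ.continuousOn.mul hh).continuous_of_tsupport_subset hA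
    ((tsupport_mul_subset_left).trans hζA)

lemma locallyIntegrableOn_cut {V : Type*} [NormedAddCommGroup V] {A S : Set (E d)}
    (hA : IsOpen A) (hS : MeasurableSet S) {h f : E d → V} (hh : ContinuousOn h A) {c : V}
    (hfS : ∀ x ∈ A, x ∈ S → f x = h x) (hfn : ∀ x ∈ A, x ∉ S → f x = c) :
    LocallyIntegrableOn f A volume := by
  rw [locallyIntegrableOn_iff hA.isLocallyClosed]
  intro K hKA hK
  have h1 : IntegrableOn (S.indicator h + Sᶜ.indicator fun _ => c) K :=
    (((hh.mono hKA).integrableOn_compact hK).indicator hS).add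
      ((integrableOn_const hK.measure_lt_top.ne).indicator hS.compl)
  refine h1.congr_fun (fun x hx => ?_) hK.measurableSet
  by_cases hxS : x ∈ S
  · simp [hxS, hfS x (hKA hx) hxS]
  · simp [hxS, hfn x (hKA hx) hxS]

/-- By the product rule, `f = 1_S h + c` has gradient `1_S ∇h` with respect to Lebesgue measure plus
`h n` with respect to `ν`. For `ν`-almost every point, either `h ≠ 0` and the point is an
approximate discontinuity, or `h = 0` and the density vanishes; so there is no Cantor part. -/
lemma IsCut.isSBVLoc {A S T : Set (E d)} {ν : Measure (E d)} {n : E d → E d →L[ℝ] ℝ}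
    (hcut : IsCut A S T ν n) (hA : IsOpen A) {h f : E d → ℝ} (hh : ContDiffOn ℝ 1 h A) {c : ℝ}
    (hfS : ∀ x ∈ A, x ∈ S → f x = h x + c) (hfn : ∀ x ∈ A, x ∉ S → f x = c) :
    IsSBVLoc A f := by
  have := hcut.finite
  have hSm : MeasurableSet S := hcut.isOpen.measurableSet
  have hTm : MeasurableSet T := hcut.measurableSet
  have hAm : MeasurableSet A := hA.measurableSet
  have hhc : ContinuousOn h A := hh.continuousOn
  have hhf : ContinuousOn (fderiv ℝ h) A := hh.continuousOn_fderiv_of_isOpen hA le_rfl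
  have hhm : Measurable (A.indicator h) := by
    classical
    rw [← piecewise_eq_indicator]
    exact hhc.measurable_piecewise continuousOn_const hAm
  -- the density of the gradient
  set Z : E d → E d →L[ℝ] ℝ := fun x => T.indicator (fun x => A.indicator h x • n x) x +
    (A ∩ S).indicator (fderiv ℝ h) x with hZ
  have hZm : Measurable Z := ((hhm.smul hcut.meas).indicator hTm).add
    ((measurable_fderiv ℝ h).indicator (hAm.inter hSm))
  have hZT : ∀ x ∈ A, x ∈ T → Z x = h x • n x := fun x hxA hxT => by
    have hxS : x ∉ S := fun hxS => disjoint_left.1 hcut.disj hxS hxT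
    simp [hZ, hxA, hxT, hxS]
  have hZS : ∀ x ∈ A, x ∉ T → Z x = S.indicator (fderiv ℝ h) x := fun x hxA hxT => by
    by_cases hxS : x ∈ S <;> simp [hZ, hxA, hxT, hxS]
  have hZb : ∀ K, IsCompact K → K ⊆ A → ∃ C, ∀ x ∈ K, ‖Z x‖ ≤ C := by
    intro K hK hKA
    obtain ⟨C₁, hC₁⟩ := hK.exists_bound_of_continuousOn (hhc.mono hKA)
    obtain ⟨C₂, hC₂⟩ := hK.exists_bound_of_continuousOn (hhf.mono hKA)
    refine ⟨max C₁ C₂, fun x hx => ?_⟩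
    by_cases hxT : x ∈ T
    · rw [hZT x (hKA hx) hxT, norm_smul]
      exact (mul_le_of_le_one_right (norm_nonneg _) (hcut.norm_le x)).trans
        ((hC₁ x hx).trans (le_max_left _ _))
    · rw [hZS x (hKA hx) hxT]
      exact (norm_indicator_le_norm_self _ _).trans ((hC₂ x hx).trans (le_max_right _ _))
  set κ : Measure (E d) := volume + ν with hκ
  have hκK : ∀ K, IsCompact K → K ⊆ A → κ K < ⊤ := fun K hK _ =>
    ENNReal.add_lt_top.2 ⟨hK.measure_lt_top, measure_lt_top _ _⟩
  refine isSBVLoc_of_density hA (locallyIntegrableOn_cut hA hSm (hhc.add continuousOn_const) hfS hfn)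
    κ hκK (Y := fun x => (InnerProductSpace.toDual ℝ (E d)).symm (Z x)) ?_ ?_ ?_ ?_
  · exact (InnerProductSpace.toDual ℝ (E d)).symm.continuous.measurable.comp hZm
  · simpa only [LinearIsometryEquiv.norm_map] using hZb
  · intro ζ hζ e
    simp_rw [InnerProductSpace.toDual_symm_apply]
    have hζ1 : ContDiff ℝ 1 ζ := hζ.smooth.of_le (by exact_mod_cast le_top)
    have hζc : Continuous ζ := hζ1.continuous
    have hζd : Continuous fun x => fderiv ℝ ζ x e :=
      (hζ1.continuous_fderiv one_ne_zero).clm_apply continuous_const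
    have hζds : tsupport (fun x => fderiv ℝ ζ x e) ⊆ tsupport ζ :=
      tsupport_fderiv_apply_subset ℝ e
    have hζo : ∀ x, x ∉ A → ζ x = 0 := fun x hx =>
      image_eq_zero_of_notMem_tsupport fun h' => hx (hζ.supp_subset h')
    have hζdo : ∀ x, x ∉ A → fderiv ℝ ζ x e = 0 := fun x hx =>
      image_eq_zero_of_notMem_tsupport (f := fun x => fderiv ℝ ζ x e)
        fun h' => hx (hζ.supp_subset (hζds h'))
    have hcs := hζ.compact_supp
    have hcds : HasCompactSupport fun x => fderiv ℝ ζ x e := hcs.fderiv_apply ℝ e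
    have hi1 : Integrable fun x => fderiv ℝ ζ x e * h x :=
      (continuous_mul_of_tsupport_subset hA hζd (hζds.trans hζ.supp_subset)
        hhc).integrable_of_hasCompactSupport hcds.mul_right
    have hi2 : Integrable fun x => ζ x * fderiv ℝ h x e :=
      (continuous_mul_of_tsupport_subset hA hζc hζ.supp_subset
        (hhf.clm_apply continuousOn_const)).integrable_of_hasCompactSupport hcs.mul_right
    have hi3 : Integrable fun x => fderiv ℝ ζ x e := hζd.integrable_of_hasCompactSupport hcds
    -- left-hand side
    have hL : ∫ x in A, f x * fderiv ℝ ζ x e = ∫ x in S, fderiv ℝ ζ x e * h x := by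
      have h1 : ∫ x in A, f x * fderiv ℝ ζ x e =
          ∫ x, (S.indicator (fun x => fderiv ℝ ζ x e * h x) x + c * fderiv ℝ ζ x e) := by
        rw [← integral_indicator hAm]
        congr 1
        funext x
        by_cases hxA : x ∈ A
        · by_cases hxS : x ∈ S
          · simp only [hxA, hxS, indicator_of_mem, hfS x hxA hxS]; ring
          · simp [hxA, hxS, hfn x hxA hxS]
        · by_cases hxS : x ∈ S <;> simp [hxA, hxS, hζdo x hxA]
      rw [h1, integral_add (hi1.indicator hSm) (hi3.const_mul c), integral_indicator hSm,
        integral_const_mul, integral_fderiv_of_hasCompactSupport hζ1 hcs, mul_zero, add_zero]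
    -- product rule
    have hprod : ∀ x, fderiv ℝ (fun x => ζ x * h x) x e =
        fderiv ℝ ζ x e * h x + ζ x * fderiv ℝ h x e := by
      intro x
      by_cases hx : x ∈ A
      · have hd1 : HasFDerivAt ζ (fderiv ℝ ζ x) x :=
          (hζ1.differentiable one_ne_zero x).hasFDerivAt
        have hd2 : HasFDerivAt h (fderiv ℝ h x) x :=
          ((hh.contDiffAt (hA.mem_nhds hx)).differentiableAt one_ne_zero).hasFDerivAt
        have hd3 : HasFDerivAt (fun x => ζ x * h x) (ζ x • fderiv ℝ h x + h x • fderiv ℝ ζ x) x :=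
          hd1.mul hd2
        rw [hd3.fderiv]
        simp only [_root_.add_apply, _root_.smul_apply, smul_eq_mul]
        ring
      · have : (fun x => ζ x * h x) =ᶠ[𝓝 x] fun _ => 0 := by
          filter_upwards [(isClosed_tsupport ζ).isOpen_compl.mem_nhds
            fun h' => hx (hζ.supp_subset h')] with y hy
          rw [image_eq_zero_of_notMem_tsupport hy, zero_mul]
        rw [this.fderiv_eq, hζdo x hx, hζo x hx]
        simp
    -- The boundary formula is tested with `ζ h`, which is only `C¹`; this is why `IsCut` allows
    -- `C¹` test functions.
    have hψ := hcut.grad (fun x => ζ x * h x)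
      (contDiff_mul_of_tsupport_subset hA hζ1 hζ.supp_subset hh) hcs.mul_right
      (tsupport_mul_subset_left.trans hζ.supp_subset) e
    simp_rw [hprod] at hψ
    rw [integral_add hi1.integrableOn hi2.integrableOn] at hψ
    -- right-hand side
    have hRi : Integrable (fun x => ζ x * Z x e) κ := by
      obtain ⟨C, hC⟩ := hZb _ hcs hζ.supp_subset
      obtain ⟨B, hB⟩ := hcs.exists_bound_of_continuousOn hζc.continuousOn
      have hsub : Function.support (fun x => ζ x * Z x e) ⊆ tsupport ζ := fun x hx =>
        subset_tsupport ζ (left_ne_zero_of_mul hx)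
      rw [← integrableOn_iff_integrable_of_support_subset hsub]
      refine IntegrableOn.of_bound (hκK _ hcs hζ.supp_subset) ?_ (B * (C * ‖e‖)) ?_
      · exact (hζc.measurable.mul (hZm.apply_continuousLinearMap e)).aestronglyMeasurable
      · filter_upwards [ae_restrict_mem (isClosed_tsupport ζ).measurableSet] with x hx
        have hB0 : 0 ≤ B := (norm_nonneg _).trans (hB x hx)
        rw [norm_mul]
        gcongr
        · exact hB x hx
        · exact ((Z x).le_opNorm e).trans (by gcongr; exact hC x hx)
    have hR : ∫ x in A, ζ x * Z x e ∂κ =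
        (∫ x in S, ζ x * fderiv ℝ h x e) + ∫ x, ζ x * h x * n x e ∂ν := by
      rw [setIntegral_eq_integral_of_forall_compl_eq_zero
        (fun x hx => by rw [hζo x hx, zero_mul]), integral_add_measure hRi.left_of_add_measure
        hRi.right_of_add_measure, ← integral_indicator hSm]
      congr 1
      · refine integral_congr_ae ?_
        filter_upwards [measure_eq_zero_iff_ae_notMem.1 hcut.null] with x hx
        by_cases hxA : x ∈ A
        · rw [hZS x hxA fun hxT => hx ⟨hxA, hxT⟩]
          by_cases hxS : x ∈ S <;> simp [hxS]
        · by_cases hxS : x ∈ S <;> simp [hxS, hζo x hxA]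
      · refine integral_congr_ae ?_
        filter_upwards [hcut.concentrated] with x hx
        by_cases hxA : x ∈ A
        · rw [hZT x hxA hx, _root_.smul_apply, smul_eq_mul, mul_assoc]
        · simp [hζo x hxA]
    rw [hL, hR]
    linarith
  · intro B hB hBA hB0
    have hvol : ∀ᵐ x ∂(volume : Measure (E d)), x ∉ B := measure_eq_zero_iff_ae_notMem.1 hB0
    rw [hκ, ae_add_measure_iff]
    refine ⟨hvol.mono fun x hx hxB => absurd hxB hx, ?_⟩
    filter_upwards [hcut.concentrated, hcut.dens] with x hxT hx hxB
    have hxA := (hBA hxB).1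
    rw [map_eq_zero_iff _ (LinearIsometryEquiv.injective _), hZT x hxA hxT]
    by_contra hne
    refine (hBA hxB).2 (mem_approxDiscSet hA hxA hx.1 hx.2 hfS hfn
      (hhc.continuousAt (hA.mem_nhds hxA)) fun h0 => hne ?_)
    rw [h0, zero_smul]

/-- Cutting off a `C¹` function along a regular set gives a function in `GSBV^p`. -/
lemma IsCut.memGSBVp {A S T : Set (E d)} {ν : Measure (E d)} {n : E d → E d →L[ℝ] ℝ}
    (hcut : IsCut A S T ν n) (hA : IsOpen A) (hAfin : volume A ≠ ⊤) {w v : E d → E d}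
    (hw : ContDiffOn ℝ 1 w A) {C : ℝ} (hC : ∀ x ∈ A, ‖fderiv ℝ w x‖ ≤ C)
    (hvS : ∀ x ∈ A, x ∈ S → v x = w x) (hvn : ∀ x ∈ A, x ∉ S → v x = 0) (p : ℝ)
    (hT : μHE[d - 1] (A ∩ T) < ⊤) :
    MemGSBVp A p v ∧ jumpSet A v ⊆ A ∩ T ∧
      ∀ᵐ x ∂(volume.restrict A), approxGrad v x = S.indicator (fderiv ℝ w) x := by
  have hAm := hA.measurableSet
  have hSm := hcut.isOpen.measurableSet
  -- Off `T` the function is locally `w` or locally `0`. Differentiability there confines the jump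
  -- set to `T` and identifies the approximate gradient.
  have hd : ∀ x ∈ A, x ∉ T → HasFDerivAt v (S.indicator (fderiv ℝ w) x) x := by
    intro x hxA hxT
    by_cases hxS : x ∈ S
    · rw [indicator_of_mem hxS]
      have h1 := ((hw.contDiffAt (hA.mem_nhds hxA)).differentiableAt one_ne_zero).hasFDerivAt
      refine h1.congr_of_eventuallyEq ?_
      filter_upwards [hA.mem_nhds hxA, hcut.isOpen.mem_nhds hxS] with y hyA hyS
      exact hvS y hyA hyS
    · rw [indicator_of_notMem hxS]
      refine (hasFDerivAt_const (0 : E d) x).congr_of_eventuallyEq ?_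
      filter_upwards [hA.mem_nhds hxA, hcut.isClosed.isOpen_compl.mem_nhds
        (show x ∉ S ∪ T from fun h => h.elim hxS hxT)] with y hyA hyS
      exact hvn y hyA fun h => hyS (Or.inl h)
  have hTae : ∀ᵐ x ∂(volume.restrict A), x ∉ T := by
    rw [ae_restrict_iff' hAm]
    filter_upwards [measure_eq_zero_iff_ae_notMem.1 hcut.null] with x hx hxA hxT
    exact hx ⟨hxA, hxT⟩
  have hgrad : ∀ᵐ x ∂(volume.restrict A), approxGrad v x = S.indicator (fderiv ℝ w) x := by
    filter_upwards [hTae, ae_restrict_mem hAm] with x hxT hxA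
    exact approxGrad_eq_of_hasFDerivAt (hd x hxA hxT)
  have hjump : jumpSet A v ⊆ A ∩ T := by
    intro x hx
    refine ⟨hx.1, ?_⟩
    by_contra hxT
    exact notMem_jumpSet_of_continuousAt (hd x hx.1 hxT).continuousAt hx
  refine ⟨⟨⟨?_, ?_⟩, ?_, ?_, (measure_mono hjump).trans_lt hT⟩, hjump, hgrad⟩
  · exact (locallyIntegrableOn_cut hA hSm hw.continuousOn hvS hvn).aestronglyMeasurable.aemeasurable
  · intro φ hφ _
    -- Off `S` the composition equals `φ 0`, which need not vanish, so it is taken as the constant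
    -- `c`.
    refine hcut.isSBVLoc hA (h := fun x => φ (w x) - φ 0) (c := φ 0)
      ((hφ.comp_contDiffOn hw).sub contDiffOn_const) (fun x hxA hxS => ?_) (fun x hxA hxS => ?_)
    · simp [hvS x hxA hxS]
    · simp [hvn x hxA hxS]
  · filter_upwards [hTae, ae_restrict_mem hAm] with x hxT hxA
    exact ⟨_, isApproxDiff_of_hasFDerivAt (hd x hxA hxT)⟩
  · have : IsFiniteMeasure (volume.restrict A) := isFiniteMeasure_restrict.2 hAfin
    have hm : AEStronglyMeasurable (approxGrad v) (volume.restrict A) :=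
      (((measurable_fderiv ℝ w).indicator hSm).aestronglyMeasurable).congr
        (hgrad.mono fun x hx => hx.symm)
    refine MemLp.of_bound hm C ?_
    filter_upwards [hgrad, ae_restrict_mem hAm] with x hx hxA
    rw [hx]
    exact (norm_indicator_le_norm_self _ _).trans (hC x hxA)

end Cut

/-! ### Bulk densities, weak gradients and mean energies -/

variable {d : ℕ} {p : ℝ} {W : Matrix (Fin d) (Fin d) ℝ → ℝ}

lemma isSymm_symPart (L : E d →L[ℝ] E d) : (symPart L).IsSymm := by
  ext i j
  simp [symPart, add_comm]

lemma symPart_zero : symPart (0 : E d →L[ℝ] E d) = 0 := by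
  ext i j
  simp [symPart]

/-- The symmetric part as a linear map. -/
def symPartLinear : (E d →L[ℝ] E d) →ₗ[ℝ] Matrix (Fin d) (Fin d) ℝ where
  toFun := symPart
  map_add' L M := by
    ext i j
    simp [symPart]
    ring
  map_smul' c L := by
    ext i j
    simp [symPart]
    ring

lemma matNorm_symPart_le (L : E d →L[ℝ] E d) : matNorm (symPart L) ≤ d * ‖L‖ := by
  have h1 : ∀ i j, |L (EuclideanSpace.single j 1) i| ≤ ‖L‖ := fun i j => by
    have h := (L.le_opNorm (EuclideanSpace.single j 1))
    rw [PiLp.norm_single, norm_one, mul_one] at h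
    exact (PiLp.norm_apply_le (L (EuclideanSpace.single j 1)) i).trans h
  have h2 : ∀ i j, symPart L i j ^ 2 ≤ ‖L‖ ^ 2 := fun i j => by
    rw [sq_le_sq, abs_of_nonneg (norm_nonneg L)]
    have h3 := abs_le.1 (h1 i j)
    have h4 := abs_le.1 (h1 j i)
    simp only [symPart, Matrix.of_apply]
    rw [abs_le]
    constructor <;> linarith [h3.1, h3.2, h4.1, h4.2]
  unfold matNorm
  refine Real.sqrt_le_iff.2 ⟨by positivity, ?_⟩
  calc ∑ i, ∑ j, symPart L i j ^ 2 ≤ ∑ _i : Fin d, ∑ _j : Fin d, ‖L‖ ^ 2 :=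
        Finset.sum_le_sum fun i _ => Finset.sum_le_sum fun j _ => h2 i j
    _ = (d * ‖L‖) ^ 2 := by simp; ring

namespace IsBulkDensity

/-- `W` is controlled on symmetric matrices only. Composition with the symmetric part gives a convex
function on all linear maps, to which finite-dimensional continuity and Jensen's inequality apply.
-/
lemma convexOn_comp_symPart (hW : IsBulkDensity p W) :
    ConvexOn ℝ univ fun L : E d →L[ℝ] E d => W (symPart L) := by
  have h := hW.convex.comp_linearMap (symPartLinear (d := d))
  have hu : (symPartLinear (d := d)) ⁻¹' {M | M.IsSymm} = univ :=
    eq_univ_of_forall fun L => isSymm_symPart L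
  rwa [hu] at h

lemma continuous_comp_symPart (hW : IsBulkDensity p W) :
    Continuous fun L : E d →L[ℝ] E d => W (symPart L) :=
  continuousOn_univ.1 (hW.convexOn_comp_symPart.continuousOn isOpen_univ)

lemma nonneg (hW : IsBulkDensity p W) (L : E d →L[ℝ] E d) : 0 ≤ W (symPart L) := by
  obtain ⟨c, C, hc, h⟩ := hW.growth
  exact le_trans (mul_nonneg hc.le (Real.rpow_nonneg (Real.sqrt_nonneg _) _))
    (h _ (isSymm_symPart L)).1

lemma exists_le (hW : IsBulkDensity p W) (hp : 0 ≤ p) :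
    ∃ C : ℝ, 0 ≤ C ∧ ∀ L : E d →L[ℝ] E d, W (symPart L) ≤ C * (1 + ‖L‖ ^ p) := by
  obtain ⟨c, C, hc, h⟩ := hW.growth
  refine ⟨|C| * (1 + (d : ℝ) ^ p), by positivity, fun L => ?_⟩
  have h1 : matNorm (symPart L) ^ p ≤ (d : ℝ) ^ p * ‖L‖ ^ p := by
    rw [← Real.mul_rpow (by positivity) (norm_nonneg L)]
    exact Real.rpow_le_rpow (Real.sqrt_nonneg _) (matNorm_symPart_le L) hp
  have h2 : 0 ≤ matNorm (symPart L) ^ p := Real.rpow_nonneg (Real.sqrt_nonneg _) _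
  have h3 : (0 : ℝ) ≤ (d : ℝ) ^ p := by positivity
  have h4 : (0 : ℝ) ≤ ‖L‖ ^ p := by positivity
  calc W (symPart L) ≤ C * (1 + matNorm (symPart L) ^ p) := (h _ (isSymm_symPart L)).2
    _ ≤ |C| * (1 + matNorm (symPart L) ^ p) := by gcongr; exact le_abs_self C
    _ ≤ |C| * (1 + (d : ℝ) ^ p * ‖L‖ ^ p) := by gcongr
    _ ≤ |C| * ((1 + (d : ℝ) ^ p) * (1 + ‖L‖ ^ p)) := by
        gcongr
        nlinarith
    _ = _ := by ring

lemma integrableOn_comp_symPart (hW : IsBulkDensity p W) (hp : 0 < p) {Ω : Set (E d)}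
    (hΩ : volume Ω ≠ ⊤) {G : E d → E d →L[ℝ] E d}
    (hG : MemLp G (ENNReal.ofReal p) (volume.restrict Ω)) :
    IntegrableOn (fun x => W (symPart (G x))) Ω := by
  obtain ⟨C, hC, hb⟩ := hW.exists_le hp.le
  have : IsFiniteMeasure (volume.restrict Ω) := ⟨by simpa using hΩ.lt_top⟩
  have h1 : Integrable (fun x => ‖G x‖ ^ p) (volume.restrict Ω) := by
    have h := hG.integrable_norm_rpow (by simpa using hp) ENNReal.ofReal_ne_top
    rwa [ENNReal.toReal_ofReal hp.le] at h
  refine Integrable.mono' (((integrable_const (1 : ℝ)).add h1).const_mul C)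
    (hW.continuous_comp_symPart.comp_aestronglyMeasurable hG.1) (Eventually.of_forall fun x => ?_)
  rw [Real.norm_of_nonneg (hW.nonneg _)]
  exact hb _

lemma jensen (hW : IsBulkDensity p W) {B : Set (E d)} (h0 : volume B ≠ 0) (ht : volume B ≠ ⊤)
    {G : E d → E d →L[ℝ] E d} (hG : IntegrableOn G B)
    (hWG : IntegrableOn (fun x => W (symPart (G x))) B) :
    W (symPart (⨍ y in B, G y)) ≤ ⨍ y in B, W (symPart (G y)) :=
  hW.convexOn_comp_symPart.map_set_average_le hW.continuous_comp_symPart.continuousOn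
    isClosed_univ h0 ht (by simp) hG hWG

end IsBulkDensity

lemma isWeakGrad_weakGrad {Ω : Set (E d)} {u : E d → E d} {G : E d → E d →L[ℝ] E d}
    (hG : IsWeakGrad Ω u G) : IsWeakGrad Ω u (weakGrad Ω u) := by
  have h : ∃ G, IsWeakGrad Ω u G := ⟨G, hG⟩
  rw [weakGrad, dif_pos h]
  exact h.choose_spec

/-- The fundamental lemma of the calculus of variations. It transfers the `p`-integrability of some
weak gradient to the chosen `weakGrad`. -/
lemma IsWeakGrad.ae_eq {Ω : Set (E d)} (hΩ : IsOpen Ω) {u : E d → E d}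
    {G G' : E d → E d →L[ℝ] E d} (hG : IsWeakGrad Ω u G) (hG' : IsWeakGrad Ω u G') :
    G =ᵐ[volume.restrict Ω] G' := by
  have key : ∀ᵐ x ∂volume, x ∈ Ω → G x - G' x = 0 := by
    refine hΩ.ae_eq_zero_of_integral_contDiff_smul_eq_zero (hG.1.sub hG'.1)
      fun φ hφ hφc hφs => ?_
    have hint : ∀ H : E d → E d →L[ℝ] E d, LocallyIntegrableOn H Ω →
        Integrable fun x => φ x • H x := fun H hH => by
      have h1 : IntegrableOn (fun x => φ x • H x) (tsupport φ) :=
        (hH.integrableOn_compact_subset hφs hφc).continuousOn_smul hφ.continuous.continuousOn hφc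
      refine IntegrableOn.integrable_of_forall_notMem_eq_zero (ε' := E d →L[ℝ] E d) (s := tsupport φ) ?_ fun x hx => ?_
      · exact h1
      rw [image_eq_zero_of_notMem_tsupport hx]
      exact zero_smul ℝ (H x)
    have hT : IsTestFun Ω φ := ⟨hφ, hφc, hφs⟩
    have hzero : ∀ H : E d → E d →L[ℝ] E d, ∫ x, φ x • H x = ∫ x in Ω, φ x • H x := fun H => by
      symm
      refine setIntegral_eq_integral_of_forall_compl_eq_zero fun x hx => ?_
      rw [image_eq_zero_of_notMem_tsupport fun h => hx (hφs h)]
      exact zero_smul ℝ (H x)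
    have heq : (∫ x, φ x • G x) = ∫ x, φ x • G' x := by
      ext1 e
      rw [ContinuousLinearMap.integral_apply (hint G hG.1),
        ContinuousLinearMap.integral_apply (hint G' hG'.1)]
      have h1 := hG.2 φ hT e
      have h2 := hG'.2 φ hT e
      have h3 : ∀ H : E d → E d →L[ℝ] E d, ∫ x, (φ x • H x) e = ∫ x in Ω, φ x • H x e := fun H => by
        symm
        refine setIntegral_eq_integral_of_forall_compl_eq_zero fun x hx => ?_
        rw [image_eq_zero_of_notMem_tsupport fun h => hx (hφs h), zero_smul]
      rw [h3, h3, ← neg_inj, ← h1, ← h2]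
    simp only [smul_sub]
    rw [integral_sub (hint G hG.1) (hint G' hG'.1), heq, sub_self]
  rw [EventuallyEq, ae_restrict_iff' hΩ.measurableSet]
  filter_upwards [key] with x hx hxΩ
  exact sub_eq_zero.1 (hx hxΩ)

/-! ### Truncated averages -/

/-- Almost every level of the distance function is regular enough to cut along. By the coarea
inequality the mean area of the levels in `(0, ρ)` is at most `2/ρ` times the volume of the strip,
so some regular level does no worse. -/
lemma exists_isCut_infDist {k : ℕ} {A K : Set (E (k + 1))} (hA : IsOpen A)
    (hAc : IsCompact (closure A)) (hK : K.Nonempty) {ρ : ℝ} (hρ : 0 < ρ) :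
    ∃ s, 0 < s ∧ s < ρ ∧ ∃ ν,
      IsCut A {x | s < infDist x K} {x | infDist x K = s} ν (fderiv ℝ fun x => infDist x K) ∧
      μHE[k] (A ∩ {x | infDist x K = s}) ≤
        ENNReal.ofReal (2 / ρ) * volume (A ∩ {x | infDist x K < ρ}) := by
  set g : E (k + 1) → ℝ := fun x => infDist x K with hg
  have hgL : LipschitzWith 1 g := lipschitz_infDist_pt K
  have hgc : Continuous g := hgL.continuous
  have hpos : MeasurableSet (A ∩ {x | 0 < g x}) :=
    (hA.inter (isOpen_lt continuous_const hgc)).measurableSet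
  have hUm : MeasurableSet (A ∩ {x | 0 < g x} ∩ {x | g x < ρ}) :=
    hpos.inter (isOpen_lt hgc continuous_const).measurableSet
  have hnull := (exists_coarea_bound hgL hpos
    fun x hx L hL => norm_fderiv_infDist hK hx.2 hL).2
  -- The coarea bound is used again, now on the strip alone, so that the area is paid for by the
  -- strip's volume; nullness of levels needs all of `A ∩ {g > 0}`.
  obtain ⟨H, hHm, hHi, hHs⟩ := (exists_coarea_bound hgL hUm
    fun x hx L hL => norm_fderiv_infDist hK hx.1.2 hL).1
  have hbd := ae_exists_boundary_measure hgL hA hAc hnull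
  have hne : volume.restrict (Ioo 0 ρ) ≠ 0 := by
    rw [Ne, Measure.restrict_eq_zero, Real.volume_Ioo]
    simpa using hρ
  have hall : ∀ᵐ s ∂(volume.restrict (Ioo 0 ρ)), s ∈ Ioo 0 ρ ∧
      μHE[k] (A ∩ {x | 0 < g x} ∩ {x | g x < ρ} ∩ g ⁻¹' {s}) ≤ H s ∧ (0 < s → ∃ ν : Measure (E (k + 1)),
        IsFiniteMeasure ν ∧ ν {x | g x ≠ s} = 0 ∧ (∀ᵐ x ∂ν, DifferentiableAt ℝ g x) ∧
        ∀ ψ : E (k + 1) → ℝ, ContDiff ℝ 1 ψ → HasCompactSupport ψ → tsupport ψ ⊆ A → ∀ e,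
          ∫ x in g ⁻¹' Ioi s, fderiv ℝ ψ x e = -∫ x, ψ x * fderiv ℝ g x e ∂ν) := by
    filter_upwards [ae_restrict_mem measurableSet_Ioo, ae_restrict_of_ae hHs,
      ae_restrict_of_ae hbd] with s h1 h2 h3 using ⟨h1, h2, h3⟩
  obtain ⟨s, hsN, hsH⟩ := exists_notMem_null_le_laverage hne hHm.aemeasurable (ae_iff.1 hall)
  obtain ⟨hs, hsle, hν⟩ := not_not.1 hsN
  obtain ⟨ν, hν1, hν2, hν3, hν4⟩ := hν hs.1
  have hconc : ∀ᵐ x ∂ν, g x = s := by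
    rw [ae_iff]; exact hν2
  refine ⟨s, hs.1, hs.2, ν, ⟨isOpen_lt continuous_const hgc, ?_, ?_, ?_, hν1, hconc,
    measurable_fderiv ℝ g, fun x => ?_, hν4, ?_⟩, ?_⟩
  · have : {x | s < g x} ∪ {x | g x = s} = {x | s ≤ g x} := by
      ext x
      simp only [mem_union, mem_ofPred_eq, le_iff_lt_or_eq, eq_comm]
    rw [this]
    exact isClosed_le continuous_const hgc
  · exact disjoint_left.2 fun x (h1 : s < g x) (h2 : g x = s) => h1.ne' h2
  · refine measure_mono_null (fun x hx => ?_) (hnull {s} (by simp))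
    exact ⟨⟨hx.1, show 0 < g x from (show g x = s from hx.2) ▸ hs.1⟩, hx.2⟩
  · simpa using norm_fderiv_le_of_lipschitz ℝ hgL (x₀ := x)
  · filter_upwards [hconc, hν3] with x hx hd
    have h := hasPosDensity_of_hasFDerivAt hd.hasFDerivAt
      (norm_fderiv_infDist hK (show 0 < g x by rw [hx]; exact hs.1) hd.hasFDerivAt)
    rwa [hx] at h
  · have hsub : A ∩ {x | g x = s} ⊆ A ∩ {x | 0 < g x} ∩ {x | g x < ρ} ∩ g ⁻¹' {s} := by
      rintro x ⟨hxA, hx⟩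
      have hx' : g x = s := hx
      exact ⟨⟨⟨hxA, show 0 < g x by rw [hx']; exact hs.1⟩, show g x < ρ by rw [hx']; exact hs.2⟩, hx'⟩
    calc μHE[k] (A ∩ {x | g x = s}) ≤ H s := (measure_mono hsub).trans hsle
      _ ≤ (∫⁻ s in Ioo 0 ρ, H s) / volume (Ioo 0 ρ) := by rwa [setLAverage_eq] at hsH
      _ ≤ (2 * volume (A ∩ {x | g x < ρ})) / ENNReal.ofReal ρ := by
        rw [Real.volume_Ioo, sub_zero]
        refine ENNReal.div_le_div_right ((setLIntegral_le_lintegral _ _).trans (hHi.trans ?_)) _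
        gcongr
        exact inter_subset_left
      _ = _ := by
        rw [ENNReal.ofReal_div_of_pos hρ, ENNReal.ofReal_ofNat, ENNReal.div_eq_inv_mul,
          ENNReal.div_eq_inv_mul, mul_assoc]

lemma volume_ne_top_of_isBounded {Ω : Set (E d)} (h : Bornology.IsBounded Ω) : volume Ω ≠ ⊤ :=
  h.measure_lt_top.ne

lemma MemW1p.memLp_weakGrad {Ω : Set (E d)} (hΩ : IsOpen Ω) {u : E d → E d} (hu : MemW1p Ω p u) :
    IsWeakGrad Ω u (weakGrad Ω u) ∧
      MemLp (weakGrad Ω u) (ENNReal.ofReal p) (volume.restrict Ω) := by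
  obtain ⟨-, G, hG, hGp⟩ := hu
  have h := isWeakGrad_weakGrad hG
  exact ⟨h, hGp.ae_eq (hG.ae_eq hΩ h)⟩

lemma integrableOn_of_memLp_of_one_lt {V : Type*} [NormedAddCommGroup V] {Ω : Set (E d)}
    (hΩ : volume Ω ≠ ⊤) (hp : 1 < p) {u : E d → V}
    (hu : MemLp u (ENNReal.ofReal p) (volume.restrict Ω)) : IntegrableOn u Ω := by
  have : IsFiniteMeasure (volume.restrict Ω) := ⟨by simpa using hΩ.lt_top⟩
  refine hu.integrable ?_
  rw [← ENNReal.ofReal_one]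
  exact ENNReal.ofReal_le_ofReal hp.le

lemma meanEnergy_eq {Ω : Set (E d)} {u : E d → E d} {ε r : ℝ} {x : E d} (h : ball x r ⊆ Ω) :
    meanEnergy Ω W u ε r x = ε * ⨍ y in ball x r, W (symPart (weakGrad Ω u y)) := by
  rw [meanEnergy, inter_eq_left.2 h]

lemma meanEnergy_nonneg (hW : IsBulkDensity p W) {Ω : Set (E d)} {u : E d → E d} {ε r : ℝ}
    {x : E d} (hε : 0 ≤ ε) : 0 ≤ meanEnergy Ω W u ε r x := by
  rw [meanEnergy, setAverage_eq]
  exact mul_nonneg hε (smul_nonneg (by positivity) (integral_nonneg fun y => hW.nonneg _))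

lemma volume_real_ball (x : E d) {r : ℝ} (hr : 0 < r) :
    volume.real (ball x r) = r ^ d * volume.real (ball (0 : E d) 1) := by
  rw [measureReal_def, Measure.addHaar_ball_of_pos volume x hr, ENNReal.toReal_mul,
    ENNReal.toReal_ofReal (by positivity), finrank_euclideanSpace_fin, measureReal_def]

/-- The integral of a nonnegative density grows with the ball, and `(r / R) ^ d` is the ratio of the
volumes. -/
lemma pow_mul_meanEnergy_le (hW : IsBulkDensity p W) {Ω : Set (E d)} {u : E d → E d}
    (hWu : IntegrableOn (fun y => W (symPart (weakGrad Ω u y))) Ω) {ε r R : ℝ} {x y : E d}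
    (hε : 0 ≤ ε) (hr : 0 < r) (hR : 0 < R) (hxy : ball x r ⊆ ball y R) (hy : ball y R ⊆ Ω) :
    (r / R) ^ d * meanEnergy Ω W u ε r x ≤ meanEnergy Ω W u ε R y := by
  rw [meanEnergy_eq hy, meanEnergy_eq (hxy.trans hy), setAverage_eq, setAverage_eq,
    volume_real_ball x hr, volume_real_ball y hR]
  have h1 : ∫ y in ball x r, W (symPart (weakGrad Ω u y)) ≤
      ∫ y in ball y R, W (symPart (weakGrad Ω u y)) :=
    setIntegral_mono_set (hWu.mono_set hy) (ae_of_all _ fun y => hW.nonneg _)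
      (LE.le.eventuallyLE hxy)
  have h2 : 0 < volume.real (ball (0 : E d) 1) :=
    ENNReal.toReal_pos (measure_ball_pos _ _ one_pos).ne' measure_ball_lt_top.ne
  simp only [smul_eq_mul]
  calc (r / R) ^ d * (ε * ((r ^ d * volume.real (ball (0 : E d) 1))⁻¹ *
        ∫ y in ball x r, W (symPart (weakGrad Ω u y))))
      = ε * ((R ^ d * volume.real (ball (0 : E d) 1))⁻¹ *
        ∫ y in ball x r, W (symPart (weakGrad Ω u y))) := by
        rw [div_pow]; field_simp
    _ ≤ _ := by gcongr

/-- The slope at `0` gives the linear bound up to some `t₀`; beyond it `f` stays above its value at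
`t₀` by monotonicity, so `b = α (1 - δ) t₀` works. -/
lemma IsProfile.exists_min_le {f : ℝ → ℝ} {α β : ℝ} (hf : IsProfile f α β) {δ : ℝ} (hδ₀ : 0 < δ)
    (hδ₁ : δ < 1) : ∃ b, 0 < b ∧ ∀ t, 0 ≤ t → min (α * (1 - δ) * t) b ≤ f t := by
  have hα := hf.alpha_pos
  have h1 : α * (1 - δ) < α := by nlinarith
  have h2 : ∀ᶠ t in 𝓝[>] (0 : ℝ), α * (1 - δ) < f t / t := hf.slope_zero.eventually_const_lt h1
  obtain ⟨t₀, ht₀, h3⟩ := (mem_nhdsGT_iff_exists_Ioc_subset).1 h2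
  have ht₀' : (0 : ℝ) < t₀ := ht₀
  have h4 : ∀ t, 0 < t → t ≤ t₀ → α * (1 - δ) * t ≤ f t := fun t ht htt => by
    have := h3 ⟨ht, htt⟩
    exact ((lt_div_iff₀ ht).1 this).le
  have h5 : 0 < α * (1 - δ) := mul_pos hα (by linarith)
  refine ⟨α * (1 - δ) * t₀, by positivity, fun t ht => ?_⟩
  rcases ht.eq_or_lt with rfl | ht
  · rw [mul_zero]
    exact (min_le_left _ _).trans (hf.nonneg 0 le_rfl)
  rcases le_total t t₀ with h | h
  · exact (min_le_left _ _).trans (h4 t ht h)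
  · exact (min_le_right _ _).trans ((h4 t₀ ht₀' le_rfl).trans (hf.mono ht₀'.le ht.le h))

lemma continuousOn_average_ball {V : Type*} [NormedAddCommGroup V] [NormedSpace ℝ V]
    {Ω A : Set (E d)} {U : E d → V} (hΩ : MeasurableSet Ω) (hU : IntegrableOn U Ω) {r : ℝ}
    (hr : 0 < r) (hball : ∀ x ∈ A, ball x r ⊆ Ω) :
    ContinuousOn (fun x => ⨍ y in ball x r, U y) A := by
  have hU' : Integrable (Ω.indicator U) := hU.integrable_indicator hΩ
  refine (continuous_average_ball hU' hr.ne').continuousOn.congr fun x hx => ?_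
  refine setAverage_congr_fun measurableSet_ball (ae_of_all _ fun y hy => ?_)
  rw [indicator_of_mem (hball x hx hy)]

lemma contDiffOn_average_ball {Ω A : Set (E d)} (hA : IsOpen A) {u : E d → E d}
    {G : E d → E d →L[ℝ] E d} (hΩ : MeasurableSet Ω) (hG : IsWeakGrad Ω u G) (hu : IntegrableOn u Ω)
    (hGi : IntegrableOn G Ω) {r : ℝ} (hr : 0 < r) (hball : ∀ x ∈ A, closedBall x r ⊆ Ω) :
    ContDiffOn ℝ 1 (fun x => ⨍ y in ball x r, u y) A := by
  have hd : ∀ x ∈ A, HasFDerivAt (fun x => ⨍ y in ball x r, u y) (⨍ y in ball x r, G y) x :=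
    fun x hx => hasFDerivAt_average_ball hA hG hu hGi hr hball hx
  have h1 : ContDiffOn ℝ (0 + 1) (fun x => ⨍ y in ball x r, u y) A := by
    rw [contDiffOn_succ_iff_fderiv_of_isOpen hA]
    refine ⟨fun x hx => (hd x hx).differentiableAt.differentiableWithinAt, by simp, ?_⟩
    rw [contDiffOn_zero]
    exact (continuousOn_average_ball hΩ hGi hr
      fun x hx => ball_subset_closedBall.trans (hball x hx)).congr fun x hx => (hd x hx).fderiv
  simpa using h1

lemma exists_norm_average_ball_le {V : Type*} [NormedAddCommGroup V] [NormedSpace ℝ V]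
    {Ω A : Set (E d)} {u : E d → V} (hu : IntegrableOn u Ω) {r : ℝ} (hr : 0 < r)
    (hball : ∀ x ∈ A, ball x r ⊆ Ω) : ∃ C, ∀ x ∈ A, ‖⨍ y in ball x r, u y‖ ≤ C := by
  have hfin : (volume (ball (0 : E d) r))⁻¹ * ∫⁻ y in Ω, ‖u y‖ₑ ≠ ⊤ :=
    ENNReal.mul_ne_top (ENNReal.inv_ne_top.2 (measure_ball_pos _ _ hr).ne') hu.2.ne
  refine ⟨((volume (ball (0 : E d) r))⁻¹ * ∫⁻ y in Ω, ‖u y‖ₑ).toReal, fun x hx => ?_⟩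
  rw [← ENNReal.ofReal_le_iff_le_toReal hfin]
  refine (norm_setAverage_ball_le (hu.mono_set (hball x hx))).trans ?_
  exact mul_le_mul_right (lintegral_mono_set (hball x hx)) _

lemma energy_eq {Ω A : Set (E d)} {f : ℝ → ℝ} {ε : ℝ} (hε : 0 < ε) {u : E d → E d}
    (hu : MemW1p Ω p u) : ENNReal.ofReal ε * energy Ω p f W ε u A =
      ∫⁻ x in A, ENNReal.ofReal (f (meanEnergy Ω W u ε ε x)) := by
  rw [energy, if_pos hu, ← mul_assoc, ← ENNReal.ofReal_mul hε.le, mul_one_div_cancel hε.ne',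
    ENNReal.ofReal_one, one_mul]

lemma le_energy {Ω A : Set (E d)} {f : ℝ → ℝ} {ε : ℝ} (hε : 0 < ε) {u : E d → E d}
    (hu : MemW1p Ω p u) {I : ℝ≥0∞} (h : ENNReal.ofReal ε * I ≤
      ∫⁻ x in A, ENNReal.ofReal (f (meanEnergy Ω W u ε ε x))) : I ≤ energy Ω p f W ε u A := by
  rw [← energy_eq hε hu] at h
  exact (ENNReal.mul_le_mul_iff_right (by simpa using hε) ENNReal.ofReal_ne_top).1 h

/-! ### Energy estimates for a single truncated average -/

/-- A configuration consisting of the data of a nonlocal energy and of one Sobolev function, such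
that the averaging balls do not leave the domain. -/
structure IsConfig (d : ℕ) (p : ℝ) (W : Matrix (Fin d) (Fin d) ℝ → ℝ) (f : ℝ → ℝ)
    (α β a b δ ε : ℝ) (Ω A : Set (E d)) (u : E d → E d) : Prop where
  one_lt : 1 < p
  bulk : IsBulkDensity p W
  profile : IsProfile f α β
  delta_pos : 0 < δ
  delta_lt : δ < 1
  a_pos : 0 < a
  b_pos : 0 < b
  le_a : α * (1 - δ) ≤ a
  min_le : ∀ t, 0 ≤ t → min (a * t) b ≤ f t
  isOpen_domain : IsOpen Ω
  isBounded : Bornology.IsBounded Ω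
  isOpen : IsOpen A
  isCompact : IsCompact (closure A)
  eps_pos : 0 < ε
  ball_subset : ∀ x ∈ A, ball x ε ⊆ Ω
  memW1p : MemW1p Ω p u

namespace IsConfig

variable {f : ℝ → ℝ} {α β a b δ ε : ℝ} {Ω A : Set (E d)} {u : E d → E d}

lemma subset (h : IsConfig d p W f α β a b δ ε Ω A u) : A ⊆ Ω :=
  fun x hx => h.ball_subset x hx (mem_ball_self h.eps_pos)

lemma radius_pos (h : IsConfig d p W f α β a b δ ε Ω A u) : 0 < (1 - δ) * ε :=
  mul_pos (by linarith [h.delta_lt]) h.eps_pos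

lemma radius_lt (h : IsConfig d p W f α β a b δ ε Ω A u) : (1 - δ) * ε < ε := by
  nlinarith [h.delta_pos, h.eps_pos]

lemma closedBall_subset (h : IsConfig d p W f α β a b δ ε Ω A u) (x : E d) (hx : x ∈ A) :
    closedBall x ((1 - δ) * ε) ⊆ Ω :=
  (closedBall_subset_ball h.radius_lt).trans (h.ball_subset x hx)

lemma volume_domain (h : IsConfig d p W f α β a b δ ε Ω A u) : volume Ω ≠ ⊤ :=
  volume_ne_top_of_isBounded h.isBounded

lemma integrableOn (h : IsConfig d p W f α β a b δ ε Ω A u) : IntegrableOn u Ω :=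
  integrableOn_of_memLp_of_one_lt h.volume_domain h.one_lt h.memW1p.1

lemma integrableOn_weakGrad (h : IsConfig d p W f α β a b δ ε Ω A u) :
    IntegrableOn (weakGrad Ω u) Ω :=
  integrableOn_of_memLp_of_one_lt h.volume_domain h.one_lt
    (h.memW1p.memLp_weakGrad h.isOpen_domain).2

lemma integrableOn_bulk (h : IsConfig d p W f α β a b δ ε Ω A u) :
    IntegrableOn (fun y => W (symPart (weakGrad Ω u y))) Ω :=
  h.bulk.integrableOn_comp_symPart (by linarith [h.one_lt]) h.volume_domain
    (h.memW1p.memLp_weakGrad h.isOpen_domain).2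

lemma hasFDerivAt (h : IsConfig d p W f α β a b δ ε Ω A u) {x : E d} (hx : x ∈ A) :
    HasFDerivAt (fun x => ⨍ y in ball x ((1 - δ) * ε), u y)
      (⨍ y in ball x ((1 - δ) * ε), weakGrad Ω u y) x :=
  hasFDerivAt_average_ball h.isOpen (h.memW1p.memLp_weakGrad h.isOpen_domain).1 h.integrableOn
    h.integrableOn_weakGrad h.radius_pos h.closedBall_subset hx

lemma div_radius (h : IsConfig d p W f α β a b δ ε Ω A u) : (1 - δ) * ε / ε = 1 - δ :=
  mul_div_cancel_right₀ _ h.eps_pos.ne'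

/-- `B_ε(y)` contains `B_{(1-δ)ε}(x)`. The factor `(1-δ)^{-d}` in the definition of `concSet`
exactly offsets the volume ratio, so the mean over the larger ball is still at least `b / a`. -/
lemma b_le (h : IsConfig d p W f α β a b δ ε Ω A u) {x y : E d}
    (hx : x ∈ concSet Ω A W u a b δ ε) (hy : y ∈ A) (hxy : dist y x < δ * ε) :
    b ≤ f (meanEnergy Ω W u ε ε y) := by
  have hδ : 0 < 1 - δ := by linarith [h.delta_lt]
  have hsub : ball x ((1 - δ) * ε) ⊆ ball y ε := by
    refine ball_subset_ball' ?_
    rw [dist_comm]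
    nlinarith [hxy]
  have h1 := pow_mul_meanEnergy_le h.bulk h.integrableOn_bulk h.eps_pos.le h.radius_pos h.eps_pos
    hsub (h.ball_subset y hy)
  rw [h.div_radius] at h1
  have h2 : b / a ≤ (1 - δ) ^ d * meanEnergy Ω W u ε ((1 - δ) * ε) x := by
    calc b / a = (1 - δ) ^ d * (1 / (1 - δ) ^ d * (b / a)) := by field_simp
      _ ≤ _ := by gcongr; exact hx.2
  have h3 : b ≤ a * meanEnergy Ω W u ε ε y := by
    rw [← div_le_iff₀' h.a_pos]; exact h2.trans h1
  exact (le_min h3 le_rfl).trans (h.min_le _ (meanEnergy_nonneg h.bulk h.eps_pos.le))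

/-- Jensen bounds `ε W` by the mean `m` over the smaller ball. Off the concentration set `(1-δ)^d m
≤ b / a`, so the linear branch of the minimum is active there, and monotonicity of `f` passes to the
mean over `B_ε`. -/
lemma bulk_le (h : IsConfig d p W f α β a b δ ε Ω A u) {x : E d} (hx : x ∈ A)
    (hxK : x ∉ concSet Ω A W u a b δ ε) :
    ε * (α * (1 - δ) ^ (2 * d + 1) *
      W (symPart (fderiv ℝ (fun x => ⨍ y in ball x ((1 - δ) * ε), u y) x))) ≤
      f (meanEnergy Ω W u ε ε x) := by
  have hδ : 0 < 1 - δ := by linarith [h.delta_lt]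
  have hα := h.profile.alpha_pos
  have hε := h.eps_pos
  have hsub : ball x ((1 - δ) * ε) ⊆ Ω := ball_subset_closedBall.trans (h.closedBall_subset x hx)
  rw [(h.hasFDerivAt hx).fderiv]
  have hJ := h.bulk.jensen (measure_ball_pos volume x h.radius_pos).ne' measure_ball_lt_top.ne
    (h.integrableOn_weakGrad.mono_set hsub) (h.integrableOn_bulk.mono_set hsub)
  set w := W (symPart (⨍ y in ball x ((1 - δ) * ε), weakGrad Ω u y)) with hw
  have hw0 : 0 ≤ w := h.bulk.nonneg _
  set m := meanEnergy Ω W u ε ((1 - δ) * ε) x with hm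
  have hm1 : ε * w ≤ m := by
    rw [hm, meanEnergy_eq hsub]
    gcongr
  have hm0 : 0 ≤ m := meanEnergy_nonneg h.bulk hε.le
  have hmlt : m < 1 / (1 - δ) ^ d * (b / a) := by
    by_contra hcon
    exact hxK ⟨hx, not_lt.1 hcon⟩
  have h1 := pow_mul_meanEnergy_le h.bulk h.integrableOn_bulk h.eps_pos.le h.radius_pos h.eps_pos
    (ball_subset_ball h.radius_lt.le) (h.ball_subset x hx)
  rw [h.div_radius, ← hm] at h1
  have ht0 : 0 ≤ (1 - δ) ^ d * m := by positivity
  have h2 : a * ((1 - δ) ^ d * m) ≤ b := by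
    have : (1 - δ) ^ d * m ≤ b / a := by
      calc (1 - δ) ^ d * m ≤ (1 - δ) ^ d * (1 / (1 - δ) ^ d * (b / a)) := by gcongr
        _ = b / a := by field_simp
    rwa [le_div_iff₀' h.a_pos] at this
  have h3 := h.min_le _ ht0
  rw [min_eq_left h2] at h3
  -- The argument loses only `(1 - δ) ^ (d + 1)`: one factor from `a`, and `d` from the change of
  -- radius.
  have h4 : (1 - δ) ^ (2 * d + 1) ≤ (1 - δ) ^ (d + 1) :=
    pow_le_pow_of_le_one hδ.le (by linarith [h.delta_pos]) (by omega)
  calc ε * (α * (1 - δ) ^ (2 * d + 1) * w) = α * (1 - δ) ^ (2 * d + 1) * (ε * w) := by ring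
    _ ≤ α * (1 - δ) ^ (d + 1) * m := by gcongr
    _ = α * (1 - δ) * ((1 - δ) ^ d * m) := by ring
    _ ≤ a * ((1 - δ) ^ d * m) := by gcongr; exact h.le_a
    _ ≤ f ((1 - δ) ^ d * m) := h3
    _ ≤ _ := h.profile.mono ht0 (ht0.trans h1) h1

/-- Everything that is needed about a truncated average, given a regular set at which to
truncate. -/
lemma truncated_average (h : IsConfig d p W f α β a b δ ε Ω A u) {S T : Set (E d)}
    {ν : Measure (E d)} {n : E d → E d →L[ℝ] ℝ} (hcut : IsCut A S T ν n)
    (hT : μHE[d - 1] (A ∩ T) < ⊤) (hSK : ∀ x ∈ A, x ∈ S → x ∉ concSet Ω A W u a b δ ε)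
    {v : E d → E d} (hvS : ∀ x ∈ A, x ∈ S → v x = ⨍ y in ball x ((1 - δ) * ε), u y)
    (hvn : ∀ x ∈ A, x ∉ S → v x = 0) :
    MemGSBVp A p v ∧ jumpSet A v ⊆ A ∩ T ∧ MemLp v 1 (volume.restrict A) ∧
      ENNReal.ofReal (α * (1 - δ) ^ (2 * d + 1)) *
        ∫⁻ x in A, ENNReal.ofReal (W (symPart (approxGrad v x))) ≤ energy Ω p f W ε u A := by
  have hAfin : volume A ≠ ⊤ := measure_ne_top_of_subset h.subset h.volume_domain
  have hδ : 0 < 1 - δ := by linarith [h.delta_lt]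
  have hα := h.profile.alpha_pos
  have hw := contDiffOn_average_ball h.isOpen h.isOpen_domain.measurableSet
    (h.memW1p.memLp_weakGrad h.isOpen_domain).1 h.integrableOn h.integrableOn_weakGrad
    h.radius_pos h.closedBall_subset
  have hb : ∀ x ∈ A, ball x ((1 - δ) * ε) ⊆ Ω :=
    fun x hx => ball_subset_closedBall.trans (h.closedBall_subset x hx)
  obtain ⟨C, hC⟩ := exists_norm_average_ball_le h.integrableOn_weakGrad h.radius_pos hb
  obtain ⟨C', hC'⟩ := exists_norm_average_ball_le h.integrableOn h.radius_pos hb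
  obtain ⟨h1, h2, h3⟩ := hcut.memGSBVp h.isOpen hAfin hw
    (fun x hx => by rw [(h.hasFDerivAt hx).fderiv]; exact hC x hx) hvS hvn p hT
  refine ⟨h1, h2, ?_, le_energy h.eps_pos h.memW1p ?_⟩
  · have : IsFiniteMeasure (volume.restrict A) := ⟨by simpa using hAfin.lt_top⟩
    refine MemLp.of_bound h1.gsbv.1.aestronglyMeasurable (max C' 0) ?_
    filter_upwards [ae_restrict_mem h.isOpen.measurableSet] with x hx
    by_cases hxS : x ∈ S
    · rw [hvS x hx hxS]
      exact (hC' x hx).trans (le_max_left _ _)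
    · rw [hvn x hx hxS, norm_zero]
      exact le_max_right _ _
  · rw [← mul_assoc, ← lintegral_const_mul' _ _
      (ENNReal.mul_ne_top ENNReal.ofReal_ne_top ENNReal.ofReal_ne_top)]
    refine lintegral_mono_ae ?_
    filter_upwards [h3, ae_restrict_mem h.isOpen.measurableSet] with x hx hxA
    rw [hx, ← ENNReal.ofReal_mul h.eps_pos.le, ← ENNReal.ofReal_mul
      (by have := h.eps_pos; positivity)]
    refine ENNReal.ofReal_le_ofReal ?_
    by_cases hxS : x ∈ S
    · rw [indicator_of_mem hxS, mul_assoc]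
      exact h.bulk_le hxA (hSK x hxA hxS)
    · rw [indicator_of_notMem hxS, symPart_zero, h.bulk.map_zero, mul_zero]
      exact h.profile.nonneg _ (meanEnergy_nonneg h.bulk h.eps_pos.le)

end IsConfig

/-- The strip `N` of width `δ ε` around the concentration set is paid for by the energy, and a good
level inside it is where the average is cut. `N` is returned because it contains the zeroed set and
has small measure. -/
lemma IsConfig.exists_truncated {k : ℕ} {p : ℝ} {W : Matrix (Fin (k + 1)) (Fin (k + 1)) ℝ → ℝ}
    {f : ℝ → ℝ} {α β a b δ ε : ℝ} {Ω A : Set (E (k + 1))} {u : E (k + 1) → E (k + 1)}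
    (h : IsConfig (k + 1) p W f α β a b δ ε Ω A u) :
    ∃ (v : E (k + 1) → E (k + 1)) (N : Set (E (k + 1))),
      (MemGSBVp A p v ∧
      ENNReal.ofReal (α * (1 - δ) ^ (2 * (k + 1) + 1)) *
        ∫⁻ x in A, ENNReal.ofReal (W (symPart (approxGrad v x))) ≤ energy Ω p f W ε u A ∧
      μHE[k] (jumpSet A v) ≤ ENNReal.ofReal (2 / (δ * b)) * energy Ω p f W ε u A ∧
      MemLp v 1 (volume.restrict A)) ∧
      IsTruncatedAverage Ω A W u a b δ ε v ∧ MeasurableSet N ∧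
      ENNReal.ofReal b * volume (A ∩ N) ≤ ENNReal.ofReal ε * energy Ω p f W ε u A ∧
      ∀ x ∈ A, v x = (⨍ y in ball x ((1 - δ) * ε), u y) ∨ x ∈ N ∧ v x = 0 := by
  set K := concSet Ω A W u a b δ ε with hKdef
  have hδε : 0 < δ * ε := mul_pos h.delta_pos h.eps_pos
  have hδ := h.delta_pos
  have hb := h.b_pos
  have hε := h.eps_pos
  -- `infDist` to the empty set is `0` by default, whereas `concNhd` uses `infEDist`, which is then
  -- `⊤`. With `K` empty the average is left uncut.
  rcases K.eq_empty_or_nonempty with hK | hK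
  · obtain ⟨h1, h2, h3, h4⟩ := h.truncated_average (isCut_univ A) (by simp)
      (fun x _ _ => by rw [← hKdef, hK]; exact notMem_empty x)
      (v := fun x => ⨍ y in ball x ((1 - δ) * ε), u y) (fun _ _ _ => rfl)
      (fun x _ hx => absurd (mem_univ x) hx)
    have hnhd : concNhd Ω A W u a b δ ε (δ * ε / 2) = ∅ := by
      refine eq_empty_of_forall_notMem fun x hx => ?_
      have := hx.2
      rw [← hKdef, hK, infEDist_empty, top_le_iff] at this
      exact ENNReal.ofReal_ne_top this
    refine ⟨_, ∅, ⟨h1, h4, ?_, h3⟩, ⟨δ * ε / 2, by positivity, by linarith, fun _ _ => rfl, ?_⟩,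
      MeasurableSet.empty, by simp, fun x _ => Or.inl rfl⟩
    · rw [subset_eq_empty h2 (inter_empty A), measure_empty]
      exact zero_le
    · rw [hnhd]
      exact fun x hx => absurd hx (notMem_empty x)
  obtain ⟨s, hs0, hs1, ν, hcut, hT⟩ := exists_isCut_infDist h.isOpen h.isCompact hK hδε
  have hNm : MeasurableSet {x | infDist x K < δ * ε} :=
    (isOpen_lt (continuous_infDist_pt K) continuous_const).measurableSet
  have hN : ENNReal.ofReal b * volume (A ∩ {x | infDist x K < δ * ε}) ≤
      ENNReal.ofReal ε * energy Ω p f W ε u A := by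
    rw [energy_eq hε h.memW1p, ← setLIntegral_const]
    refine (setLIntegral_mono' (h.isOpen.measurableSet.inter hNm) fun y hy => ?_).trans
      (lintegral_mono_set inter_subset_left)
    obtain ⟨x, hx, hxy⟩ := (infDist_lt_iff hK).1 hy.2
    exact ENNReal.ofReal_le_ofReal (h.b_le hx hy.1 hxy)
  have hAN : volume (A ∩ {x | infDist x K < δ * ε}) < ⊤ :=
    (measure_mono (inter_subset_left.trans h.subset)).trans_lt h.volume_domain.lt_top
  have hTfin : μHE[k + 1 - 1] (A ∩ {x | infDist x K = s}) < ⊤ :=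
    hT.trans_lt (ENNReal.mul_lt_top ENNReal.ofReal_lt_top hAN)
  have hmemS : ∀ x ∈ A, (x ∈ concNhd Ω A W u a b δ ε s ↔ ¬ s < infDist x K) := fun x hx => by
    rw [not_lt, infDist, ← ENNReal.le_ofReal_iff_toReal_le (infEDist_ne_top hK) hs0.le]
    exact and_iff_right hx
  set v : E (k + 1) → E (k + 1) :=
    {x | s < infDist x K}.indicator fun x => ⨍ y in ball x ((1 - δ) * ε), u y with hv
  have hvS : ∀ x, s < infDist x K → v x = ⨍ y in ball x ((1 - δ) * ε), u y := fun x hx =>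
    indicator_of_mem (show x ∈ {x | s < infDist x K} from hx) _
  have hvn : ∀ x, ¬ s < infDist x K → v x = 0 := fun x hx =>
    indicator_of_notMem (show x ∉ {x | s < infDist x K} from hx) _
  obtain ⟨h1, h2, h3, h4⟩ := h.truncated_average hcut hTfin
    (fun x _ (hx : s < infDist x K) hxK => by
      rw [infDist_zero_of_mem hxK] at hx
      exact absurd hx hs0.not_gt) (v := v)
    (fun x _ hx => hvS x hx) (fun x _ hx => hvn x hx)
  refine ⟨v, {x | infDist x K < δ * ε}, ⟨h1, h4, ?_, h3⟩, ⟨s, hs0, hs1, fun x hx => ?_,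
    fun x hx => ?_⟩, hNm, hN, fun x hx => ?_⟩
  -- The level costs `2/(δε)` times the strip's volume, and the volume is at most `ε F / b`; `ε`
  -- cancels, leaving `2/(δb)`.
  · calc μHE[k] (jumpSet A v) ≤ μHE[k] (A ∩ {x | infDist x K = s}) := measure_mono h2
      _ ≤ ENNReal.ofReal (2 / (δ * ε)) * volume (A ∩ {x | infDist x K < δ * ε}) := hT
      _ = ENNReal.ofReal (2 / (δ * b * ε)) *
          (ENNReal.ofReal b * volume (A ∩ {x | infDist x K < δ * ε})) := by
          rw [← mul_assoc, ← ENNReal.ofReal_mul (by positivity)]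
          congr 2
          field_simp
      _ ≤ ENNReal.ofReal (2 / (δ * b * ε)) * (ENNReal.ofReal ε * energy Ω p f W ε u A) := by
          gcongr
      _ = _ := by
          rw [← mul_assoc, ← ENNReal.ofReal_mul (by positivity)]
          congr 2
          field_simp
  · exact hvS x (not_not.1 fun hn => hx.2 ((hmemS x hx.1).2 hn))
  · exact hvn x ((hmemS x hx.1).1 hx)
  · by_cases hxs : s < infDist x K
    · exact Or.inl (hvS x hxs)
    · exact Or.inr ⟨(not_lt.1 hxs).trans_lt hs1, hvn x hxs⟩

/-! ### Convergence in `L¹` and smooth competitors -/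

lemma eventually_ball_subset {Ω A : Set (E d)} (hΩ : IsOpen Ω) (hAc : IsCompact (closure A))
    (hAΩ : closure A ⊆ Ω) {ι : Type*} {l : Filter ι} {ε : ι → ℝ} (hε : Tendsto ε l (𝓝 0)) :
    ∀ᶠ i in l, ∀ x ∈ A, ball x (ε i) ⊆ Ω := by
  obtain ⟨ρ, hρ, h⟩ := hAc.exists_thickening_subset_open hΩ hAΩ
  filter_upwards [hε.eventually_lt_const hρ] with i hi x hx
  exact ((ball_subset_ball hi.le).trans
    (ball_subset_thickening (subset_closure hx) ρ)).trans h

/-- Averages over small balls, set to zero on sets of small measure, converge in `L¹`. -/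
lemma eventually_truncated_close {Ω A : Set (E d)} (hΩ : IsOpen Ω) (hΩfin : volume Ω ≠ ⊤)
    (hA : IsOpen A) (hAΩ : A ⊆ Ω) {ι : Type*} {l : Filter ι} {ε : ι → ℝ} (hε₀ : ∀ i, 0 < ε i)
    (hε : Tendsto ε l (𝓝 0)) {u : ι → E d → E d} {u₀ : E d → E d} (hu : ∀ i, IntegrableOn (u i) Ω)
    (hu₀ : IntegrableOn u₀ Ω)
    (hlim : Tendsto (fun i => eLpNorm (u i - u₀) 1 (volume.restrict Ω)) l (𝓝 0))
    {b δ : ℝ} (hb : 0 < b) (hδ₀ : 0 < δ) (hδ₁ : δ < 1) {F : ι → ℝ≥0∞} (C : ℝ≥0) {η : ℝ≥0∞}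
    (hη : 0 < η) :
    ∀ᶠ i in l, (∀ x ∈ A, ball x (ε i) ⊆ Ω) → F i ≤ C → ∀ (v : E d → E d) (N : Set (E d)),
      MeasurableSet N → ENNReal.ofReal b * volume (A ∩ N) ≤ ENNReal.ofReal (ε i) * F i →
      (∀ x ∈ A, v x = (⨍ y in ball x ((1 - δ) * ε i), u i y) ∨ x ∈ N ∧ v x = 0) →
      eLpNorm (v - u₀) 1 (volume.restrict A) ≤ η := by
  have hAm := hA.measurableSet
  have hη3 : η / 3 ≠ 0 := (ENNReal.div_pos hη.ne' (by simp)).ne'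
  have hint : Integrable (Ω.indicator u₀) := hu₀.integrable_indicator hΩ.measurableSet
  -- The error has three parts: averaging the limit over small balls, the distance of `u i` from the
  -- limit, and the mass of the limit on the zeroed set. The bound `F i ≤ C` is assumed index by
  -- index, so that the lemma also applies when the energies are unbounded.
  obtain ⟨ρ, hρ, hclose⟩ := exists_average_ball_close (A := A) hint
    (measure_ne_top_of_subset hAΩ hΩfin) hη3
  obtain ⟨κ, hκ, hsmall⟩ := exists_pos_setLIntegral_lt_of_measure_lt
    (hu₀.mono_set hAΩ).2.ne hη3
  have hmeas : Tendsto (fun i => ENNReal.ofReal (ε i) * C / ENNReal.ofReal b) l (𝓝 0) := by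
    have h1 : Tendsto (fun i => ENNReal.ofReal (ε i)) l (𝓝 0) := by
      have := ENNReal.tendsto_ofReal hε
      rwa [ENNReal.ofReal_zero] at this
    have h2 : Tendsto (fun i => ENNReal.ofReal (ε i) * ((C : ℝ≥0∞) / ENNReal.ofReal b)) l
        (𝓝 (0 * ((C : ℝ≥0∞) / ENNReal.ofReal b))) :=
      ENNReal.Tendsto.mul_const h1
        (Or.inr (ENNReal.div_ne_top ENNReal.coe_ne_top (by simpa using hb)))
    rw [zero_mul] at h2
    exact h2.congr fun i => (mul_div_assoc _ _ _).symm
  filter_upwards [hε.eventually_lt_const hρ, hmeas.eventually_lt_const hκ,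
    (ENNReal.tendsto_nhds_zero.1 hlim) (η / 3) (pos_iff_ne_zero.2 hη3)]
    with i hi1 hi2 hi3 hball hF v N hN hvol hv
  have hr : 0 < (1 - δ) * ε i := mul_pos (by linarith) (hε₀ i)
  have hrlt : (1 - δ) * ε i < ρ := by nlinarith [hε₀ i]
  have hrle : (1 - δ) * ε i ≤ ε i := by nlinarith [hε₀ i]
  have hvolN : (volume.restrict A) N < κ := by
    rw [Measure.restrict_apply hN, inter_comm]
    refine lt_of_le_of_lt ?_ hi2
    rw [ENNReal.le_div_iff_mul_le (Or.inl (by simpa using hb)) (Or.inl ENNReal.ofReal_ne_top),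
      mul_comm]
    exact hvol.trans (by gcongr)
  rw [eLpNorm_one_eq_lintegral_enorm] at hi3 ⊢
  have hpt : ∀ x ∈ A, ‖(v - u₀) x‖ₑ ≤
      ‖(⨍ y in ball x ((1 - δ) * ε i), u i y) - u₀ x‖ₑ + N.indicator (fun x => ‖u₀ x‖ₑ) x := by
    intro x hx
    rcases hv x hx with h | ⟨hxN, h⟩
    · rw [Pi.sub_apply, h]
      exact le_self_add
    · rw [Pi.sub_apply, h, zero_sub, enorm_neg, indicator_of_mem hxN]
      exact le_add_self
  calc ∫⁻ x in A, ‖(v - u₀) x‖ₑ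
      ≤ ∫⁻ x in A, (‖(⨍ y in ball x ((1 - δ) * ε i), u i y) - u₀ x‖ₑ +
          N.indicator (fun x => ‖u₀ x‖ₑ) x) := setLIntegral_mono' hAm hpt
    _ = (∫⁻ x in A, ‖(⨍ y in ball x ((1 - δ) * ε i), u i y) - u₀ x‖ₑ) +
          ∫⁻ x in N, ‖u₀ x‖ₑ ∂(volume.restrict A) := by
        rw [lintegral_add_right' _ ((hu₀.mono_set hAΩ).1.enorm.indicator hN),
          lintegral_indicator hN]
    _ ≤ (η / 3 + η / 3) + η / 3 := by
        refine add_le_add ((lintegral_average_sub_le hΩ.measurableSet (hu i) hu₀ hr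
          (fun x hx => (ball_subset_ball hrle).trans (hball x hx)) hAΩ hAm).trans
          (add_le_add hi3 (hclose _ hr hrlt))) (hsmall N hvolN).le
    _ = η := ENNReal.add_thirds η

/-- Competitors without jumps. They satisfy the surface estimate for free, and the bulk estimate as
soon as the energy exceeds their own bulk term. -/
lemma memGSBVp_of_contDiff {A : Set (E d)} (hA : IsOpen A) (hAfin : volume A ≠ ⊤)
    {φ : E d → E d} (hφ : ContDiff ℝ 1 φ) (hc : HasCompactSupport φ) (p : ℝ) :
    MemGSBVp A p φ ∧ jumpSet A φ = ∅ ∧ MemLp φ 1 (volume.restrict A) ∧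
      ∀ᵐ x ∂(volume.restrict A), approxGrad φ x = fderiv ℝ φ x := by
  obtain ⟨C, hC⟩ := (hφ.continuous_fderiv one_ne_zero).bounded_above_of_compact_support
    (hc.fderiv ℝ)
  obtain ⟨h1, h2, h3⟩ := (isCut_univ A).memGSBVp hA hAfin hφ.contDiffOn (fun x _ => hC x)
    (v := φ) (fun _ _ _ => rfl) (fun x _ hx => absurd (mem_univ x) hx) p (by simp)
  refine ⟨h1, subset_eq_empty h2 (inter_empty A), ?_, by simpa using h3⟩
  exact (hφ.continuous.memLp_of_hasCompactSupport hc).restrict A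

lemma lintegral_bulk_lt_top {p : ℝ} {W : Matrix (Fin d) (Fin d) ℝ → ℝ} (hW : IsBulkDensity p W)
    (hp : 0 < p) {A : Set (E d)} (hAfin : volume A ≠ ⊤) {φ : E d → E d} (h : MemGSBVp A p φ) :
    ∫⁻ x in A, ENNReal.ofReal (W (symPart (approxGrad φ x))) < ⊤ := by
  have := (hW.integrableOn_comp_symPart hp hAfin h.grad_Lp).2
  refine (lintegral_mono fun x => ?_).trans_lt this
  rw [← ofReal_norm, Real.norm_of_nonneg (hW.nonneg _)]

end Griffith

end

/-! ### Choice of the approximating functions -/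

open Griffith
theorem proposition5p1 (f : ℝ → ℝ) (α β : ℝ) (hf : IsProfile f α β)
    (δ : ℝ) (hδ₀ : 0 < δ) (hδ₁ : δ < 1) :
    -- `M`, and the constants `a`, `b` of the construction, depend on `f` and `δ` only
    ∃ (M : ℝ≥0) (a b : ℝ), 0 < a ∧ 0 < b ∧ α * (1 - δ) ≤ a ∧
      (∀ t : ℝ, 0 ≤ t → min (a * t) b ≤ f t) ∧
      ∀ (d : ℕ), 1 ≤ d → ∀ (p : ℝ), 1 < p →
      ∀ (W : Matrix (Fin d) (Fin d) ℝ → ℝ), IsBulkDensity p W →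
      ∀ (Ω A : Set (E d)), IsOpen Ω → Bornology.IsBounded Ω → IsOpen A →
        IsCompact (closure A) → closure A ⊆ Ω →
      -- a family of parameters `ε i > 0` tending to zero, and functions `u i → u` in `L¹(Ω)`
      ∀ {ι : Type*} (l : Filter ι) (ε : ι → ℝ), (∀ i, 0 < ε i) → Tendsto ε l (𝓝 0) →
      ∀ (u : ι → E d → E d) (u₀ : E d → E d), (∀ i, MemW1p Ω p (u i)) →
        MemLp u₀ 1 (volume.restrict Ω) →
        Tendsto (fun i => eLpNorm (u i - u₀) 1 (volume.restrict Ω)) l (𝓝 0) →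
      ∃ v : ι → E d → E d,
        (∀ i, MemGSBVp A p (v i)) ∧
        (∀ i, ENNReal.ofReal (α * (1 - δ) ^ (2 * d + 1)) *
            ∫⁻ x in A, ENNReal.ofReal (W (symPart (approxGrad (v i) x)))
              ≤ energy Ω p f W (ε i) (u i) A) ∧
        (∀ i, μHE[d - 1] (jumpSet A (v i)) ≤ M * energy Ω p f W (ε i) (u i) A) ∧
        (∀ i, MemLp (v i) 1 (volume.restrict A)) ∧
        Tendsto (fun i => eLpNorm (v i - u₀) 1 (volume.restrict A)) l (𝓝 0) ∧
        -- if the energies stay bounded, the `v i` are truncated ball averages of the `u i`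
        -- as soon as the balls of radius `ε i` centred in `A` are contained in `Ω`
        ((∃ C : ℝ≥0, ∀ᶠ i in l, energy Ω p f W (ε i) (u i) A ≤ C) →
          ∀ i, (∀ x ∈ A, ball x (ε i) ⊆ Ω) →
            IsTruncatedAverage Ω A W (u i) a b δ (ε i) (v i)) := by
  classical
  obtain ⟨b, hb, hmin⟩ := hf.exists_min_le hδ₀ hδ₁
  have hα := hf.alpha_pos
  have hδ' : 0 < 1 - δ := by linarith
  have ha : 0 < α * (1 - δ) := mul_pos hα hδ'
  refine ⟨Real.toNNReal (2 / (δ * b)), α * (1 - δ), b, ha, hb, le_rfl, hmin, ?_⟩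
  intro d hd p hp W hW Ω A hΩ hΩb hA hAc hAΩ ι l ε hε₀ hε u u₀ hu hu₀ hlim
  obtain ⟨k, rfl⟩ := Nat.exists_eq_add_of_le' hd
  have hΩfin := volume_ne_top_of_isBounded hΩb
  have hAsub : A ⊆ Ω := subset_closure.trans hAΩ
  have hAfin : volume A ≠ ⊤ := measure_ne_top_of_subset hAsub hΩfin
  have hu₀i : IntegrableOn u₀ Ω := memLp_one_iff_integrable.1 hu₀
  have hu₀A : MemLp u₀ 1 (volume.restrict A) := hu₀.mono_measure (Measure.restrict_mono hAsub le_rfl)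
  set F : ι → ℝ≥0∞ := fun i => energy Ω p f W (ε i) (u i) A with hFdef
  have hball := eventually_ball_subset hΩ hAc hAΩ hε
  have htrunc : ∀ i, (∀ x ∈ A, ball x (ε i) ⊆ Ω) → _ := fun i hi =>
    IsConfig.exists_truncated (⟨hp, hW, hf, hδ₀, hδ₁, ha, hb, le_rfl, hmin, hΩ, hΩb, hA, hAc,
      hε₀ i, hi, hu i⟩ : IsConfig (k + 1) p W f α β (α * (1 - δ)) b δ (ε i) Ω A (u i))
  -- `v i` is meaningful only where the balls stay in `Ω`; at the other indices it is an arbitrary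
  -- value.
  choose! v N hadm htr hN hvol hpt using htrunc
  have hclose : ∀ (C : ℝ≥0) (η : ℝ≥0∞), 0 < η → ∀ᶠ i in l, F i ≤ C →
      (∀ x ∈ A, ball x (ε i) ⊆ Ω) ∧ eLpNorm (v i - u₀) 1 (volume.restrict A) ≤ η := by
    intro C η hη
    filter_upwards [hball, eventually_truncated_close hΩ hΩfin hA hAsub hε₀ hε
      (fun i => integrableOn_of_memLp_of_one_lt hΩfin hp (hu i).1) hu₀i hlim hb hδ₀ hδ₁
      (F := F) C hη] with i h1 h2 hF
    exact ⟨h1, h2 h1 hF (v i) (N i) (hN i h1) (hvol i h1) (hpt i h1)⟩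
  -- All that is demanded at a single index. The zero function always qualifies, so this class is
  -- never empty.
  let Adm : ι → (E (k + 1) → E (k + 1)) → Prop := fun i v => MemGSBVp A p v ∧
    ENNReal.ofReal (α * (1 - δ) ^ (2 * (k + 1) + 1)) *
      ∫⁻ x in A, ENNReal.ofReal (W (symPart (approxGrad v x))) ≤ F i ∧
    μHE[k] (jumpSet A v) ≤ ENNReal.ofReal (2 / (δ * b)) * F i ∧ MemLp v 1 (volume.restrict A)
  have hsmooth : ∀ φ : E (k + 1) → E (k + 1), ContDiff ℝ 1 φ → HasCompactSupport φ → ∀ i,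
      ENNReal.ofReal (α * (1 - δ) ^ (2 * (k + 1) + 1)) *
        ∫⁻ x in A, ENNReal.ofReal (W (symPart (approxGrad φ x))) ≤ F i → Adm i φ := by
    intro φ hφ hc i hi
    obtain ⟨h1, h2, h3, -⟩ := memGSBVp_of_contDiff hA hAfin hφ hc p
    refine ⟨h1, hi, ?_, h3⟩
    rw [h2, measure_empty]
    exact zero_le
  have hzero : ∀ i, Adm i 0 := fun i => by
    refine hsmooth 0 contDiff_zero_fun HasCompactSupport.zero i ?_
    obtain ⟨-, -, -, h4⟩ := memGSBVp_of_contDiff hA hAfin (φ := (0 : E (k + 1) → E (k + 1)))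
      contDiff_zero_fun HasCompactSupport.zero p
    rw [lintegral_congr_ae (g := 0), Pi.zero_def, lintegral_zero, mul_zero]
    · exact zero_le
    · filter_upwards [h4] with x hx
      rw [hx, fderiv_zero, Pi.zero_apply, symPart_zero, hW.map_zero]
      simp
  suffices hmain : ∃ v' : ι → E (k + 1) → E (k + 1), (∀ i, Adm i (v' i)) ∧
      Tendsto (fun i => eLpNorm (v' i - u₀) 1 (volume.restrict A)) l (𝓝 0) ∧
      ((∃ C : ℝ≥0, ∀ᶠ i in l, F i ≤ C) → ∀ i, (∀ x ∈ A, ball x (ε i) ⊆ Ω) →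
        IsTruncatedAverage Ω A W (u i) (α * (1 - δ)) b δ (ε i) (v' i)) by
    obtain ⟨v', h1, h2, h3⟩ := hmain
    exact ⟨v', fun i => (h1 i).1, fun i => (h1 i).2.1, fun i => (h1 i).2.2.1,
      fun i => (h1 i).2.2.2, h2, h3⟩
  by_cases hbd : ∃ C : ℝ≥0, ∀ᶠ i in l, F i ≤ C
  -- The balls are eventually contained in `Ω`, so the indices where zero is used do not affect the
  -- limit.
  · refine ⟨fun i => if ∀ x ∈ A, ball x (ε i) ⊆ Ω then v i else 0, fun i => ?_, ?_,
      fun _ i hi => ?_⟩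
    · by_cases hi : ∀ x ∈ A, ball x (ε i) ⊆ Ω
      · simp only [if_pos hi]
        exact hadm i hi
      · simp only [if_neg hi]
        exact hzero i
    · obtain ⟨C, hC⟩ := hbd
      refine ENNReal.tendsto_nhds_zero.2 fun η hη => ?_
      filter_upwards [hC, hclose C η hη] with i h1 h2
      rw [if_pos (h2 h1).1]
      exact (h2 h1).2
    · simp only [if_pos hi]
      exact htr i hi
  -- Energies may be small at some indices and large at others, with no common threshold. An
  -- admissible function that is `L¹`-optimal up to `ε i` does at least as well, up to that slack,
  -- as any competitor chosen for a given accuracy.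
  · have hmin' : ∀ i, ∃ w, Adm i w ∧ ∀ w', Adm i w' → eLpNorm (w - u₀) 1 (volume.restrict A) ≤
        eLpNorm (w' - u₀) 1 (volume.restrict A) + ENNReal.ofReal (ε i) := by
      intro i
      set m : ℝ≥0∞ := ⨅ (w) (_ : Adm i w), eLpNorm (w - u₀) 1 (volume.restrict A) with hm
      have hmtop : m ≠ ⊤ := by
        refine ne_top_of_le_ne_top ?_ (iInf₂_le 0 (hzero i))
        rw [zero_sub, eLpNorm_neg]
        exact hu₀A.2.ne
      have hlt : m < m + ENNReal.ofReal (ε i) :=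
        ENNReal.lt_add_right hmtop (by simpa using hε₀ i)
      obtain ⟨w, hw⟩ := iInf_lt_iff.1 hlt
      obtain ⟨hwA, hw⟩ := iInf_lt_iff.1 hw
      exact ⟨w, hwA, fun w' hw' => hw.le.trans (by gcongr; exact iInf₂_le w' hw')⟩
    choose w hwA hw using hmin'
    refine ⟨w, hwA, ENNReal.tendsto_nhds_zero.2 fun η hη => ?_, fun h => absurd h hbd⟩
    have hη2 : 0 < η / 2 := ENNReal.half_pos hη.ne'
    obtain ⟨θ, hθ0, hθ⟩ : ∃ θ : ℝ, 0 < θ ∧ ENNReal.ofReal θ ≤ η / 2 := by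
      obtain ⟨q, hq0, hq⟩ := ENNReal.lt_iff_exists_nnreal_btwn.1 hη2
      exact ⟨q, by exact_mod_cast hq0, by rw [ENNReal.ofReal_coe_nnreal]; exact hq.le⟩
    obtain ⟨φ, hφc, hφ, hφu⟩ := hu₀A.exist_eLpNorm_sub_le ENNReal.one_ne_top le_rfl hθ0
    have hφ1 : ContDiff ℝ 1 φ := hφ.of_le (by exact_mod_cast le_top)
    -- The threshold `C` is the weighted bulk energy of a smooth `φ` close to the limit: above it
    -- `φ` is admissible, below it the truncated averages converge.
    have hfin := ENNReal.mul_lt_top (a := ENNReal.ofReal (α * (1 - δ) ^ (2 * (k + 1) + 1)))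
      ENNReal.ofReal_lt_top (lintegral_bulk_lt_top hW (by linarith) hAfin
        (memGSBVp_of_contDiff hA hAfin hφ1 hφc p).1)
    obtain ⟨C, hC⟩ : ∃ C : ℝ≥0, (C : ℝ≥0∞) = _ := ⟨_, ENNReal.coe_toNNReal hfin.ne⟩
    filter_upwards [hclose C (η / 2) hη2, hε.eventually_lt_const hθ0] with i h1 h2
    have hεi : ENNReal.ofReal (ε i) ≤ η / 2 := (ENNReal.ofReal_le_ofReal h2.le).trans hθ
    rw [← ENNReal.add_halves η]
    rcases le_total (F i) C with h | h
    · exact (hw i (v i) (hadm i (h1 h).1)).trans (add_le_add (h1 h).2 hεi)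
    · refine (hw i φ (hsmooth φ hφ1 hφc i (hC ▸ h))).trans (add_le_add ?_ hεi)
      rw [eLpNorm_sub_comm]
      exact hφu.trans hθ
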